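/- **Setting.** Let $(X,\mu)$ be a $\sigma$-finite measure space, $H$ a complex Hilbert space and $\mathcal H=L^2(X,\mu;H)$. Let $\tau$ denote the trace, with values in $[0,\infty]$ on positive operators, $\chi_\Omega$ multiplication by the characteristic function of $\Omega$, and $\|\cdot\|_{2,2}$ the operator norm on $\mathcal H$. For a bounded positive operator $P$ on $\mathcal H$ let $$\nu_P(\Omega)=\tau(\chi_\Omega P\chi_\Omega)=\tau(P^{1/2}\chi_\Omega P^{1/2})\qquad(\Omega\subset X\text{ measurable}),$$ which is a measure absolutely continuous with respect to $\mu$; let $D\nu_P=d\nu_P/d\mu$ be its Radon–Nikodym derivative and $D(P)=\|D\nu_P\|_\infty=\sup_\Omega \nu_P(\Omega)/\mu(\Omega)$. **Theorem.** Let $A$ be a positive self-adjoint (possibly unbounded) operator on $\mathcal H$. Suppose that its spectral projections $\Pi_\lambda=\chi_A(]0,\lambda])$ have finite density $F(\lambda)=D(\Pi_\lambda)<\infty$ for all $\lambda$, and that the Stieltjes integral $$G(\lambda)=\int_0^\lambda\frac{dF(u)}{u}$$ converges for all $\lambda$ (here $F=0$ on $]-\infty,0]$ and the integral is over $[0,\lambda]$;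 in particular $F(0^+)=0$). Put $G^{-1}(y)=\sup\{\lambda\ge 0 : G(\lambda)\le y\}\in[0,\infty]$. Let $\rho$ be a bounded positive operator on $\mathcal H$ with $\rho=0$ on $\ker A$. Then $$\int_X G^{-1}\Bigl(\frac{D\nu_\rho(x)}{4\,\|\rho^{1/2}A\rho^{1/2}\|_{2,2}}\Bigr)\,d\nu_\rho(x)\;\le\;4\,\mathcal E(\rho),\qquad \mathcal E(\rho)=\tau(\rho^{1/2}A\rho^{1/2})\in[0,\infty].$$ Moreover $\mathcal E(\rho)=\tau(A^{1/2}\rho A^{1/2})$, and if $A\rho$ is everywhere defined and of trace class, then $\mathcal E(\rho)$ is finite and $\mathcal E(\rho)=\tau(A\rho)$. Here $\rho^{1/2}A\rho^{1/2}$ stands for the quadratic form $f\mapsto\|A^{1/2}\rho^{1/2}f\|^2\in[0,\infty]$, with value $\infty$ where $\rho^{1/2}f\notin\mathrm{dom}\,A^{1/2}$; its norm is the supremum over the unit ball and its trace the sum over a Hilbert basis, either of which may be $\infty$ (with $a/\infty=0$). The trace $\tau(A^{1/2}\rho A^{1/2})$ is the supremum of $\sum_i\|\rho^{1/2}A^{1/2}f_i\|^2$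 over the finite orthonormal families $(f_i)$ in $\mathrm{dom}\,A^{1/2}$. -/

import Mathlib

open MeasureTheory
open scoped ENNReal

noncomputable section

namespace MixedState

/-! ## Operators, traces and quadratic forms on a complex Hilbert space -/

section Hilbert

variable {E : Type*} [NormedAddCommGroup E] [InnerProductSpace ℂ E] [CompleteSpace E]

/-- The positive square root `T^{1/2}` of a bounded positive operator. -/
def opSqrt (T : E →L[ℂ] E) : E →L[ℂ] E := CFC.sqrt T

lemma inner_opSqrt (T : E →L[ℂ] E) (f g : E) :
    inner ℂ f (opSqrt T g) = inner ℂ (opSqrt T f) g :=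
  (((ContinuousLinearMap.nonneg_iff_isPositive _).1 (CFC.sqrt_nonneg T)).isSymmetric f g).symm

lemma opSqrt_mul_self (T : E →L[ℂ] E) (hT : T.IsPositive) : opSqrt T * opSqrt T = T :=
  CFC.sqrt_mul_sqrt_self T ((ContinuousLinearMap.nonneg_iff_isPositive _).2 hT)

variable (E) in
/-- The index set of a fixed Hilbert basis of `E`. -/
def basisIndex : Set E := (exists_hilbertBasis ℂ E).choose

variable (E) in
/-- A fixed Hilbert basis of `E`. -/
def stdBasis : HilbertBasis (basisIndex E) ℂ E := (exists_hilbertBasis ℂ E).choose_spec.choose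

/-- The trace `∑ᵢ q(eᵢ) ∈ [0, ∞]` of a nonnegative quadratic form `q` on `E`. -/
def formTrace (q : E → ℝ≥0∞) : ℝ≥0∞ := ∑' i, q (stdBasis E i)

/-- The norm `sup_{‖f‖ ≤ 1} q(f) ∈ [0, ∞]` of a nonnegative quadratic form `q` on `E`, that is the
operator norm of the associated positive operator. -/
def formNorm (q : E → ℝ≥0∞) : ℝ≥0∞ := ⨆ (f : E) (_ : ‖f‖ ≤ 1), q f

/-- The trace `τ(T) = ∑ᵢ ⟨eᵢ, T eᵢ⟩ ∈ [0, ∞]` of a bounded positive operator. -/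
def trace (T : E →L[ℂ] E) : ℝ≥0∞ :=
  formTrace fun f => ENNReal.ofReal (inner ℂ f (T f)).re

/-- Hilbert--Schmidt operators. -/
def IsHilbertSchmidt (T : E →L[ℂ] E) : Prop := formTrace (fun f => ‖T f‖ₑ ^ 2) ≠ ∞

/-- Trace class operators: the products of two Hilbert--Schmidt operators (equivalently, those with
`τ(|T|) < ∞`). -/
def IsTraceClass (T : E →L[ℂ] E) : Prop :=
  ∃ S R : E →L[ℂ] E, IsHilbertSchmidt S ∧ IsHilbertSchmidt R ∧ T = S * R

/-- Parseval: `∑ᵢ ‖T eᵢ‖² = ∑ᵢ ‖T* eᵢ‖²`. -/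
lemma formTrace_adjoint (T : E →L[ℂ] E) :
    formTrace (fun f => ‖T f‖ₑ ^ 2) = formTrace (fun f => ‖ContinuousLinearMap.adjoint T f‖ₑ ^ 2) := by
  have key : ∀ x : E, ‖x‖ₑ ^ 2 = ∑' i, ‖inner ℂ (stdBasis E i) x‖ₑ ^ 2 := by
    intro x
    have h := (stdBasis E).hasSum_inner_mul_inner x x
    have h2 : HasSum (fun i => ‖inner ℂ (stdBasis E i) x‖ ^ 2) (‖x‖ ^ 2) := by
      have h3 := Complex.hasSum_re h
      convert h3 using 1
      · ext i
        rw [← inner_conj_symm x, mul_comm, Complex.mul_conj, Complex.ofReal_re,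
          Complex.normSq_eq_norm_sq]
      · exact norm_sq_eq_re_inner (𝕜 := ℂ) x
    have h4 : ∀ y : ℂ, ‖y‖ₑ ^ 2 = ENNReal.ofReal (‖y‖ ^ 2) := fun y => by
      rw [ENNReal.ofReal_pow (norm_nonneg _), ofReal_norm]
    simp_rw [h4]
    rw [← ENNReal.ofReal_tsum_of_nonneg (fun i => by positivity) h2.summable, h2.tsum_eq,
      ENNReal.ofReal_pow (norm_nonneg _), ofReal_norm]
  unfold formTrace
  simp_rw [key]
  rw [ENNReal.tsum_comm]
  refine tsum_congr fun i => tsum_congr fun j => ?_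
  rw [ContinuousLinearMap.adjoint_inner_right, ← inner_conj_symm]
  congr 1
  exact RCLike.enorm_conj _

end Hilbert

/-! ## Spectral calculus of a self-adjoint operator -/

/-- The Lebesgue--Stieltjes measure `dF` of a nondecreasing function `F`; it gives `]a, b]` the
mass `F(b+) - F(a+)` and `{a}` the mass `F(a+) - F(a-)`. -/
def stieltjesMeasure (F : ℝ → ℝ) : Measure ℝ :=
  open Classical in if h : Monotone F then h.stieltjesFunction.measure else 0

section Spectral

variable {E : Type*} [NormedAddCommGroup E] [InnerProductSpace ℂ E] [CompleteSpace E]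

/-- A resolution of the identity `(P_t)`, `t ∈ ℝ`: orthogonal projections, nondecreasing and
strongly right continuous in `t`, with strong limits `0` at `-∞` and `1` at `+∞`. -/
structure IsSpectralFamily (P : ℝ → E →L[ℂ] E) : Prop where
  isStarProjection : ∀ t, IsStarProjection (P t)
  mono : ∀ s t, s ≤ t → P s * P t = P s
  rightCont : ∀ t f, ContinuousWithinAt (fun s => P s f) (Set.Ici t) t
  tendsto_atBot : ∀ f, Filter.Tendsto (fun s => P s f) Filter.atBot (nhds 0)
  tendsto_atTop : ∀ f, Filter.Tendsto (fun s => P s f) Filter.atTop (nhds f)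

/-- The scalar spectral measure `d⟨P_t f, f⟩ = d‖P_t f‖²`. -/
def scalarMeasure (P : ℝ → E →L[ℂ] E) (f : E) : Measure ℝ :=
  stieltjesMeasure fun t => ‖P t f‖ ^ 2

/-- `S = ∫ φ(t) dP_t`: the domain of `S` consists of the `f` such that `∫ φ(t)² d⟨P_t f, f⟩ < ∞`,
and `⟨f, S f⟩ = ∫ φ(t) d⟨P_t f, f⟩` there. -/
structure IsSpectralIntegral (P : ℝ → E →L[ℂ] E) (φ : ℝ → ℝ) (S : E →ₗ.[ℂ] E) : Prop where
  mem_domain_iff : ∀ f : E,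
    f ∈ S.domain ↔ ∫⁻ t, ENNReal.ofReal (φ t ^ 2) ∂(scalarMeasure P f) < ∞
  inner_eq : ∀ f : S.domain,
    inner ℂ (f : E) (S f) = ((∫ t, φ t ∂(scalarMeasure P f) : ℝ) : ℂ)

/-- The spectral family `E_t = χ_A(]-∞, t])` of a self-adjoint operator `A`: the resolution of the
identity with `A = ∫ t dE_t`. -/
def spectralFamily (A : E →ₗ.[ℂ] E) : ℝ → E →L[ℂ] E :=
  open Classical in
  if h : ∃ P : ℝ → E →L[ℂ] E, IsSpectralFamily P ∧ IsSpectralIntegral P id A then h.choose else 0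

/-- The operator `φ(A) = ∫ φ(t) dE_t`, for a self-adjoint operator `A`. -/
def funCalc (A : E →ₗ.[ℂ] E) (φ : ℝ → ℝ) : E →ₗ.[ℂ] E :=
  open Classical in
  if h : ∃ S : E →ₗ.[ℂ] E, IsSpectralIntegral (spectralFamily A) φ S then h.choose else ⊥

/-- The square root `A^{1/2}` of a positive self-adjoint operator `A`. -/
def sqrtOp (A : E →ₗ.[ℂ] E) : E →ₗ.[ℂ] E := funCalc A Real.sqrt

/-- The spectral projection `Π_l = χ_A(]0, l])`; it vanishes when `l ≤ 0`. -/
def spectralProj (A : E →ₗ.[ℂ] E) (l : ℝ) : E →L[ℂ] E :=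
  spectralFamily A (max l 0) - spectralFamily A 0

/-- The energy `⟨A f, f⟩ = ‖A^{1/2} f‖² = ∫ t d⟨E_t f, f⟩` of `f`, for `A` positive self-adjoint;
it is `∞` when `f` is not in the domain of `A^{1/2}`. -/
def energy (A : E →ₗ.[ℂ] E) (f : E) : ℝ≥0∞ :=
  ∫⁻ t, ENNReal.ofReal t ∂(scalarMeasure (spectralFamily A) f)

/-- The positive operator `ρ^{1/2} A ρ^{1/2} = (A^{1/2} ρ^{1/2})* (A^{1/2} ρ^{1/2})`, as the quadratic
form `f ↦ ⟨A ρ^{1/2} f, ρ^{1/2} f⟩ = ‖A^{1/2} ρ^{1/2} f‖² ∈ [0, ∞]`. -/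
def sandwichForm (A : E →ₗ.[ℂ] E) (ρ : E →L[ℂ] E) (f : E) : ℝ≥0∞ := energy A (opSqrt ρ f)

/-- The trace `τ(S ρ S)`, for `S` densely defined and self-adjoint and `ρ` bounded and positive: the
supremum of `∑ᵢ ‖ρ^{1/2} S fᵢ‖²` over the finite orthonormal families in the domain of `S`. -/
def sandwichTrace (S : E →ₗ.[ℂ] E) (ρ : E →L[ℂ] E) : ℝ≥0∞ :=
  ⨆ (n : ℕ) (v : Fin n → S.domain) (_ : Orthonormal ℂ fun i => (v i : E)),
    ∑ i, ‖opSqrt ρ (S (v i))‖ₑ ^ 2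

end Spectral

/-! ## Density of an operator on `L²(X, H)` -/

section Density

variable {X : Type*} [MeasurableSpace X] {μ : Measure X}
variable {H : Type*} [NormedAddCommGroup H] [InnerProductSpace ℂ H] [CompleteSpace H]

/-- Multiplication by the characteristic function `χ_Ω` on `L²(X, H)`. -/
def chi (Ω : Set X) (hΩ : MeasurableSet Ω) : Lp H 2 μ →L[ℂ] Lp H 2 μ :=
  LinearMap.mkContinuous
    { toFun := fun f => ((Lp.memLp f).indicator hΩ).toLp (Ω.indicator f)
      map_add' := fun f g => by
        rw [← MemLp.toLp_add]
        refine MemLp.toLp_congr _ _ ?_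
        filter_upwards [Lp.coeFn_add f g] with x hx
        by_cases h : x ∈ Ω
        · simp only [Set.indicator_of_mem h, Pi.add_apply]
          exact hx
        · simp [h]
      map_smul' := fun c f => by
        rw [RingHom.id_apply, ← MemLp.toLp_const_smul]
        refine MemLp.toLp_congr _ _ ?_
        filter_upwards [Lp.coeFn_smul c f] with x hx
        by_cases h : x ∈ Ω
        · simp only [Set.indicator_of_mem h, Pi.smul_apply]
          exact hx
        · simp [h] }
    1 (fun f => by
      rw [one_mul]
      refine Lp.norm_le_norm_of_ae_le ?_
      filter_upwards [((Lp.memLp f).indicator hΩ).coeFn_toLp] with x hx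
      simp only [LinearMap.coe_mk, AddHom.coe_mk, hx]
      by_cases h : x ∈ Ω <;> simp [h])

lemma chi_coeFn (Ω : Set X) (hΩ : MeasurableSet Ω) (f : Lp H 2 μ) :
    chi Ω hΩ f =ᵐ[μ] Ω.indicator f :=
  ((Lp.memLp f).indicator hΩ).coeFn_toLp

lemma inner_chi (Ω : Set X) (hΩ : MeasurableSet Ω) (f g : Lp H 2 μ) :
    inner ℂ f (chi Ω hΩ g) = inner ℂ (chi Ω hΩ f) g := by
  rw [L2.inner_def, L2.inner_def]
  refine integral_congr_ae ?_
  filter_upwards [chi_coeFn Ω hΩ f, chi_coeFn Ω hΩ g] with x h1 h2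
  rw [h1, h2]
  by_cases h : x ∈ Ω <;> simp [h]

lemma ofReal_inner_chi (Ω : Set X) (hΩ : MeasurableSet Ω) (f : Lp H 2 μ) :
    ENNReal.ofReal (inner ℂ f (chi Ω hΩ f)).re = ∫⁻ x in Ω, ‖f x‖ₑ ^ 2 ∂μ := by
  have hint : Integrable (fun x => ‖f x‖ ^ 2) μ := (Lp.memLp f).integrable_norm_pow (by norm_num)
  have h1 : inner ℂ f (chi Ω hΩ f) = ((∫ x in Ω, ‖f x‖ ^ 2 ∂μ : ℝ) : ℂ) := by
    rw [L2.inner_def, ← integral_indicator hΩ, ← integral_complex_ofReal]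
    refine integral_congr_ae ?_
    filter_upwards [chi_coeFn Ω hΩ f] with x h1
    rw [h1]
    by_cases h : x ∈ Ω
    · simp [h, inner_self_eq_norm_sq_to_K]
    · simp [h]
  rw [h1, Complex.ofReal_re, ofReal_integral_eq_lintegral_ofReal hint.integrableOn
    (Filter.Eventually.of_forall fun x => by positivity)]
  refine lintegral_congr fun x => ?_
  rw [ENNReal.ofReal_pow (norm_nonneg _), ofReal_norm]

/-- `τ(P^{1/2} χ_Ω P^{1/2})` is the integral over `Ω` of the pointwise squared norms. -/
lemma trace_sqrt_chi_sqrt (P : Lp H 2 μ →L[ℂ] Lp H 2 μ) (Ω : Set X) (hΩ : MeasurableSet Ω) :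
    trace (opSqrt P * chi Ω hΩ * opSqrt P) =
      formTrace fun f => ∫⁻ x in Ω, ‖(opSqrt P f) x‖ₑ ^ 2 ∂μ := by
  have hs := inner_opSqrt P
  unfold trace
  congr 1
  ext f
  rw [← ofReal_inner_chi Ω hΩ]
  simp only [mul_apply_eq_comp, hs]

/-- The density measure `ν_P(Ω) = τ(P^{1/2} χ_Ω P^{1/2}) = τ(χ_Ω P χ_Ω)` of a bounded positive
operator `P` on `L²(X, H)`. -/
def densityMeasure (P : Lp H 2 μ →L[ℂ] Lp H 2 μ) : Measure X :=
  Measure.ofMeasurable (fun Ω hΩ => trace (opSqrt P * chi Ω hΩ * opSqrt P))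
    (by
      rw [trace_sqrt_chi_sqrt]
      simp [formTrace])
    (by
      intro Ω hΩ hd
      simp only [trace_sqrt_chi_sqrt]
      unfold formTrace
      rw [ENNReal.tsum_comm]
      exact tsum_congr fun i => lintegral_iUnion hΩ hd _)

lemma densityMeasure_apply (P : Lp H 2 μ →L[ℂ] Lp H 2 μ) {Ω : Set X} (hΩ : MeasurableSet Ω) :
    densityMeasure P Ω = trace (opSqrt P * chi Ω hΩ * opSqrt P) :=
  Measure.ofMeasurable_apply Ω hΩ

/-- The two expressions `τ(P^{1/2} χ_Ω P^{1/2})` and `τ(χ_Ω P χ_Ω)` agree. -/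
lemma densityMeasure_apply' (P : Lp H 2 μ →L[ℂ] Lp H 2 μ) (hP : P.IsPositive) {Ω : Set X}
    (hΩ : MeasurableSet Ω) :
    densityMeasure P Ω = trace (chi Ω hΩ * P * chi Ω hΩ) := by
  have hs := inner_opSqrt P
  have hPP := opSqrt_mul_self P hP
  have hidem : ∀ f : Lp H 2 μ, chi Ω hΩ (chi Ω hΩ f) = chi Ω hΩ f := by
    intro f
    refine Lp.ext ?_
    filter_upwards [chi_coeFn Ω hΩ (chi Ω hΩ f), chi_coeFn Ω hΩ f] with x h1 h2
    rw [h1]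
    by_cases h : x ∈ Ω
    · simp [h]
    · simp [h, h2]
  have hsq : ∀ g : Lp H 2 μ, ENNReal.ofReal (inner ℂ g g).re = ‖g‖ₑ ^ 2 := by
    intro g
    have : (inner ℂ g g).re = ‖g‖ ^ 2 := (norm_sq_eq_re_inner (𝕜 := ℂ) g).symm
    rw [this, ENNReal.ofReal_pow (norm_nonneg _), ofReal_norm]
  have hadj : ContinuousLinearMap.adjoint (chi Ω hΩ * opSqrt P) = opSqrt P * chi Ω hΩ := by
    symm
    rw [ContinuousLinearMap.eq_adjoint_iff]
    intro x y
    simp only [mul_apply_eq_comp]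
    rw [← hs, inner_chi]
  rw [densityMeasure_apply P hΩ]
  have h1 : trace (opSqrt P * chi Ω hΩ * opSqrt P)
      = formTrace (fun f => ‖(chi Ω hΩ * opSqrt P : Lp H 2 μ →L[ℂ] Lp H 2 μ) f‖ₑ ^ 2) := by
    unfold trace
    congr 1
    ext f
    rw [← hsq]
    simp only [mul_apply_eq_comp]
    rw [hs, ← inner_chi, hidem]
  have h2 : trace (chi Ω hΩ * P * chi Ω hΩ)
      = formTrace (fun f => ‖(opSqrt P * chi Ω hΩ : Lp H 2 μ →L[ℂ] Lp H 2 μ) f‖ₑ ^ 2) := by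
    unfold trace
    congr 1
    ext f
    rw [← hsq]
    nth_rewrite 1 [← hPP]
    simp only [mul_apply_eq_comp]
    rw [inner_chi, hs]
  rw [h1, h2, formTrace_adjoint, hadj]

lemma densityMeasure_absolutelyContinuous (P : Lp H 2 μ →L[ℂ] Lp H 2 μ) :
    densityMeasure P ≪ μ := by
  refine Measure.AbsolutelyContinuous.mk fun Ω hΩ h => ?_
  rw [densityMeasure_apply P hΩ, trace_sqrt_chi_sqrt]
  have : μ.restrict Ω = 0 := Measure.restrict_eq_zero.2 h
  simp [formTrace, this]

/-- The density function `Dν_P = dν_P / dμ`. -/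
def densityFun (P : Lp H 2 μ →L[ℂ] Lp H 2 μ) : X → ℝ≥0∞ := (densityMeasure P).rnDeriv μ

/-- The density `D(P) = sup_Ω ν_P(Ω) / μ(Ω) ∈ [0, ∞]`, over the measurable `Ω ⊆ X` (with `0 / 0 = 0`).
-/
def density (P : Lp H 2 μ →L[ℂ] Lp H 2 μ) : ℝ≥0∞ :=
  ⨆ (Ω : Set X) (_ : MeasurableSet Ω), densityMeasure P Ω / μ Ω

/-- The spectral density `F(l) = D(Π_l)` of `A`; it vanishes for `l ≤ 0`. -/
def spectralDensity (A : Lp H 2 μ →ₗ.[ℂ] Lp H 2 μ) (l : ℝ) : ℝ≥0∞ := density (spectralProj A l)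

/-- The Stieltjes integral `G(l) = ∫_{[0, l]} dF(u) / u ∈ [0, ∞]`, where `F` vanishes on `]-∞, 0]`.
An atom of `dF` at `0`, of mass `F(0+)`, makes it infinite. -/
def stieltjesG (A : Lp H 2 μ →ₗ.[ℂ] Lp H 2 μ) (l : ℝ) : ℝ≥0∞ :=
  ∫⁻ u in Set.Icc 0 l, (ENNReal.ofReal u)⁻¹
    ∂(stieltjesMeasure fun t => (spectralDensity A t).toReal)

/-- The right continuous inverse `G⁻¹(y) = sup {l ≥ 0 | G(l) ≤ y} ∈ [0, ∞]`. -/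
def invG (A : Lp H 2 μ →ₗ.[ℂ] Lp H 2 μ) (y : ℝ≥0∞) : ℝ≥0∞ :=
  ⨆ (l : ℝ) (_ : 0 ≤ l) (_ : stieltjesG A l ≤ y), ENNReal.ofReal l

end Density

end MixedState

end

noncomputable section

namespace MixedState

open Set Filter Topology

/-!
Write `A = ∫ t dP_t` and `Π_l = P_l - P_0`. On `Ω`, the low energies of `ρ` are controlled by the
factorization `ρ^{1/2} Π_l = (ρ^{1/2} A^{1/2}) (A^{-1/2} Π_l)`: the trace of `χ_Ω A^{-1} Π_l χ_Ω` is
at most `μ(Ω) G(l)`, by a layer cake comparison of `s ↦ τ(χ_Ω Π_s χ_Ω)` with `μ(Ω) F(s)`, so that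
`τ(ρ^{1/2} Π_l χ_Ω Π_l ρ^{1/2}) ≤ ‖ρ^{1/2} A ρ^{1/2}‖ G(l) μ(Ω)`. Where
`Dν_ρ ≥ 4 ‖ρ^{1/2} A ρ^{1/2}‖ G(l)` this is at most a quarter of `ν_ρ(Ω)`, hence
`ν_ρ(Ω) ≤ 4 τ(ρ^{1/2} (1 - P_l) ρ^{1/2})`. Integrating over `l > 0` gives `4 𝓔(ρ)` on the right and
the integral of `G⁻¹(Dν_ρ / (4 ‖ρ^{1/2} A ρ^{1/2}‖))` on the left.

The trace identities pass to the limit in the bounded operators `A^{1/2} χ_A(]1/n, n])`, for which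
they are the cyclicity of the trace on products of Hilbert--Schmidt operators.

The spectral family of `A` is that of the resolvent `(1 + A)⁻¹`, whose projection at `t` is the one
onto the kernel of the positive part of `(1 + t)⁻¹ - (1 + A)⁻¹`.
-/

/-! ## The scalar measures of a spectral family -/

section SpectralFamily

variable {E : Type*} [NormedAddCommGroup E] [InnerProductSpace ℂ E] [CompleteSpace E]
  {P : ℝ → E →L[ℂ] E}

lemma inner_left_of_isSelfAdjoint {T : E →L[ℂ] E} (hT : IsSelfAdjoint T) (f g : E) :
    inner ℂ (T f) g = inner ℂ f (T g) :=
  hT.isSymmetric f g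

namespace IsSpectralFamily

lemma isSelfAdjoint (hP : IsSpectralFamily P) (t : ℝ) : IsSelfAdjoint (P t) :=
  (hP.isStarProjection t).isSelfAdjoint

lemma inner_left (hP : IsSpectralFamily P) (t : ℝ) (f g : E) :
    inner ℂ (P t f) g = inner ℂ f (P t g) :=
  inner_left_of_isSelfAdjoint (hP.isSelfAdjoint t) f g

lemma mul_eq_min (hP : IsSpectralFamily P) (s t : ℝ) : P s * P t = P (min s t) := by
  rcases le_total s t with h | h
  · rw [min_eq_left h, hP.mono s t h]
  · have := congrArg star (hP.mono t s h)
    rw [star_mul, (hP.isSelfAdjoint s).star_eq, (hP.isSelfAdjoint t).star_eq] at this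
    rw [min_eq_right h, this]

lemma apply_apply (hP : IsSpectralFamily P) (s t : ℝ) (f : E) : P s (P t f) = P (min s t) f :=
  congrArg (· f) (hP.mul_eq_min s t)

lemma commute (hP : IsSpectralFamily P) (s t : ℝ) : Commute (P s) (P t) := by
  rw [Commute, SemiconjBy, hP.mul_eq_min, hP.mul_eq_min, min_comm]

lemma inner_apply_self (hP : IsSpectralFamily P) (t : ℝ) (f : E) :
    inner ℂ f (P t f) = ((‖P t f‖ ^ 2 : ℝ) : ℂ) := by
  have h : P t (P t f) = P t f := by rw [hP.apply_apply, min_self]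
  rw [← h, ← hP.inner_left, h, inner_self_eq_norm_sq_to_K]
  norm_cast

lemma norm_sq_sub_apply (hP : IsSpectralFamily P) (t : ℝ) (f : E) :
    ‖f - P t f‖ ^ 2 = ‖f‖ ^ 2 - ‖P t f‖ ^ 2 := by
  rw [norm_sub_sq (𝕜 := ℂ), hP.inner_apply_self, RCLike.re_to_complex, Complex.ofReal_re]
  ring

lemma norm_apply_le (hP : IsSpectralFamily P) (t : ℝ) (f : E) : ‖P t f‖ ≤ ‖f‖ := by
  refine le_of_sq_le_sq ?_ (norm_nonneg f)
  linarith [hP.norm_sq_sub_apply t f, sq_nonneg ‖f - P t f‖]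

lemma monotone_norm_sq (hP : IsSpectralFamily P) (f : E) : Monotone fun t => ‖P t f‖ ^ 2 := by
  intro s t hst
  have := hP.norm_apply_le s (P t f)
  rw [hP.apply_apply, min_eq_left hst] at this
  dsimp only
  gcongr

lemma coe_stieltjesFunction (hP : IsSpectralFamily P) (f : E) :
    ((hP.monotone_norm_sq f).stieltjesFunction : ℝ → ℝ) = fun t => ‖P t f‖ ^ 2 := by
  ext t
  rw [Monotone.stieltjesFunction_eq]
  exact rightLim_eq_of_tendsto (((hP.rightCont t f).mono Ioi_subset_Ici_self).norm.pow 2)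

lemma scalarMeasure_eq (hP : IsSpectralFamily P) (f : E) :
    scalarMeasure P f = (hP.monotone_norm_sq f).stieltjesFunction.measure := by
  rw [scalarMeasure, stieltjesMeasure, dif_pos (hP.monotone_norm_sq f)]

lemma scalarMeasure_univ (hP : IsSpectralFamily P) (f : E) :
    scalarMeasure P f univ = ENNReal.ofReal (‖f‖ ^ 2) := by
  rw [hP.scalarMeasure_eq, StieltjesFunction.measure_univ (l := 0) (u := ‖f‖ ^ 2), sub_zero]
  · simpa [hP.coe_stieltjesFunction] using (hP.tendsto_atBot f).norm.pow 2
  · simpa [hP.coe_stieltjesFunction] using (hP.tendsto_atTop f).norm.pow 2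

lemma isFiniteMeasure (hP : IsSpectralFamily P) (f : E) : IsFiniteMeasure (scalarMeasure P f) :=
  ⟨by rw [hP.scalarMeasure_univ]; exact ENNReal.ofReal_lt_top⟩

lemma scalarMeasure_Iic (hP : IsSpectralFamily P) (f : E) (t : ℝ) :
    scalarMeasure P f (Iic t) = ENNReal.ofReal (‖P t f‖ ^ 2) := by
  rw [hP.scalarMeasure_eq, StieltjesFunction.measure_Iic (l := 0), hP.coe_stieltjesFunction,
    sub_zero]
  simpa [hP.coe_stieltjesFunction] using (hP.tendsto_atBot f).norm.pow 2

lemma scalarMeasure_real_Iic (hP : IsSpectralFamily P) (f : E) (t : ℝ) :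
    (scalarMeasure P f).real (Iic t) = ‖P t f‖ ^ 2 := by
  rw [measureReal_def, hP.scalarMeasure_Iic, ENNReal.toReal_ofReal (by positivity)]

lemma scalarMeasure_real_univ (hP : IsSpectralFamily P) (f : E) :
    (scalarMeasure P f).real univ = ‖f‖ ^ 2 := by
  rw [measureReal_def, hP.scalarMeasure_univ, ENNReal.toReal_ofReal (by positivity)]

lemma scalarMeasure_Ioi (hP : IsSpectralFamily P) (f : E) (t : ℝ) :
    scalarMeasure P f (Ioi t) = ENNReal.ofReal (‖f - P t f‖ ^ 2) := by
  have := hP.isFiniteMeasure f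
  rw [← compl_Iic, measure_compl measurableSet_Iic (measure_ne_top _ _), hP.scalarMeasure_univ,
    hP.scalarMeasure_Iic, ← ENNReal.ofReal_sub _ (by positivity), hP.norm_sq_sub_apply]

lemma scalarMeasure_eq_of_real_Iic (hP : IsSpectralFamily P) (f : E) (ν : Measure ℝ)
    [IsFiniteMeasure ν] (h : ∀ t, ν.real (Iic t) = ‖P t f‖ ^ 2) : scalarMeasure P f = ν := by
  have := hP.isFiniteMeasure f
  refine Measure.ext_of_Iic _ _ fun t => ?_
  rw [← measureReal_eq_measureReal_iff, h, hP.scalarMeasure_real_Iic]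

end IsSpectralFamily

end SpectralFamily

/-! ## The bounded Borel functional calculus of a spectral family -/

/-- A bounded Borel function on the line, the argument of the bounded functional calculus. -/
structure IsBoundedBorel (φ : ℝ → ℝ) : Prop where
  measurable : Measurable φ
  exists_abs_le : ∃ C, ∀ t, |φ t| ≤ C

namespace IsBoundedBorel

variable {φ ψ : ℝ → ℝ}

lemma const (c : ℝ) : IsBoundedBorel fun _ => c := ⟨measurable_const, |c|, fun _ => le_rfl⟩

lemma add (hφ : IsBoundedBorel φ) (hψ : IsBoundedBorel ψ) :
    IsBoundedBorel fun t => φ t + ψ t := by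
  obtain ⟨C, hC⟩ := hφ.exists_abs_le
  obtain ⟨D, hD⟩ := hψ.exists_abs_le
  exact ⟨hφ.measurable.add hψ.measurable, C + D,
    fun t => (abs_add_le _ _).trans (add_le_add (hC t) (hD t))⟩

lemma mul (hφ : IsBoundedBorel φ) (hψ : IsBoundedBorel ψ) :
    IsBoundedBorel fun t => φ t * ψ t := by
  obtain ⟨C, hC⟩ := hφ.exists_abs_le
  obtain ⟨D, hD⟩ := hψ.exists_abs_le
  refine ⟨hφ.measurable.mul hψ.measurable, C * D, fun t => ?_⟩
  rw [abs_mul]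
  exact mul_le_mul (hC t) (hD t) (abs_nonneg _) ((abs_nonneg _).trans (hC t))

lemma const_mul (c : ℝ) (hφ : IsBoundedBorel φ) : IsBoundedBorel fun t => c * φ t :=
  (const c).mul hφ

lemma sub (hφ : IsBoundedBorel φ) (hψ : IsBoundedBorel ψ) :
    IsBoundedBorel fun t => φ t - ψ t := by
  simpa only [sub_eq_add_neg, neg_one_mul] using hφ.add (hψ.const_mul (-1))

lemma max_zero (hφ : IsBoundedBorel φ) : IsBoundedBorel fun t => max (φ t) 0 := by
  obtain ⟨C, hC⟩ := hφ.exists_abs_le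
  refine ⟨hφ.measurable.max measurable_const, C, fun t => ?_⟩
  rw [abs_of_nonneg (le_max_right _ _)]
  exact max_le ((le_abs_self _).trans (hC t)) ((abs_nonneg _).trans (hC t))

lemma indicator (hφ : IsBoundedBorel φ) {s : Set ℝ} (hs : MeasurableSet s) :
    IsBoundedBorel (s.indicator φ) := by
  obtain ⟨C, hC⟩ := hφ.exists_abs_le
  exact ⟨hφ.measurable.indicator hs, C, fun t => (norm_indicator_le_norm_self φ t).trans (hC t)⟩

lemma integrable (hφ : IsBoundedBorel φ) (ν : Measure ℝ) [IsFiniteMeasure ν] :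
    Integrable φ ν := by
  obtain ⟨C, hC⟩ := hφ.exists_abs_le
  exact Integrable.of_bound hφ.measurable.aestronglyMeasurable C (Eventually.of_forall hC)

end IsBoundedBorel

section WeakLimit

variable {E : Type*} [NormedAddCommGroup E] [InnerProductSpace ℂ E]

lemma continuousLinearMap_ext_inner_self {S T : E →L[ℂ] E}
    (h : ∀ f, inner ℂ f (S f) = inner ℂ f (T f)) : S = T := by
  refine ContinuousLinearMap.coe_injective ((ext_inner_map _ _).1 fun f => ?_)
  exact (inner_conj_symm (S f) f).symm.trans
    ((congrArg (starRingEnd ℂ) (h f)).trans (inner_conj_symm (T f) f))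

variable [CompleteSpace E]

lemma isSelfAdjoint_of_inner_self_ofReal {T : E →L[ℂ] E} {q : E → ℝ}
    (h : ∀ f, inner ℂ f (T f) = (q f : ℂ)) : IsSelfAdjoint T := by
  rw [ContinuousLinearMap.isSelfAdjoint_iff_isSymmetric,
    LinearMap.isSymmetric_iff_inner_map_self_real]
  intro f
  rw [inner_conj_symm]
  have := congrArg (starRingEnd ℂ) (h f)
  rw [inner_conj_symm, Complex.conj_ofReal] at this
  exact (h f).trans this.symm

/-- By polarization the forms `⟨x, Tₙ y⟩` converge; their limit is represented by a symmetric
everywhere defined operator, which is bounded by the Hellinger--Toeplitz theorem. -/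
lemma exists_weak_limit {T : ℕ → E →L[ℂ] E} {q : E → ℝ} (hT : ∀ n, IsSelfAdjoint (T n))
    (h : ∀ f, Tendsto (fun n => inner ℂ f (T n f)) atTop (𝓝 (q f : ℂ))) :
    ∃ S : E →L[ℂ] E, ∀ x y, Tendsto (fun n => inner ℂ x (T n y)) atTop (𝓝 (inner ℂ x (S y))) := by
  have hconv : ∀ x y, ∃ c, Tendsto (fun n => inner ℂ (T n x) y) atTop (𝓝 c) := by
    intro x y
    have h' : ∀ f, Tendsto (fun n => inner ℂ (T n f) f) atTop (𝓝 (q f : ℂ)) := fun f =>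
      (h f).congr fun n => ((hT n).isSymmetric f f).symm
    have hlim := ((((h' (x + y)).sub (h' (x - y))).sub ((h' (x + Complex.I • y)).const_mul
      Complex.I)).add ((h' (x - Complex.I • y)).const_mul Complex.I)).div_const 4
    refine ⟨_, hlim.congr fun n => ?_⟩
    exact (inner_map_polarization' (T n : E →ₗ[ℂ] E) x y).symm
  choose b hb using hconv
  let functional : E → StrongDual ℂ E := fun x =>
    continuousLinearMapOfTendsto (fun n => innerSL ℂ (T n x)) (tendsto_pi_nhds.2 (hb x))
  have hfunctional : ∀ x y, functional x y = b x y := fun x y => rfl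
  let S₀ : E → E := fun x => (InnerProductSpace.toDual ℂ E).symm (functional x)
  have hS₀ : ∀ x y, Tendsto (fun n => inner ℂ (T n x) y) atTop (𝓝 (inner ℂ (S₀ x) y)) := by
    intro x y
    rw [InnerProductSpace.toDual_symm_apply, hfunctional]
    exact hb x y
  let S : E →ₗ[ℂ] E :=
    { toFun := S₀
      map_add' := fun x y => ext_inner_right ℂ fun z =>
        tendsto_nhds_unique (hS₀ (x + y) z) (by
          simpa only [map_add, inner_add_left] using (hS₀ x z).add (hS₀ y z))
      map_smul' := fun c x => ext_inner_right ℂ fun z =>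
        tendsto_nhds_unique (hS₀ (c • x) z) (by
          simpa only [map_smul, inner_smul_left, RingHom.id_apply] using
            (hS₀ x z).const_mul (starRingEnd ℂ c)) }
  have hsymm : S.IsSymmetric := by
    intro x y
    have hyx := (Complex.continuous_conj.tendsto _).comp (hS₀ y x)
    rw [inner_conj_symm] at hyx
    refine tendsto_nhds_unique (hS₀ x y) (hyx.congr fun n => ?_)
    rw [Function.comp_apply, inner_conj_symm]
    exact ((hT n).isSymmetric x y).symm
  refine ⟨⟨S, hsymm.continuous⟩, fun x y => ?_⟩
  have hxy := (hS₀ x y).congr fun n => (hT n).isSymmetric x y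
  rwa [show inner ℂ (S₀ x) y = inner ℂ x (S₀ y) from hsymm x y] at hxy

lemma commute_of_weak_limit {T : ℕ → E →L[ℂ] E} {S R : E →L[ℂ] E}
    (h : ∀ x y, Tendsto (fun n => inner ℂ x (T n y)) atTop (𝓝 (inner ℂ x (S y))))
    (hR : ∀ n, Commute R (T n)) : Commute R S := by
  refine ContinuousLinearMap.ext fun y => ext_inner_left ℂ fun x => ?_
  have hleft := h (ContinuousLinearMap.adjoint R x) y
  simp only [ContinuousLinearMap.adjoint_inner_left] at hleft
  refine tendsto_nhds_unique hleft ((h x (R y)).congr fun n => ?_)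
  exact congrArg (inner ℂ x) (congrArg (· y) (hR n).eq).symm

end WeakLimit

section BorelCalculus

variable {E : Type*} [NormedAddCommGroup E] [InnerProductSpace ℂ E] {P : ℝ → E →L[ℂ] E}
  {φ ψ : ℝ → ℝ} {S T : E →L[ℂ] E}

/-- `T = ∫ φ(t) dP_t` as a bounded operator. Membership in the bicommutant of the family is
recorded because it passes to weak limits, whereas multiplicativity in `φ` does not. -/
structure IsBorelCalc (P : ℝ → E →L[ℂ] E) (φ : ℝ → ℝ) (T : E →L[ℂ] E) : Prop where
  inner_self : ∀ f, inner ℂ f (T f) = ((∫ t, φ t ∂(scalarMeasure P f) : ℝ) : ℂ)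
  commute : ∀ R, (∀ t, Commute R (P t)) → Commute R T

namespace IsBorelCalc

lemma unique (hS : IsBorelCalc P φ S) (hT : IsBorelCalc P φ T) : S = T :=
  continuousLinearMap_ext_inner_self fun f => (hS.inner_self f).trans (hT.inner_self f).symm

protected lemma zero : IsBorelCalc P (fun _ => 0) 0 where
  inner_self f := by simp
  commute R _ := Commute.zero_right R

variable [CompleteSpace E]

lemma isSelfAdjoint (hT : IsBorelCalc P φ T) : IsSelfAdjoint T :=
  isSelfAdjoint_of_inner_self_ofReal hT.inner_self

protected lemma one (hP : IsSpectralFamily P) : IsBorelCalc P (fun _ => 1) 1 where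
  inner_self f := by
    rw [integral_const, smul_eq_mul, mul_one, hP.scalarMeasure_real_univ,
      one_apply_eq_self, inner_self_eq_norm_sq_to_K]
    norm_cast
  commute R _ := Commute.one_right R

lemma indicator_Iic (hP : IsSpectralFamily P) (t : ℝ) :
    IsBorelCalc P ((Iic t).indicator fun _ => 1) (P t) where
  inner_self f := by
    rw [hP.inner_apply_self, integral_indicator_const _ measurableSet_Iic,
      hP.scalarMeasure_real_Iic, smul_eq_mul, mul_one]
  commute R hR := hR t

lemma add (hP : IsSpectralFamily P) (hφ : IsBoundedBorel φ) (hψ : IsBoundedBorel ψ)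
    (hS : IsBorelCalc P φ S) (hT : IsBorelCalc P ψ T) :
    IsBorelCalc P (fun t => φ t + ψ t) (S + T) where
  inner_self f := by
    have := hP.isFiniteMeasure f
    rw [integral_add (hφ.integrable _) (hψ.integrable _), add_apply, inner_add_right,
      hS.inner_self, hT.inner_self, Complex.ofReal_add]
  commute R hR := (hS.commute R hR).add_right (hT.commute R hR)

omit [CompleteSpace E] in
lemma const_smul (hT : IsBorelCalc P φ T) (c : ℝ) :
    IsBorelCalc P (fun t => c * φ t) ((c : ℂ) • T) where
  inner_self f := by
    rw [integral_const_mul, smul_apply, inner_smul_right, hT.inner_self,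
      Complex.ofReal_mul]
  commute R hR := (hT.commute R hR).smul_right _

lemma sub (hP : IsSpectralFamily P) (hφ : IsBoundedBorel φ) (hψ : IsBoundedBorel ψ)
    (hS : IsBorelCalc P φ S) (hT : IsBorelCalc P ψ T) :
    IsBorelCalc P (fun t => φ t - ψ t) (S - T) := by
  have h := hS.add hP hφ (hψ.const_mul (-1)) (hT.const_smul (-1))
  simpa [sub_eq_add_neg] using h

lemma exists_of_tendsto (hP : IsSpectralFamily P) {u : ℕ → ℝ → ℝ} {C : ℝ}
    (hu : ∀ n, Measurable (u n)) (hC : ∀ n t, |u n t| ≤ C)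
    (hlim : ∀ t, Tendsto (fun n => u n t) atTop (𝓝 (φ t)))
    (h : ∀ n, ∃ T, IsBorelCalc P (u n) T) : ∃ T, IsBorelCalc P φ T := by
  choose T hT using h
  have hq : ∀ f, Tendsto (fun n => inner ℂ f (T n f)) atTop
      (𝓝 ((∫ t, φ t ∂(scalarMeasure P f) : ℝ) : ℂ)) := by
    intro f
    have := hP.isFiniteMeasure f
    simp only [(hT _).inner_self]
    refine (Complex.continuous_ofReal.tendsto _).comp ?_
    exact tendsto_integral_of_dominated_convergence (fun _ => C)
      (fun n => (hu n).aestronglyMeasurable) (integrable_const C)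
      (fun n => Eventually.of_forall (hC n)) (Eventually.of_forall hlim)
  obtain ⟨S, hS⟩ := exists_weak_limit (fun n => (hT n).isSelfAdjoint) hq
  exact ⟨S, fun f => tendsto_nhds_unique (hS f f) (hq f),
    fun R hR => commute_of_weak_limit hS fun n => (hT n).commute R hR⟩

lemma exists_indicator (hP : IsSpectralFamily P) {s : Set ℝ} (hs : MeasurableSet s) :
    ∃ T, IsBorelCalc P (s.indicator fun _ => 1) T := by
  have hone := IsBoundedBorel.const 1
  induction s, hs using MeasurableSpace.induction_on_inter (borel_eq_generateFrom_Iic ℝ)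
    isPiSystem_Iic with
  | empty => exact ⟨0, by simpa only [indicator_empty] using IsBorelCalc.zero⟩
  | basic _ h =>
    obtain ⟨t, rfl⟩ := h
    exact ⟨P t, indicator_Iic hP t⟩
  | compl s hs h =>
    obtain ⟨T, hT⟩ := h
    refine ⟨1 - T, ?_⟩
    rw [indicator_compl]
    exact (IsBorelCalc.one hP).sub hP hone (hone.indicator hs) hT
  | iUnion s hdisj hs h =>
    have hmeas : ∀ n, MeasurableSet (accumulate s n) := fun n =>
      .biUnion (to_countable _) fun i _ => hs i
    refine exists_of_tendsto hP (u := fun n => (accumulate s n).indicator fun _ => 1) (C := 1)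
      (fun n => measurable_const.indicator (hmeas n)) (fun n t => ?_) (fun t => ?_) fun n => ?_
    · exact (norm_indicator_le_norm_self (fun _ => (1 : ℝ)) t).trans (by simp)
    · rw [← iUnion_accumulate]
      exact (monotone_accumulate.tendsto_indicator _ _ _).mono_right (pure_le_nhds _)
    · induction n with
      | zero => simpa only [accumulate_zero_nat] using h 0
      | succ n ih =>
        obtain ⟨S, hS⟩ := ih
        obtain ⟨T, hT⟩ := h (n + 1)
        refine ⟨S + T, ?_⟩
        rw [accumulate_succ, indicator_union_of_disjoint (disjoint_accumulate hdisj n.lt_succ_self)]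
        exact hS.add hP (hone.indicator (hmeas n)) (hone.indicator (hs _)) hT

lemma exists_simpleFunc (hP : IsSpectralFamily P) (u : SimpleFunc ℝ ℝ) :
    ∃ T, IsBorelCalc P u T := by
  have hbdd : ∀ v : SimpleFunc ℝ ℝ, IsBoundedBorel v := fun v =>
    ⟨v.measurable, v.exists_forall_norm_le⟩
  induction u using SimpleFunc.induction with
  | const c hs =>
    obtain ⟨T, hT⟩ := exists_indicator hP hs
    refine ⟨_, (?_ : (fun t => c * _) = _) ▸ hT.const_smul c⟩
    ext t
    simp [indicator, Set.piecewise]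
  | add _ hu hv =>
    obtain ⟨S, hS⟩ := hu
    obtain ⟨T, hT⟩ := hv
    exact ⟨S + T, hS.add hP (hbdd _) (hbdd _) hT⟩

end IsBorelCalc

lemma IsBoundedBorel.exists_isBorelCalc [CompleteSpace E] (hφ : IsBoundedBorel φ)
    (hP : IsSpectralFamily P) : ∃ T, IsBorelCalc P φ T := by
  obtain ⟨C, hC⟩ := hφ.exists_abs_le
  have hsm := hφ.measurable.stronglyMeasurable
  exact IsBorelCalc.exists_of_tendsto hP (fun n => (hsm.approxBounded C n).measurable)
    (hsm.norm_approxBounded_le ((abs_nonneg _).trans (hC 0)))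
    (fun t => hsm.tendsto_approxBounded_of_norm_le (hC t))
    fun n => IsBorelCalc.exists_simpleFunc hP _

/-- The bounded operator `φ(P) = ∫ φ(t) dP_t` for a bounded Borel function `φ`; it is `0` when no
such operator exists. -/
def borelCalc (P : ℝ → E →L[ℂ] E) (φ : ℝ → ℝ) : E →L[ℂ] E :=
  open Classical in if h : ∃ T, IsBorelCalc P φ T then h.choose else 0

lemma IsBorelCalc.borelCalc_eq (hT : IsBorelCalc P φ T) : borelCalc P φ = T := by
  have h : ∃ T, IsBorelCalc P φ T := ⟨T, hT⟩
  rw [borelCalc, dif_pos h]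
  exact h.choose_spec.unique hT

variable [CompleteSpace E]

lemma isBorelCalc_borelCalc (hP : IsSpectralFamily P) (hφ : IsBoundedBorel φ) :
    IsBorelCalc P φ (borelCalc P φ) := by
  obtain ⟨T, hT⟩ := hφ.exists_isBorelCalc hP
  rwa [hT.borelCalc_eq]

lemma isSelfAdjoint_borelCalc (hP : IsSpectralFamily P) (hφ : IsBoundedBorel φ) :
    IsSelfAdjoint (borelCalc P φ) :=
  (isBorelCalc_borelCalc hP hφ).isSelfAdjoint

lemma inner_borelCalc_self (hP : IsSpectralFamily P) (hφ : IsBoundedBorel φ) (f : E) :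
    inner ℂ f (borelCalc P φ f) = ((∫ t, φ t ∂(scalarMeasure P f) : ℝ) : ℂ) :=
  (isBorelCalc_borelCalc hP hφ).inner_self f

lemma borelCalc_indicator_Iic (hP : IsSpectralFamily P) (t : ℝ) :
    borelCalc P ((Iic t).indicator fun _ => 1) = P t :=
  (IsBorelCalc.indicator_Iic hP t).borelCalc_eq

lemma borelCalc_one (hP : IsSpectralFamily P) : borelCalc P (fun _ => 1) = 1 :=
  (IsBorelCalc.one hP).borelCalc_eq

lemma borelCalc_sub (hP : IsSpectralFamily P) (hφ : IsBoundedBorel φ) (hψ : IsBoundedBorel ψ) :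
    borelCalc P (fun t => φ t - ψ t) = borelCalc P φ - borelCalc P ψ :=
  ((isBorelCalc_borelCalc hP hφ).sub hP hφ hψ (isBorelCalc_borelCalc hP hψ)).borelCalc_eq

lemma commute_proj_borelCalc (hP : IsSpectralFamily P) (hφ : IsBoundedBorel φ) (t : ℝ) :
    Commute (P t) (borelCalc P φ) :=
  (isBorelCalc_borelCalc hP hφ).commute _ fun s => hP.commute t s

lemma commute_borelCalc (hP : IsSpectralFamily P) (hφ : IsBoundedBorel φ)
    (hψ : IsBoundedBorel ψ) : Commute (borelCalc P φ) (borelCalc P ψ) :=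
  (isBorelCalc_borelCalc hP hψ).commute _ fun t => (commute_proj_borelCalc hP hφ t).symm

lemma borelCalc_nonneg (hP : IsSpectralFamily P) (hφ : IsBoundedBorel φ) (h0 : ∀ t, 0 ≤ φ t) :
    0 ≤ borelCalc P φ := by
  refine (ContinuousLinearMap.nonneg_iff_isPositive _).2 ⟨?_, fun f => ?_⟩
  · exact (isSelfAdjoint_borelCalc hP hφ).isSymmetric
  · rw [ContinuousLinearMap.reApplyInnerSelf_apply, inner_re_symm, inner_borelCalc_self hP hφ]
    exact integral_nonneg h0

lemma scalarMeasure_proj (hP : IsSpectralFamily P) (t : ℝ) (f : E) :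
    scalarMeasure P (P t f) = (scalarMeasure P f).restrict (Iic t) := by
  have := hP.isFiniteMeasure f
  refine hP.scalarMeasure_eq_of_real_Iic _ _ fun s => ?_
  rw [measureReal_restrict_apply measurableSet_Iic, Iic_inter_Iic, hP.scalarMeasure_real_Iic,
    hP.apply_apply]

lemma measureReal_withDensity {α : Type*} [MeasurableSpace α] {ν : Measure α} {u : α → ℝ}
    (hu : Integrable u ν) (h0 : ∀ a, 0 ≤ u a) {s : Set α} (hs : MeasurableSet s) :
    (ν.withDensity fun a => ENNReal.ofReal (u a)).real s = ∫ a in s, u a ∂ν := by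
  rw [measureReal_def, withDensity_apply _ hs,
    integral_eq_lintegral_of_nonneg_ae (Eventually.of_forall h0) hu.aestronglyMeasurable.restrict]

/-- Multiplicativity of the calculus comes from here: `⟨f, φ(P) ψ(P) f⟩` is `∫ φ` against the
spectral measure of `ψ(P)^{1/2} f`. -/
lemma scalarMeasure_sqrt_borelCalc (hP : IsSpectralFamily P) (hψ : IsBoundedBorel ψ)
    (h0 : ∀ t, 0 ≤ ψ t) (f : E) :
    scalarMeasure P (CFC.sqrt (borelCalc P ψ) f) =
      (scalarMeasure P f).withDensity fun t => ENNReal.ofReal (ψ t) := by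
  have := hP.isFiniteMeasure f
  have hint := hψ.integrable (scalarMeasure P f)
  have := isFiniteMeasure_withDensity_ofReal hint.2
  refine hP.scalarMeasure_eq_of_real_Iic _ _ fun t => ?_
  set S := CFC.sqrt (borelCalc P ψ)
  have hS : IsSelfAdjoint S := .of_nonneg (CFC.sqrt_nonneg _)
  have hSS : S * S = borelCalc P ψ := CFC.sqrt_mul_sqrt_self _ (borelCalc_nonneg hP hψ h0)
  have hPS : P t * S = S * P t := ((commute_proj_borelCalc hP hψ t).symm.cfcₙ_nnreal _).symm.eq
  have hnorm : ((‖P t (S f)‖ ^ 2 : ℝ) : ℂ) = inner ℂ (P t f) (borelCalc P ψ (P t f)) :=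
    calc ((‖P t (S f)‖ ^ 2 : ℝ) : ℂ) = inner ℂ (S (P t f)) (S (P t f)) := by
          rw [show P t (S f) = S (P t f) from congrArg (· f) hPS, inner_self_eq_norm_sq_to_K]
          norm_cast
      _ = inner ℂ (P t f) ((S * S) (P t f)) := inner_left_of_isSelfAdjoint hS _ _
      _ = _ := by rw [hSS]
  rw [inner_borelCalc_self hP hψ, Complex.ofReal_inj, scalarMeasure_proj hP] at hnorm
  rw [measureReal_withDensity hint h0 measurableSet_Iic, hnorm]

lemma isBorelCalc_mul_of_nonneg (hP : IsSpectralFamily P) (hφ : IsBoundedBorel φ)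
    (hψ : IsBoundedBorel ψ) (h0 : ∀ t, 0 ≤ ψ t) :
    IsBorelCalc P (fun t => φ t * ψ t) (borelCalc P φ * borelCalc P ψ) where
  inner_self f := by
    have hS : IsSelfAdjoint (CFC.sqrt (borelCalc P ψ)) := .of_nonneg (CFC.sqrt_nonneg _)
    have hcomm : Commute (borelCalc P φ) (CFC.sqrt (borelCalc P ψ)) :=
      ((commute_borelCalc hP hψ hφ).cfcₙ_nnreal _).symm
    have hprod : borelCalc P φ * borelCalc P ψ =
        CFC.sqrt (borelCalc P ψ) * (borelCalc P φ * CFC.sqrt (borelCalc P ψ)) := by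
      rw [← mul_assoc, ← hcomm.eq, mul_assoc,
        CFC.sqrt_mul_sqrt_self _ (borelCalc_nonneg hP hψ h0)]
    rw [hprod]
    rw [mul_apply_eq_comp, ← inner_left_of_isSelfAdjoint hS, mul_apply_eq_comp,
      inner_borelCalc_self hP hφ, scalarMeasure_sqrt_borelCalc hP hψ h0, Complex.ofReal_inj,
      integral_withDensity_eq_integral_toReal_smul hψ.measurable.ennreal_ofReal
        (Eventually.of_forall fun t => ENNReal.ofReal_lt_top)]
    simp only [ENNReal.toReal_ofReal (h0 _), smul_eq_mul, mul_comm]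
  commute R hR := ((isBorelCalc_borelCalc hP hφ).commute R hR).mul_right
    ((isBorelCalc_borelCalc hP hψ).commute R hR)

lemma borelCalc_mul (hP : IsSpectralFamily P) (hφ : IsBoundedBorel φ) (hψ : IsBoundedBorel ψ) :
    borelCalc P (fun t => φ t * ψ t) = borelCalc P φ * borelCalc P ψ := by
  have hpos := hψ.max_zero
  have hneg := (hψ.const_mul (-1)).max_zero
  have hsplit : ψ = fun t => max (ψ t) 0 - max (-1 * ψ t) 0 := by
    ext t
    rw [neg_one_mul, max_zero_sub_max_neg_zero_eq_self]
  have h1 := (isBorelCalc_mul_of_nonneg hP hφ hpos fun t => le_max_right _ _).borelCalc_eq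
  have h2 := (isBorelCalc_mul_of_nonneg hP hφ hneg fun t => le_max_right _ _).borelCalc_eq
  rw [hsplit, borelCalc_sub hP hpos hneg, mul_sub, ← h1, ← h2,
    ← borelCalc_sub hP (hφ.mul hpos) (hφ.mul hneg)]
  simp only [mul_sub]

lemma borelCalc_apply_apply (hP : IsSpectralFamily P) (hφ : IsBoundedBorel φ)
    (hψ : IsBoundedBorel ψ) (f : E) :
    borelCalc P φ (borelCalc P ψ f) = borelCalc P (fun t => φ t * ψ t) f :=
  (congrArg (· f) (borelCalc_mul hP hφ hψ)).symm

lemma norm_sq_borelCalc (hP : IsSpectralFamily P) (hφ : IsBoundedBorel φ) (f : E) :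
    ‖borelCalc P φ f‖ ^ 2 = ∫ t, φ t ^ 2 ∂(scalarMeasure P f) := by
  have h := inner_borelCalc_self hP (hφ.mul hφ) f
  rw [← borelCalc_apply_apply hP hφ hφ,
    ← inner_left_of_isSelfAdjoint (isSelfAdjoint_borelCalc hP hφ), inner_self_eq_norm_sq_to_K] at h
  simpa [sq, ← Complex.ofReal_mul] using congrArg Complex.re h

lemma enorm_sq_borelCalc (hP : IsSpectralFamily P) (hφ : IsBoundedBorel φ) (f : E) :
    ‖borelCalc P φ f‖ₑ ^ 2 = ∫⁻ t, ENNReal.ofReal (φ t ^ 2) ∂(scalarMeasure P f) := by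
  have := hP.isFiniteMeasure f
  rw [← ofReal_norm, ← ENNReal.ofReal_pow (norm_nonneg _), norm_sq_borelCalc hP hφ,
    ofReal_integral_eq_lintegral_ofReal _ (Eventually.of_forall fun t => sq_nonneg _)]
  simpa only [sq] using (hφ.mul hφ).integrable _

end BorelCalculus

/-! ## Unbounded spectral integrals -/

section Truncation

variable {φ : ℝ → ℝ} {n : ℕ} {t : ℝ}

/-- The truncation `φ 1_{|φ| ≤ n}`. -/
def trunc (φ : ℝ → ℝ) (n : ℕ) : ℝ → ℝ := {t | |φ t| ≤ n}.indicator φ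

/-- The indicator function `1_{|φ| ≤ n}`. -/
def cutoff (φ : ℝ → ℝ) (n : ℕ) : ℝ → ℝ := {t | |φ t| ≤ n}.indicator fun _ => 1

lemma trunc_of_le (h : |φ t| ≤ n) : trunc φ n t = φ t :=
  indicator_of_mem (s := {t | |φ t| ≤ n}) h φ

lemma trunc_of_lt (h : n < |φ t|) : trunc φ n t = 0 :=
  indicator_of_notMem (s := {t | |φ t| ≤ n}) (not_le.2 h) φ

lemma abs_trunc_le (φ : ℝ → ℝ) (n : ℕ) (t : ℝ) : |trunc φ n t| ≤ |φ t| :=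
  norm_indicator_le_norm_self φ t

lemma abs_cutoff_le (φ : ℝ → ℝ) (n : ℕ) (t : ℝ) : |cutoff φ n t| ≤ 1 :=
  (norm_indicator_le_norm_self (fun _ => (1 : ℝ)) t).trans (by simp)

lemma isBoundedBorel_trunc (hφ : Measurable φ) (n : ℕ) : IsBoundedBorel (trunc φ n) := by
  refine ⟨hφ.indicator (measurableSet_le hφ.abs measurable_const), n, fun t => ?_⟩
  rcases le_or_gt |φ t| n with h | h
  · rwa [trunc_of_le h]
  · rw [trunc_of_lt h, abs_zero]
    positivity

lemma isBoundedBorel_cutoff (hφ : Measurable φ) (n : ℕ) : IsBoundedBorel (cutoff φ n) :=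
  (IsBoundedBorel.const 1).indicator (measurableSet_le hφ.abs measurable_const)

lemma eventually_abs_le (φ : ℝ → ℝ) (t : ℝ) : ∀ᶠ n : ℕ in atTop, |φ t| ≤ n := by
  obtain ⟨N, hN⟩ := exists_nat_ge |φ t|
  exact (eventually_ge_atTop N).mono fun n hn => hN.trans (by exact_mod_cast hn)

lemma tendsto_trunc (φ : ℝ → ℝ) (t : ℝ) : Tendsto (fun n => trunc φ n t) atTop (𝓝 (φ t)) :=
  tendsto_const_nhds.congr' ((eventually_abs_le φ t).mono fun _ h => (trunc_of_le h).symm)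

lemma tendsto_cutoff (φ : ℝ → ℝ) (t : ℝ) : Tendsto (fun n => cutoff φ n t) atTop (𝓝 1) :=
  tendsto_const_nhds.congr' ((eventually_abs_le φ t).mono fun n h =>
    (indicator_of_mem (s := {t | |φ t| ≤ n}) h fun _ => (1 : ℝ)).symm)

lemma mul_cutoff (φ : ℝ → ℝ) (n : ℕ) (t : ℝ) : φ t * cutoff φ n t = trunc φ n t := by
  rw [cutoff, ← indicator_mul_right, trunc]
  simp only [mul_one]

lemma monotone_trunc_sq (φ : ℝ → ℝ) (t : ℝ) : Monotone fun n => trunc φ n t ^ 2 := by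
  intro n m h
  dsimp only
  rcases le_or_gt |φ t| n with hn | hn
  · rw [trunc_of_le hn, trunc_of_le (hn.trans (by exact_mod_cast h))]
  · rw [trunc_of_lt hn, zero_pow two_ne_zero]
    exact sq_nonneg _

end Truncation

section SpectralIntegral

variable {E : Type*} [NormedAddCommGroup E] [InnerProductSpace ℂ E] {P : ℝ → E →L[ℂ] E}
  {φ ψ : ℝ → ℝ}

/-- The operator `∫ φ(t) dP_t`, for a measurable `φ`, as the strong limit of the bounded operators
attached to the truncations of `φ`, on the subspace where this limit exists. -/
def spectralIntegral (P : ℝ → E →L[ℂ] E) (φ : ℝ → ℝ) : E →ₗ.[ℂ] E where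
  domain :=
    { carrier := {f | ∃ g, Tendsto (fun n => borelCalc P (trunc φ n) f) atTop (𝓝 g)}
      add_mem' := by
        rintro f g ⟨f', hf⟩ ⟨g', hg⟩
        exact ⟨f' + g', by simpa only [map_add] using hf.add hg⟩
      zero_mem' := ⟨0, by simpa only [map_zero] using tendsto_const_nhds⟩
      smul_mem' := by
        rintro c f ⟨f', hf⟩
        exact ⟨c • f', by simpa only [map_smul] using hf.const_smul c⟩ }
  toFun :=
    { toFun := fun f => f.2.choose
      map_add' := fun f g => tendsto_nhds_unique (f + g).2.choose_spec (by
        simpa only [Submodule.coe_add, map_add] using f.2.choose_spec.add g.2.choose_spec)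
      map_smul' := fun c f => tendsto_nhds_unique (c • f).2.choose_spec (by
        simpa only [Submodule.coe_smul, map_smul, RingHom.id_apply] using
          f.2.choose_spec.const_smul c) }

lemma tendsto_spectralIntegral (f : (spectralIntegral P φ).domain) :
    Tendsto (fun n => borelCalc P (trunc φ n) f) atTop (𝓝 (spectralIntegral P φ f)) :=
  f.2.choose_spec

variable [CompleteSpace E]

lemma tendsto_borelCalc_zero (hP : IsSpectralFamily P) {ι : Type*} {l : Filter ι}
    [l.IsCountablyGenerated] {w : ι → ℝ → ℝ} (hw : ∀ i, IsBoundedBorel (w i)) {f : E} {b : ℝ → ℝ}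
    (hb : Integrable (fun t => b t ^ 2) (scalarMeasure P f)) (hwb : ∀ i t, |w i t| ≤ b t)
    (hlim : ∀ t, Tendsto (fun i => w i t) l (𝓝 0)) :
    Tendsto (fun i => borelCalc P (w i) f) l (𝓝 0) := by
  have hsq : Tendsto (fun i => ‖borelCalc P (w i) f‖ ^ 2) l (𝓝 0) := by
    simp only [norm_sq_borelCalc hP (hw _)]
    rw [← integral_zero ℝ ℝ (μ := scalarMeasure P f)]
    refine tendsto_integral_filter_of_dominated_convergence (fun t => b t ^ 2)
      (Eventually.of_forall fun i => ((hw i).measurable.pow_const 2).aestronglyMeasurable)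
      (Eventually.of_forall fun i => Eventually.of_forall fun t => ?_) hb
      (Eventually.of_forall fun t => ?_)
    · rw [Real.norm_of_nonneg (sq_nonneg _), ← sq_abs]
      exact pow_le_pow_left₀ (abs_nonneg _) (hwb i t) 2
    · simpa using (hlim t).pow 2
  exact tendsto_zero_iff_norm_tendsto_zero.2 (by simpa using hsq.sqrt)

lemma tendsto_borelCalc (hP : IsSpectralFamily P) {u : ℕ → ℝ → ℝ} (hu : ∀ n, IsBoundedBorel (u n))
    (hφ : IsBoundedBorel φ) {C : ℝ} (hC : ∀ n t, |u n t| ≤ C)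
    (hlim : ∀ t, Tendsto (fun n => u n t) atTop (𝓝 (φ t))) (f : E) :
    Tendsto (fun n => borelCalc P (u n) f) atTop (𝓝 (borelCalc P φ f)) := by
  have := hP.isFiniteMeasure f
  obtain ⟨D, hD⟩ := hφ.exists_abs_le
  rw [tendsto_iff_norm_sub_tendsto_zero, ← tendsto_zero_iff_norm_tendsto_zero]
  simp only [← sub_apply, ← borelCalc_sub hP (hu _) hφ]
  refine tendsto_borelCalc_zero hP (fun n => (hu n).sub hφ) (b := fun _ => C + D)
    (integrable_const _) (fun n t => (abs_sub _ _).trans (add_le_add (hC n t) (hD t))) fun t => ?_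
  simpa only [sub_self] using (hlim t).sub_const (φ t)

lemma cauchySeq_borelCalc (hP : IsSpectralFamily P) {u : ℕ → ℝ → ℝ}
    (hu : ∀ n, IsBoundedBorel (u n)) {f : E} {b : ℝ → ℝ}
    (hb : Integrable (fun t => b t ^ 2) (scalarMeasure P f)) (hub : ∀ n t, |u n t| ≤ b t)
    (hlim : ∀ t, Tendsto (fun n => u n t) atTop (𝓝 (φ t))) :
    CauchySeq fun n => borelCalc P (u n) f := by
  simp only [cauchySeq_iff_tendsto_dist_atTop_0, dist_eq_norm]
  rw [← tendsto_zero_iff_norm_tendsto_zero]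
  simp only [← sub_apply, ← borelCalc_sub hP (hu _) (hu _)]
  refine tendsto_borelCalc_zero hP (w := fun (p : ℕ × ℕ) t => u p.1 t - u p.2 t)
    (fun p => (hu p.1).sub (hu p.2)) (b := fun t => 2 * b t) ?_ (fun p t => ?_) fun t => ?_
  · simpa only [mul_pow] using hb.const_mul (2 ^ 2)
  · exact (abs_sub _ _).trans ((add_le_add (hub _ t) (hub _ t)).trans_eq (two_mul _).symm)
  · rw [← prod_atTop_atTop_eq, ← sub_self (φ t)]
    exact ((hlim t).comp tendsto_fst).sub ((hlim t).comp tendsto_snd)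

lemma exists_spectralIntegral_borelCalc (hP : IsSpectralFamily P) (hφ : Measurable φ)
    (hψ : IsBoundedBorel ψ) (hφψ : IsBoundedBorel fun t => φ t * ψ t) (f : E) :
    ∃ hf : borelCalc P ψ f ∈ (spectralIntegral P φ).domain,
      spectralIntegral P φ ⟨borelCalc P ψ f, hf⟩ = borelCalc P (fun t => φ t * ψ t) f := by
  obtain ⟨C, hC⟩ := hφψ.exists_abs_le
  have h : Tendsto (fun n => borelCalc P (trunc φ n) (borelCalc P ψ f)) atTop
      (𝓝 (borelCalc P (fun t => φ t * ψ t) f)) := by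
    simp only [borelCalc_apply_apply hP (isBoundedBorel_trunc hφ _) hψ]
    refine tendsto_borelCalc hP (fun n => (isBoundedBorel_trunc hφ n).mul hψ) hφψ (C := C)
      (fun n t => ?_) (fun t => (tendsto_trunc φ t).mul_const _) f
    refine le_trans ?_ (hC t)
    rw [abs_mul, abs_mul]
    exact mul_le_mul_of_nonneg_right (abs_trunc_le φ n t) (abs_nonneg _)
  exact ⟨⟨_, h⟩, tendsto_nhds_unique (tendsto_spectralIntegral ⟨_, ⟨_, h⟩⟩) h⟩

lemma borelCalc_spectralIntegral (hP : IsSpectralFamily P) (hφ : Measurable φ)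
    (hψ : IsBoundedBorel ψ) (hψφ : IsBoundedBorel fun t => ψ t * φ t)
    (f : (spectralIntegral P φ).domain) :
    borelCalc P ψ (spectralIntegral P φ f) = borelCalc P (fun t => ψ t * φ t) f := by
  obtain ⟨C, hC⟩ := hψφ.exists_abs_le
  refine tendsto_nhds_unique (((borelCalc P ψ).continuous.tendsto _).comp
    (tendsto_spectralIntegral f)) ?_
  simp only [Function.comp_def, borelCalc_apply_apply hP hψ (isBoundedBorel_trunc hφ _)]
  refine tendsto_borelCalc hP (fun n => hψ.mul (isBoundedBorel_trunc hφ n)) hψφ (C := C)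
    (fun n t => ?_) (fun t => (tendsto_trunc φ t).const_mul _) f
  refine le_trans ?_ (hC t)
  rw [abs_mul, abs_mul]
  exact mul_le_mul_of_nonneg_left (abs_trunc_le φ n t) (abs_nonneg _)

lemma mem_graph_spectralIntegral_iff (hP : IsSpectralFamily P) (hφ : Measurable φ)
    (h0 : ∀ t, 0 ≤ φ t) (x y : E) :
    (x, y) ∈ (spectralIntegral P φ).graph ↔ borelCalc P (fun t => (1 + φ t)⁻¹) (x + y) = x := by
  have hpos : ∀ t, 0 < 1 + φ t := fun t => by linarith [h0 t]
  have hr : IsBoundedBorel fun t => (1 + φ t)⁻¹ := by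
    refine ⟨(hφ.const_add 1).inv, 1, fun t => ?_⟩
    rw [abs_of_pos (inv_pos.2 (hpos t))]
    exact inv_le_one_of_one_le₀ (by linarith [h0 t])
  have h1 := (IsBoundedBorel.const 1).sub hr
  have hφr : (fun t => φ t * (1 + φ t)⁻¹) = fun t => 1 - (1 + φ t)⁻¹ := by
    ext t
    field_simp [(hpos t).ne']
    ring
  have hrφ : (fun t => (1 + φ t)⁻¹ * φ t) = fun t => 1 - (1 + φ t)⁻¹ := by
    simp only [← hφr, mul_comm]
  have hcalc : borelCalc P (fun t => 1 - (1 + φ t)⁻¹) = 1 - borelCalc P fun t => (1 + φ t)⁻¹ := by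
    rw [borelCalc_sub hP (IsBoundedBorel.const 1) hr, borelCalc_one hP]
  constructor
  · intro h
    obtain ⟨f, rfl, rfl⟩ := (LinearPMap.mem_graph_iff _).1 h
    rw [map_add, borelCalc_spectralIntegral hP hφ hr (hrφ ▸ h1), hrφ, hcalc, sub_apply,
      one_apply_eq_self, add_sub_cancel]
  · intro h
    obtain ⟨hx, hSx⟩ := exists_spectralIntegral_borelCalc hP hφ hr (hφr ▸ h1) (x + y)
    refine (LinearPMap.mem_graph_iff _).2 ⟨⟨_, hx⟩, h, ?_⟩
    rw [hSx, hφr, hcalc, sub_apply, one_apply_eq_self, h, add_sub_cancel_left]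

lemma tendsto_borelCalc_cutoff (hP : IsSpectralFamily P) (hφ : Measurable φ) (f : E) :
    Tendsto (fun n => borelCalc P (cutoff φ n) f) atTop (𝓝 f) := by
  have h := tendsto_borelCalc hP (isBoundedBorel_cutoff hφ) (IsBoundedBorel.const 1)
    (abs_cutoff_le φ) (tendsto_cutoff φ) f
  rwa [borelCalc_one hP] at h

lemma exists_spectralIntegral_cutoff (hP : IsSpectralFamily P) (hφ : Measurable φ) (n : ℕ)
    (f : E) :
    ∃ hf : borelCalc P (cutoff φ n) f ∈ (spectralIntegral P φ).domain,
      spectralIntegral P φ ⟨borelCalc P (cutoff φ n) f, hf⟩ = borelCalc P (trunc φ n) f := by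
  have h := exists_spectralIntegral_borelCalc hP hφ (isBoundedBorel_cutoff hφ n)
    (by simpa only [mul_cutoff] using isBoundedBorel_trunc hφ n) f
  simpa only [mul_cutoff] using h

lemma dense_domain_spectralIntegral (hP : IsSpectralFamily P) (hφ : Measurable φ) :
    Dense ((spectralIntegral P φ).domain : Set E) := fun f =>
  mem_closure_of_tendsto (tendsto_borelCalc_cutoff hP hφ f)
    (Eventually.of_forall fun n => (exists_spectralIntegral_cutoff hP hφ n f).1)

lemma monotone_enorm_sq_borelCalc_trunc (hP : IsSpectralFamily P) (hφ : Measurable φ) (f : E) :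
    Monotone fun n => ‖borelCalc P (trunc φ n) f‖ₑ ^ 2 := by
  intro n m h
  simp only [enorm_sq_borelCalc hP (isBoundedBorel_trunc hφ _)]
  exact lintegral_mono fun t => ENNReal.ofReal_le_ofReal (monotone_trunc_sq φ t h)

lemma iSup_enorm_sq_borelCalc_trunc (hP : IsSpectralFamily P) (hφ : Measurable φ) (f : E) :
    ⨆ n, ‖borelCalc P (trunc φ n) f‖ₑ ^ 2 =
      ∫⁻ t, ENNReal.ofReal (φ t ^ 2) ∂(scalarMeasure P f) := by
  simp only [enorm_sq_borelCalc hP (isBoundedBorel_trunc hφ _)]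
  have hmono : ∀ t, Monotone fun n => ENNReal.ofReal (trunc φ n t ^ 2) := fun t n m h =>
    ENNReal.ofReal_le_ofReal (monotone_trunc_sq φ t h)
  rw [← lintegral_iSup (fun n =>
    ((isBoundedBorel_trunc hφ n).measurable.pow_const 2).ennreal_ofReal) fun n m h t => hmono t h]
  exact lintegral_congr fun t =>
    iSup_eq_of_tendsto (hmono t) (ENNReal.tendsto_ofReal ((tendsto_trunc φ t).pow 2))

lemma memLp_two_of_lintegral_sq_lt_top {α : Type*} [MeasurableSpace α] {ν : Measure α}
    {u : α → ℝ} (hu : Measurable u) (h : ∫⁻ a, ENNReal.ofReal (u a ^ 2) ∂ν < ∞) : MemLp u 2 ν := by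
  refine (memLp_two_iff_integrable_sq hu.aestronglyMeasurable).2
    ⟨(hu.pow_const 2).aestronglyMeasurable, ?_⟩
  rwa [hasFiniteIntegral_iff_ofReal (Eventually.of_forall fun a => sq_nonneg _)]

lemma mem_domain_spectralIntegral (hP : IsSpectralFamily P) (hφ : Measurable φ) (f : E) :
    f ∈ (spectralIntegral P φ).domain ↔
      ∫⁻ t, ENNReal.ofReal (φ t ^ 2) ∂(scalarMeasure P f) < ∞ := by
  constructor
  · rintro ⟨g, hg⟩
    rw [← iSup_enorm_sq_borelCalc_trunc hP hφ f, iSup_eq_of_tendsto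
      (monotone_enorm_sq_borelCalc_trunc hP hφ f) (ENNReal.Tendsto.pow hg.enorm)]
    exact ENNReal.pow_lt_top enorm_lt_top
  · intro hf
    have hb : Integrable (fun t => |φ t| ^ 2) (scalarMeasure P f) := by
      simpa only [sq_abs] using (memLp_two_of_lintegral_sq_lt_top hφ hf).integrable_sq
    exact cauchySeq_tendsto_of_complete
      (cauchySeq_borelCalc hP (isBoundedBorel_trunc hφ) hb (abs_trunc_le φ) (tendsto_trunc φ))

lemma isSpectralIntegral_spectralIntegral (hP : IsSpectralFamily P) (hφ : Measurable φ) :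
    IsSpectralIntegral P φ (spectralIntegral P φ) where
  mem_domain_iff := mem_domain_spectralIntegral hP hφ
  inner_eq f := by
    have := hP.isFiniteMeasure (f : E)
    have hint : Integrable φ (scalarMeasure P f) := (memLp_two_of_lintegral_sq_lt_top hφ
      ((mem_domain_spectralIntegral hP hφ f).1 f.2)).integrable (by norm_num)
    refine tendsto_nhds_unique (tendsto_const_nhds.inner (tendsto_spectralIntegral f)) ?_
    simp only [inner_borelCalc_self hP (isBoundedBorel_trunc hφ _)]
    refine (Complex.continuous_ofReal.tendsto _).comp ?_
    exact tendsto_integral_of_dominated_convergence (fun t => |φ t|)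
      (fun n => (isBoundedBorel_trunc hφ n).measurable.aestronglyMeasurable) hint.abs
      (fun n => Eventually.of_forall (abs_trunc_le φ n)) (Eventually.of_forall (tendsto_trunc φ))

omit [CompleteSpace E] in
lemma eq_zero_of_inner_self_eq_zero {p : Submodule ℂ E} (hp : Dense (p : Set E)) (D : p →ₗ[ℂ] E)
    (h : ∀ f : p, inner ℂ (f : E) (D f) = 0) : D = 0 := by
  have hpolar : ∀ f g : p, inner ℂ (f : E) (D g) = 0 := by
    intro f g
    have h₁ := h (f + g)
    have h₂ := h (f + Complex.I • g)
    simp only [map_add, map_smul, Submodule.coe_add, Submodule.coe_smul, inner_add_left,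
      inner_add_right, inner_smul_left, inner_smul_right, h, Complex.conj_I] at h₁ h₂
    have h₃ : (2 * Complex.I) * inner ℂ (f : E) (D g) = 0 := by
      linear_combination h₂ + Complex.I * h₁
    simpa using h₃
  ext g
  exact hp.eq_zero_of_inner_right ℂ fun f hf => hpolar ⟨f, hf⟩ g

omit [CompleteSpace E] in
lemma IsSpectralIntegral.unique {S S' : E →ₗ.[ℂ] E} (hS : IsSpectralIntegral P φ S)
    (hS' : IsSpectralIntegral P φ S') (hd : Dense (S.domain : Set E)) : S = S' := by
  have hdom : S.domain = S'.domain := by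
    ext f
    rw [hS.mem_domain_iff, hS'.mem_domain_iff]
  obtain ⟨d, T⟩ := S
  obtain ⟨d', T'⟩ := S'
  obtain rfl : d = d' := hdom
  congr 1
  refine sub_eq_zero.1 (eq_zero_of_inner_self_eq_zero hd _ fun f => ?_)
  rw [LinearMap.sub_apply, inner_sub_right, sub_eq_zero]
  exact (hS.inner_eq f).trans (hS'.inner_eq f).symm

end SpectralIntegral

/-! ## The resolvent of a positive self-adjoint operator -/

section Resolvent

variable {E : Type*} [NormedAddCommGroup E] [InnerProductSpace ℂ E]

lemma re_inner_self_eq (f : E) : (inner ℂ f f).re = ‖f‖ ^ 2 :=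
  (norm_sq_eq_re_inner (𝕜 := ℂ) f).symm

lemma norm_prodMk_le_norm_add {x y : E} (h : 0 ≤ (inner ℂ x y).re) : ‖(x, y)‖ ≤ ‖x + y‖ := by
  have hadd := norm_add_sq (𝕜 := ℂ) x y
  rw [RCLike.re_to_complex] at hadd
  refine max_le (le_of_sq_le_sq ?_ (norm_nonneg _)) (le_of_sq_le_sq ?_ (norm_nonneg _)) <;>
    linarith [sq_nonneg ‖x‖, sq_nonneg ‖y‖]

/-- The operator `1 + A`, as the bounded operator `(f, A f) ↦ f + A f` on the graph of `A`. -/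
def graphAdd (A : E →ₗ.[ℂ] E) : A.graph →L[ℂ] E :=
  (ContinuousLinearMap.fst ℂ E E + ContinuousLinearMap.snd ℂ E E) ∘L A.graph.subtypeL

variable {A : E →ₗ.[ℂ] E}

lemma re_inner_nonneg_of_mem_graph (hpos : ∀ f : A.domain, 0 ≤ (inner ℂ (f : E) (A f)).re)
    {p : E × E} (hp : p ∈ A.graph) : 0 ≤ (inner ℂ p.1 p.2).re := by
  obtain ⟨f, hf1, hf2⟩ := (LinearPMap.mem_graph_iff A).1 hp
  rw [← hf1, ← hf2]
  exact hpos f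

lemma antilipschitz_graphAdd (hpos : ∀ f : A.domain, 0 ≤ (inner ℂ (f : E) (A f)).re) :
    AntilipschitzWith 1 (graphAdd A) := by
  refine ContinuousLinearMap.antilipschitz_of_bound _ fun p => ?_
  rw [NNReal.coe_one, one_mul]
  exact norm_prodMk_le_norm_add (re_inner_nonneg_of_mem_graph hpos p.2)

variable [CompleteSpace E]

lemma inner_apply_eq_of_isSelfAdjoint (hA : IsSelfAdjoint A) (f g : A.domain) :
    inner ℂ (A f) (g : E) = inner ℂ (f : E) (A g) := by
  have h := LinearPMap.adjoint_isFormalAdjoint hA.dense_domain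
  rw [LinearPMap.isSelfAdjoint_def.1 hA] at h
  exact h f g

lemma inner_eq_of_mem_graph (hA : IsSelfAdjoint A) {p q : E × E} (hp : p ∈ A.graph)
    (hq : q ∈ A.graph) : inner ℂ p.2 q.1 = inner ℂ p.1 q.2 := by
  obtain ⟨f, hf1, hf2⟩ := (LinearPMap.mem_graph_iff A).1 hp
  obtain ⟨g, hg1, hg2⟩ := (LinearPMap.mem_graph_iff A).1 hq
  rw [← hf1, ← hf2, ← hg1, ← hg2]
  exact inner_apply_eq_of_isSelfAdjoint hA f g

lemma eq_zero_of_mem_orthogonal_range_graphAdd (hA : IsSelfAdjoint A)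
    (hpos : ∀ f : A.domain, 0 ≤ (inner ℂ (f : E) (A f)).re) {z : E}
    (hz : z ∈ (graphAdd A).rangeᗮ) : z = 0 := by
  have horth : ∀ f : A.domain, inner ℂ z ((f : E) + A f) = 0 := fun f =>
    (Submodule.mem_orthogonal' _ z).1 hz _ ⟨⟨_, A.mem_graph f⟩, rfl⟩
  have hdom : z ∈ A.domain := by
    rw [← LinearPMap.isSelfAdjoint_def.1 hA]
    refine LinearPMap.mem_adjoint_domain_of_exists z ⟨-z, fun f => ?_⟩
    have := horth f
    rw [inner_add_right] at this
    rw [inner_neg_left]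
    linear_combination -this
  have h := congrArg Complex.re (horth ⟨z, hdom⟩)
  rw [inner_add_right, Complex.add_re, re_inner_self_eq, Complex.zero_re] at h
  have hnorm : ‖z‖ ^ 2 = 0 := le_antisymm (by linarith [hpos ⟨z, hdom⟩]) (sq_nonneg _)
  exact norm_eq_zero.1 (eq_zero_of_pow_eq_zero hnorm)

lemma range_graphAdd (hA : IsSelfAdjoint A)
    (hpos : ∀ f : A.domain, 0 ≤ (inner ℂ (f : E) (A f)).re) : (graphAdd A).range = ⊤ := by
  have : CompleteSpace A.graph := hA.isClosed.completeSpace_coe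
  have hclosed : IsClosed ((graphAdd A).range : Set E) :=
    (antilipschitz_graphAdd hpos).isClosed_range (graphAdd A).uniformContinuous
  have : CompleteSpace (graphAdd A).range := hclosed.completeSpace_coe
  rw [← Submodule.orthogonal_eq_bot_iff, Submodule.eq_bot_iff]
  exact fun z hz => eq_zero_of_mem_orthogonal_range_graphAdd hA hpos hz

lemma nonneg_of_isSelfAdjoint_of_re_inner {T : E →L[ℂ] E} (hT : IsSelfAdjoint T)
    (h : ∀ f, 0 ≤ (inner ℂ (T f) f).re) : 0 ≤ T := by
  rw [ContinuousLinearMap.nonneg_iff_isPositive, ContinuousLinearMap.isPositive_def]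
  exact ⟨hT.isSymmetric, h⟩

theorem exists_resolvent (hA : IsSelfAdjoint A)
    (hpos : ∀ f : A.domain, 0 ≤ (inner ℂ (f : E) (A f)).re) :
    ∃ B : E →L[ℂ] E, 0 ≤ B ∧ B ≤ 1 ∧ ∀ x y, (x, y) ∈ A.graph ↔ B (x + y) = x := by
  have : CompleteSpace A.graph := hA.isClosed.completeSpace_coe
  obtain ⟨e, he⟩ : ∃ e : A.graph ≃L[ℂ] E, ∀ p, e p = p.1.1 + p.1.2 :=
    ⟨.ofBijective (graphAdd A) (LinearMap.ker_eq_bot.2 (antilipschitz_graphAdd hpos).injective)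
      (range_graphAdd hA hpos), fun _ => rfl⟩
  let B : E →L[ℂ] E :=
    ContinuousLinearMap.fst ℂ E E ∘L A.graph.subtypeL ∘L (e.symm : E →L[ℂ] A.graph)
  have hB : ∀ p, B (e p) = p.1.1 := fun p => congrArg (·.1.1) (e.symm_apply_apply p)
  have hsymm : IsSelfAdjoint B := by
    rw [ContinuousLinearMap.isSelfAdjoint_iff_isSymmetric]
    intro f g
    obtain ⟨p, rfl⟩ := e.surjective f
    obtain ⟨q, rfl⟩ := e.surjective g
    change inner ℂ (B (e p)) (e q) = inner ℂ (e p) (B (e q))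
    rw [hB, hB, he, he, inner_add_right, inner_add_left, inner_eq_of_mem_graph hA p.2 q.2]
  refine ⟨B, nonneg_of_isSelfAdjoint_of_re_inner hsymm fun f => ?_, ?_,
    fun x y => ⟨fun h => ?_, fun h => ?_⟩⟩
  · obtain ⟨p, rfl⟩ := e.surjective f
    rw [hB, he, inner_add_right, Complex.add_re, re_inner_self_eq]
    exact add_nonneg (sq_nonneg _) (re_inner_nonneg_of_mem_graph hpos p.2)
  · refine sub_nonneg.1 <| nonneg_of_isSelfAdjoint_of_re_inner
      ((IsSelfAdjoint.one _).sub hsymm) fun f => ?_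
    obtain ⟨p, rfl⟩ := e.surjective f
    rw [sub_apply, one_apply_eq_self, hB, he, add_sub_cancel_left, inner_add_right,
      inner_eq_of_mem_graph hA p.2 p.2, Complex.add_re, re_inner_self_eq]
    exact add_nonneg (re_inner_nonneg_of_mem_graph hpos p.2) (sq_nonneg _)
  · rw [← he ⟨(x, y), h⟩, hB]
  · obtain ⟨p, hp⟩ := e.surjective (x + y)
    rw [← hp, hB] at h
    rw [he, h, add_right_inj] at hp
    rw [← h, ← hp]
    exact p.2

end Resolvent

/-! ## Spectral subspaces of a bounded self-adjoint operator -/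

section SpectralSubspace

variable {E : Type*} [NormedAddCommGroup E] [InnerProductSpace ℂ E]

lemma re_inner_le_of_le {S T : E →L[ℂ] E} (h : S ≤ T) (f : E) :
    (inner ℂ f (S f)).re ≤ (inner ℂ f (T f)).re := by
  have hTS := ((ContinuousLinearMap.le_def S T).1 h).re_inner_nonneg_right f
  rw [sub_apply, inner_sub_right, RCLike.re_to_complex, Complex.sub_re] at hTS
  linarith

lemma re_inner_algebraMap (c : ℝ) (f : E) :
    (inner ℂ f (algebraMap ℝ (E →L[ℂ] E) c f)).re = c * ‖f‖ ^ 2 := by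
  rw [Algebra.algebraMap_eq_smul_one, smul_apply, one_apply_eq_self, ← Complex.coe_smul,
    inner_smul_right, Complex.re_ofReal_mul, re_inner_self_eq]

variable [CompleteSpace E]

lemma norm_opSqrt_sq {T : E →L[ℂ] E} (hT : T.IsPositive) (f : E) :
    ‖opSqrt T f‖ ^ 2 = (inner ℂ f (T f)).re := by
  conv_rhs => rw [← opSqrt_mul_self T hT]
  rw [mul_apply_eq_comp, inner_opSqrt, re_inner_self_eq]

lemma apply_eq_zero_of_re_inner_nonpos {T : E →L[ℂ] E} (hT : 0 ≤ T) {f : E}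
    (h : (inner ℂ f (T f)).re ≤ 0) : T f = 0 := by
  have hpos := (ContinuousLinearMap.nonneg_iff_isPositive _).1 hT
  rw [← norm_opSqrt_sq hpos] at h
  have hsqrt : opSqrt T f = 0 :=
    norm_eq_zero.1 (eq_zero_of_pow_eq_zero (le_antisymm h (sq_nonneg _)))
  rw [← opSqrt_mul_self T hpos, mul_apply_eq_comp, hsqrt, map_zero]

/-- The positive part `(c - B)⁺`, whose kernel is the spectral subspace of `B` for `[c, ∞[`. -/
def ramp (B : E →L[ℂ] E) (c : ℝ) : E →L[ℂ] E := cfc (fun x : ℝ => max (c - x) 0) B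

variable {B : E →L[ℂ] E}

lemma ramp_nonneg (B : E →L[ℂ] E) (c : ℝ) : 0 ≤ ramp B c :=
  cfc_nonneg fun _ _ => le_max_right _ _

lemma ramp_mono (B : E →L[ℂ] E) {c d : ℝ} (h : c ≤ d) : ramp B c ≤ ramp B d :=
  cfc_mono fun x _ => max_le_max_right 0 (by linarith)

lemma ramp_le_add (hB : IsSelfAdjoint B) {c d : ℝ} (h : c ≤ d) :
    ramp B d ≤ ramp B c + algebraMap ℝ (E →L[ℂ] E) (d - c) := by
  rw [ramp, ramp, ← cfc_add_const (a := B) (d - c) (fun x : ℝ => max (c - x) 0)]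
  refine cfc_mono fun x _ => max_le ?_ ?_
  · linarith [le_max_left (c - x) 0]
  · linarith [le_max_right (c - x) 0]

lemma commute_ramp (hB : IsSelfAdjoint B) (c : ℝ) : Commute (ramp B c) B := by
  have := cfc_commute_cfc (fun x : ℝ => max (c - x) 0) (fun x => x) B
  rwa [cfc_id' ℝ B] at this

lemma ramp_add_sub (hB : IsSelfAdjoint B) (c : ℝ) :
    ramp B c + B - algebraMap ℝ (E →L[ℂ] E) c = cfc (fun x : ℝ => max (x - c) 0) B := by
  have hadd := cfc_add (a := B) (f := fun x : ℝ => max (c - x) 0) (g := fun x : ℝ => x)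
  have hsub := cfc_sub (a := B) (f := fun x : ℝ => max (c - x) 0 + x) (g := fun _ : ℝ => c)
  rw [cfc_const c B, hadd, cfc_id' ℝ B] at hsub
  rw [ramp, ← hsub]
  congr 1
  ext x
  rcases le_total c x with h | h
  · rw [max_eq_right (sub_nonpos.2 h), max_eq_left (sub_nonneg.2 h), zero_add]
  · rw [max_eq_left (sub_nonneg.2 h), max_eq_right (sub_nonpos.2 h)]
    ring

lemma algebraMap_le_ramp_add (hB : IsSelfAdjoint B) (c : ℝ) :
    algebraMap ℝ (E →L[ℂ] E) c ≤ ramp B c + B := by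
  rw [← sub_nonneg, ramp_add_sub hB]
  exact cfc_nonneg fun _ _ => le_max_right _ _

lemma ramp_mul_ramp_add_sub (hB : IsSelfAdjoint B) (c : ℝ) :
    ramp B c * (ramp B c + B - algebraMap ℝ (E →L[ℂ] E) c) = 0 := by
  rw [ramp_add_sub hB, ramp, ← cfc_mul (fun x : ℝ => max (c - x) 0) (fun x : ℝ => max (x - c) 0) B,
    ← cfc_const_zero ℝ B]
  congr 1
  ext x
  rcases le_total c x with h | h
  · rw [max_eq_right (sub_nonpos.2 h), zero_mul]
  · rw [max_eq_right (sub_nonpos.2 h), mul_zero]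

/-- The spectral subspace of `B` for `[c, ∞[`. -/
def specSubspace (B : E →L[ℂ] E) (c : ℝ) : Submodule ℂ E := (ramp B c).ker

instance (B : E →L[ℂ] E) (c : ℝ) : CompleteSpace (specSubspace B c) :=
  ContinuousLinearMap.completeSpace_ker _

lemma mem_specSubspace {c : ℝ} {f : E} : f ∈ specSubspace B c ↔ ramp B c f = 0 := Iff.rfl

lemma mem_specSubspace_iff_re_inner_nonpos {c : ℝ} {f : E} :
    f ∈ specSubspace B c ↔ (inner ℂ f (ramp B c f)).re ≤ 0 := by
  refine ⟨fun h => ?_, apply_eq_zero_of_re_inner_nonpos (ramp_nonneg B c)⟩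
  rw [mem_specSubspace.1 h, inner_zero_right, Complex.zero_re]

lemma specSubspace_antitone (B : E →L[ℂ] E) : Antitone (specSubspace B) := fun _ _ h f hf =>
  mem_specSubspace_iff_re_inner_nonpos.2
    ((re_inner_le_of_le (ramp_mono B h) f).trans (mem_specSubspace_iff_re_inner_nonpos.1 hf))

lemma mem_specSubspace_of_forall_lt (hB : IsSelfAdjoint B) {c : ℝ} {f : E}
    (h : ∀ d < c, f ∈ specSubspace B d) : f ∈ specSubspace B c := by
  have hle : ∀ d < c, (inner ℂ f (ramp B c f)).re ≤ (c - d) * ‖f‖ ^ 2 := by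
    intro d hd
    have := re_inner_le_of_le (ramp_le_add hB hd.le) f
    rwa [add_apply, mem_specSubspace.1 (h d hd), zero_add, re_inner_algebraMap] at this
  have hlim : Tendsto (fun d => (c - d) * ‖f‖ ^ 2) (𝓝[<] c) (𝓝 ((c - c) * ‖f‖ ^ 2)) :=
    (Continuous.tendsto (by fun_prop) c).mono_left nhdsWithin_le_nhds
  rw [sub_self, zero_mul] at hlim
  exact mem_specSubspace_iff_re_inner_nonpos.2
    (ge_of_tendsto hlim (eventually_mem_nhdsWithin.mono hle))

lemma le_re_inner_of_mem_specSubspace (hB : IsSelfAdjoint B) {c : ℝ} {f : E}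
    (h : f ∈ specSubspace B c) : c * ‖f‖ ^ 2 ≤ (inner ℂ f (B f)).re := by
  have hle := re_inner_le_of_le (algebraMap_le_ramp_add hB c) f
  rwa [add_apply, mem_specSubspace.1 h, zero_add, re_inner_algebraMap] at hle

lemma re_inner_le_of_mem_orthogonal_specSubspace (hB : IsSelfAdjoint B) {c : ℝ} {f : E}
    (h : f ∈ (specSubspace B c)ᗮ) : (inner ℂ f (B f)).re ≤ c * ‖f‖ ^ 2 := by
  have hmem : ramp B c f + B f - algebraMap ℝ (E →L[ℂ] E) c f ∈ specSubspace B c :=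
    DFunLike.congr_fun (ramp_mul_ramp_add_sub hB c) f
  have horth := congrArg Complex.re ((Submodule.mem_orthogonal' _ f).1 h _ hmem)
  rw [inner_sub_right, inner_add_right, Complex.sub_re, Complex.add_re, re_inner_algebraMap,
    Complex.zero_re] at horth
  have hramp := re_inner_le_of_le (ramp_nonneg B c) f
  rw [zero_apply, inner_zero_right, Complex.zero_re] at hramp
  linarith

lemma specSubspace_eq_bot (hB : IsSelfAdjoint B) (hB1 : B ≤ 1) {c : ℝ} (hc : 1 < c) :
    specSubspace B c = ⊥ := by
  refine (Submodule.eq_bot_iff _).2 fun f hf => ?_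
  have hlower := le_re_inner_of_mem_specSubspace hB hf
  have hupper := re_inner_le_of_le hB1 f
  rw [one_apply_eq_self, re_inner_self_eq] at hupper
  have hnorm : ‖f‖ ^ 2 = 0 := by nlinarith [sq_nonneg ‖f‖]
  exact norm_eq_zero.1 (eq_zero_of_pow_eq_zero hnorm)

lemma commute_starProjection_specSubspace (hB : IsSelfAdjoint B) (c : ℝ) :
    Commute (specSubspace B c).starProjection B := by
  have hinv : ∀ f ∈ specSubspace B c, B f ∈ specSubspace B c := fun f hf => by
    have := congrArg (· f) (commute_ramp hB c).eq
    simp only [mul_apply_eq_comp, mem_specSubspace.1 hf, map_zero] at this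
    exact this
  refine ContinuousLinearMap.ext fun f => ?_
  refine Submodule.eq_starProjection_of_mem_of_inner_eq_zero (K := specSubspace B c)
    (hinv _ (Submodule.starProjection_apply_mem _ _)) fun w hw => ?_
  change inner ℂ (B f - B ((specSubspace B c).starProjection f)) w = 0
  rw [← map_sub, inner_left_of_isSelfAdjoint hB]
  exact Submodule.starProjection_inner_eq_zero _ _ (hinv w hw)

/-- A decreasing extension of `t ↦ (1 + t)⁻¹` to the line, with values `> 1` on the negative half
line. -/
def levelFun (t : ℝ) : ℝ := (1 + max t 0)⁻¹ + max (-t) 0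

lemma levelFun_of_nonneg {t : ℝ} (h : 0 ≤ t) : levelFun t = (1 + t)⁻¹ := by
  rw [levelFun, max_eq_left h, max_eq_right (neg_nonpos.2 h), add_zero]

lemma one_lt_levelFun {t : ℝ} (h : t < 0) : 1 < levelFun t := by
  rw [levelFun, max_eq_right h.le, max_eq_left (neg_pos.2 h).le, add_zero, inv_one]
  linarith

lemma levelFun_antitone : Antitone levelFun := by
  intro s t h
  unfold levelFun
  gcongr

lemma levelFun_continuous : Continuous levelFun :=
  (Continuous.inv₀ (by fun_prop) fun t => by positivity).add (by fun_prop)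

lemma levelFun_sub_le {x y : ℝ} (h : x ≤ y) : levelFun x - levelFun y ≤ y - x := by
  have hinv : ∀ {a b : ℝ}, 0 ≤ a → a ≤ b → (1 + a)⁻¹ - (1 + b)⁻¹ ≤ b - a := by
    intro a b ha hab
    rw [inv_sub_inv (by positivity) (by linarith), div_le_iff₀ (by nlinarith)]
    nlinarith [mul_nonneg ha (ha.trans hab)]
  have hneg : ∀ t : ℝ, max (-t) 0 = max t 0 - t := fun t => by
    rw [← max_sub_sub_right, sub_self, zero_sub, max_comm]
  have := hinv (le_max_right x 0) (max_le_max_right 0 h)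
  rw [levelFun, levelFun, hneg, hneg]
  linarith

/-- The spectral family of `B⁻¹ - 1`: its projection at `t ≥ 0` is the spectral projection of `B`
for `[(1 + t)⁻¹, ∞[`. -/
def resolventFamily (B : E →L[ℂ] E) (t : ℝ) : E →L[ℂ] E :=
  (specSubspace B (levelFun t)).starProjection

lemma resolventFamily_of_neg (hB : IsSelfAdjoint B) (hB1 : B ≤ 1) {t : ℝ} (ht : t < 0) :
    resolventFamily B t = 0 := by
  ext f
  have := Submodule.starProjection_apply_mem (specSubspace B (levelFun t)) f
  exact (Submodule.mem_bot ℂ).1 ((specSubspace_eq_bot hB hB1 (one_lt_levelFun ht)).le this)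

lemma monotone_specSubspace_levelFun (B : E →L[ℂ] E) :
    Monotone fun t => specSubspace B (levelFun t) :=
  (specSubspace_antitone B).comp levelFun_antitone

lemma resolventFamily_mul (B : E →L[ℂ] E) {s t : ℝ} (h : s ≤ t) :
    resolventFamily B s * resolventFamily B t = resolventFamily B s :=
  Submodule.starProjection_comp_starProjection_of_le (monotone_specSubspace_levelFun B h)

lemma tendsto_resolventFamily_atTop (hpos : 0 ≤ B) (hinj : ∀ f, B f = 0 → f = 0) (f : E) :
    Tendsto (fun t => resolventFamily B t f) atTop (𝓝 f) := by
  refine Submodule.starProjection_tendsto_self _ (monotone_specSubspace_levelFun B) f ?_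
  rw [top_le_iff, Submodule.topologicalClosure_eq_top_iff, ← Submodule.iInf_orthogonal,
    Submodule.eq_bot_iff]
  refine fun g hg => hinj g (apply_eq_zero_of_re_inner_nonpos hpos ?_)
  have hle : ∀ t : ℝ, 0 ≤ t → (inner ℂ g (B g)).re ≤ (1 + t)⁻¹ * ‖g‖ ^ 2 := fun t ht => by
    rw [← levelFun_of_nonneg ht]
    exact re_inner_le_of_mem_orthogonal_specSubspace (.of_nonneg hpos)
      ((Submodule.mem_iInf _).1 hg t)
  have hlim : Tendsto (fun t : ℝ => (1 + t)⁻¹ * ‖g‖ ^ 2) atTop (𝓝 (0 * ‖g‖ ^ 2)) :=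
    (tendsto_inv_atTop_zero.comp (tendsto_atTop_add_const_left _ 1 tendsto_id)).mul_const _
  rw [zero_mul] at hlim
  exact ge_of_tendsto hlim ((eventually_ge_atTop 0).mono hle)

lemma iInf_specSubspace_levelFun (hB : IsSelfAdjoint B) (t : ℝ) :
    ⨅ s : Ioi t, specSubspace B (levelFun s) = specSubspace B (levelFun t) := by
  refine le_antisymm (fun g hg => mem_specSubspace_of_forall_lt hB fun d hd => ?_)
    (le_iInf fun s => monotone_specSubspace_levelFun B s.2.le)
  have hlim : Tendsto levelFun (𝓝[>] t) (𝓝 (levelFun t)) :=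
    (levelFun_continuous.tendsto t).mono_left nhdsWithin_le_nhds
  obtain ⟨s, hs, hst⟩ := ((hlim.eventually (eventually_gt_nhds hd)).and
    eventually_mem_nhdsWithin).exists
  exact specSubspace_antitone B hs.le ((Submodule.mem_iInf _).1 hg ⟨s, hst⟩)

lemma continuousWithinAt_resolventFamily (hB : IsSelfAdjoint B) (t : ℝ) (f : E) :
    ContinuousWithinAt (fun s => resolventFamily B s f) (Ici t) t := by
  let U : (Ioi t)ᵒᵈ → Submodule ℂ E := fun s => (specSubspace B (levelFun s.ofDual.1))ᗮ
  have hU : Monotone U := fun r s h =>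
    Submodule.orthogonal_le (monotone_specSubspace_levelFun B h)
  have hclosure : (⨆ s, U s).topologicalClosure = (specSubspace B (levelFun t))ᗮ := by
    rw [← Submodule.orthogonal_orthogonal_eq_closure, ← Submodule.iInf_orthogonal,
      ← iInf_specSubspace_levelFun hB t]
    simp only [U, Submodule.orthogonal_orthogonal]
    rfl
  have hlim := Submodule.starProjection_tendsto_closure_iSup U hU f
  simp only [hclosure, U, Submodule.starProjection_orthogonal_val] at hlim
  replace hlim := (tendsto_const_nhds (x := f)).sub hlim
  simp only [sub_sub_cancel] at hlim
  rw [← continuousWithinAt_Ioi_iff_Ici, ContinuousWithinAt, ← tendsto_comp_coe_Ioi_atBot]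
  exact hlim

lemma isSpectralFamily_resolventFamily (hpos : 0 ≤ B) (hB1 : B ≤ 1)
    (hinj : ∀ f, B f = 0 → f = 0) : IsSpectralFamily (resolventFamily B) where
  isStarProjection _ := isStarProjection_starProjection
  mono _ _ h := resolventFamily_mul B h
  rightCont := continuousWithinAt_resolventFamily (.of_nonneg hpos)
  tendsto_atBot f := by
    refine tendsto_const_nhds.congr' ((eventually_lt_atBot 0).mono fun t ht => ?_)
    simp only [resolventFamily_of_neg (.of_nonneg hpos) hB1 ht, zero_apply]
  tendsto_atTop := tendsto_resolventFamily_atTop hpos hinj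

end SpectralSubspace

/-! ## The spectral theorem for positive self-adjoint operators -/

section SpectralTheorem

lemma eq_of_abs_sub_le_mul {h v : ℝ → ℝ} {a b : ℝ} (hab : a ≤ b)
    (hh : ∀ x y, a ≤ x → x ≤ y → |h y - h x| ≤ (y - x) * (v y - v x)) : h b = h a := by
  have hpartition : ∀ δ : ℝ, 0 ≤ δ → ∀ k : ℕ,
      |h (a + k * δ) - h a| ≤ δ * (v (a + k * δ) - v a) := by
    intro δ hδ k
    induction k with
    | zero => simp
    | succ k ih =>
      have hstep := hh (a + k * δ) (a + (k + 1 : ℕ) * δ) (by nlinarith [k.cast_nonneg (α := ℝ)])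
        (by push_cast; linarith)
      rw [show a + ((k + 1 : ℕ) : ℝ) * δ - (a + k * δ) = δ by push_cast; ring] at hstep
      linarith [abs_sub_le (h (a + (k + 1 : ℕ) * δ)) (h (a + k * δ)) (h a)]
  have hbound : ∀ᶠ N : ℕ in atTop, |h b - h a| ≤ (b - a) / N * (v b - v a) := by
    filter_upwards [eventually_gt_atTop 0] with N hN
    have := hpartition ((b - a) / N) (div_nonneg (sub_nonneg.2 hab) N.cast_nonneg) N
    rwa [mul_div_cancel₀ _ (Nat.cast_ne_zero.2 hN.ne'), add_sub_cancel] at this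
  have hlim : Tendsto (fun N : ℕ => (b - a) / N * (v b - v a)) atTop (𝓝 (0 * (v b - v a))) :=
    (tendsto_const_div_atTop_nhds_zero_nat (b - a)).mul_const _
  rw [zero_mul] at hlim
  exact sub_eq_zero.1 (abs_nonpos_iff.1 (ge_of_tendsto hlim hbound))

variable {E : Type*} [NormedAddCommGroup E] [InnerProductSpace ℂ E] [CompleteSpace E]
  {P : ℝ → E →L[ℂ] E}

namespace IsSpectralFamily

lemma ae_le_of_apply_eq_self (hP : IsSpectralFamily P) {t : ℝ} {f : E} (h : P t f = f) :
    ∀ᵐ s ∂scalarMeasure P f, s ≤ t := by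
  simp only [ae_iff, not_le]
  change scalarMeasure P f (Ioi t) = 0
  simp [hP.scalarMeasure_Ioi, h]

lemma ae_lt_of_apply_eq_zero (hP : IsSpectralFamily P) {t : ℝ} {f : E} (h : P t f = 0) :
    ∀ᵐ s ∂scalarMeasure P f, t < s := by
  simp only [ae_iff, not_lt]
  change scalarMeasure P f (Iic t) = 0
  simp [hP.scalarMeasure_Iic, h]

lemma ae_nonneg (hP : IsSpectralFamily P) (hneg : ∀ t < 0, P t = 0) (f : E) :
    ∀ᵐ t ∂scalarMeasure P f, 0 ≤ t := by
  have hlt : ∀ᵐ t ∂scalarMeasure P f, ∀ n : ℕ, -(1 / ((n : ℝ) + 1)) < t :=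
    ae_all_iff.2 fun n => hP.ae_lt_of_apply_eq_zero <| by
      rw [hneg _ (neg_lt_zero.2 Nat.one_div_pos_of_nat), zero_apply]
  filter_upwards [hlt] with t ht
  have hlim := (tendsto_one_div_add_atTop_nhds_zero_nat (𝕜 := ℝ)).neg
  rw [neg_zero] at hlim
  exact le_of_tendsto' hlim fun n => (ht n).le

lemma norm_sq_sub_apply_apply (hP : IsSpectralFamily P) {x y : ℝ} (h : x ≤ y) (f : E) :
    ‖P y f - P x f‖ ^ 2 = ‖P y f‖ ^ 2 - ‖P x f‖ ^ 2 := by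
  have := hP.norm_sq_sub_apply x (P y f)
  rwa [hP.apply_apply, min_eq_left h] at this

lemma inner_sub_apply_sub_apply (hP : IsSpectralFamily P) {D : E →L[ℂ] E}
    (hD : ∀ t, Commute (P t) D) {x y : ℝ} (h : x ≤ y) (f : E) :
    inner ℂ (P y f - P x f) (D (P y f - P x f))
      = inner ℂ (P y f) (D (P y f)) - inner ℂ (P x f) (D (P x f)) := by
  have hcomm : ∀ t g, D (P t g) = P t (D g) := fun t g => (DFunLike.congr_fun (hD t).eq g).symm
  have hxy : inner ℂ (P x f) (D (P y f)) = inner ℂ (P x f) (D (P x f)) := by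
    simp only [hcomm, hP.inner_left, hP.apply_apply, min_self, min_eq_left h]
  have hyx : inner ℂ (P y f) (D (P x f)) = inner ℂ (P x f) (D (P x f)) := by
    simp only [hcomm, hP.inner_left, hP.apply_apply, min_self, min_eq_right h]
  rw [map_sub, inner_sub_left, inner_sub_right, inner_sub_right, hxy, hyx, sub_self, sub_zero]

end IsSpectralFamily

/-- The increments of `h t = ⟨P_t f, D P_t f⟩` are at most `(y - x) (‖P_y f‖² - ‖P_x f‖²)`, which
forces `h` to be constant. -/
lemma eq_zero_of_abs_re_inner_le (hP : IsSpectralFamily P) {a : ℝ} (ha : P a = 0)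
    {D : E →L[ℂ] E} (hsymm : IsSelfAdjoint D) (hD : ∀ t, Commute (P t) D)
    (hle : ∀ x y, x ≤ y → ∀ g, P y g = g → P x g = 0 →
      |(inner ℂ g (D g)).re| ≤ (y - x) * ‖g‖ ^ 2) : D = 0 := by
  let h : E → ℝ → ℝ := fun f t => (inner ℂ (P t f) (D (P t f))).re
  have hzero : ∀ f, ∀ t ≥ a, h f t = 0 := by
    intro f t ht
    have hconst : h f t = h f a := by
      refine eq_of_abs_sub_le_mul (v := fun t => ‖P t f‖ ^ 2) ht fun x y _ hxy => ?_
      have := hle x y hxy (P y f - P x f)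
        (by rw [map_sub, hP.apply_apply, hP.apply_apply, min_self, min_eq_right hxy])
        (by rw [map_sub, hP.apply_apply, hP.apply_apply, min_self, min_eq_left hxy, sub_self])
      rwa [hP.inner_sub_apply_sub_apply hD hxy, Complex.sub_re,
        hP.norm_sq_sub_apply_apply hxy] at this
    rw [hconst]
    simp [h, ha]
  refine continuousLinearMap_ext_inner_self fun f => ?_
  have hlim : Tendsto (h f) atTop (𝓝 (inner ℂ f (D f)).re) :=
    (Complex.continuous_re.tendsto _).comp ((hP.tendsto_atTop f).inner
      ((D.continuous.tendsto _).comp (hP.tendsto_atTop f)))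
  have hre : (inner ℂ f (D f)).re = 0 := tendsto_nhds_unique hlim
    (tendsto_const_nhds.congr' ((eventually_ge_atTop a).mono fun t ht => (hzero f t ht).symm))
  rw [zero_apply, inner_zero_right]
  exact (hsymm.isSymmetric.coe_re_inner_self_apply f).symm.trans (by
    simp only [RCLike.re_eq_complex_re, ContinuousLinearMap.coe_coe, hre, Complex.coe_algebraMap,
      Complex.ofReal_zero])

/-- The function `(1 + t)⁻¹`, extended by `1` to the negative half line. -/
def resolventFun (t : ℝ) : ℝ := (1 + max t 0)⁻¹

lemma isBoundedBorel_resolventFun : IsBoundedBorel resolventFun := by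
  refine ⟨by unfold resolventFun; fun_prop, 1, fun t => ?_⟩
  rw [resolventFun, abs_of_pos (by positivity)]
  exact inv_le_one_of_one_le₀ (by linarith [le_max_right t 0])

lemma levelFun_eq_resolventFun {t : ℝ} (h : 0 ≤ t) : levelFun t = resolventFun t := by
  rw [levelFun_of_nonneg h, resolventFun, max_eq_left h]

lemma levelFun_mul_norm_sq_le_re_inner_borelCalc (hP : IsSpectralFamily P)
    (hneg : ∀ t < 0, P t = 0) {y : ℝ} {g : E} (h : P y g = g) :
    levelFun y * ‖g‖ ^ 2 ≤ (inner ℂ g (borelCalc P resolventFun g)).re := by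
  have := hP.isFiniteMeasure g
  rw [inner_borelCalc_self hP isBoundedBorel_resolventFun, Complex.ofReal_re, mul_comm,
    ← hP.scalarMeasure_real_univ, ← smul_eq_mul, ← integral_const]
  refine integral_mono_ae (integrable_const _) (isBoundedBorel_resolventFun.integrable _) ?_
  filter_upwards [hP.ae_nonneg hneg g, hP.ae_le_of_apply_eq_self h] with t ht hty
  rw [← levelFun_eq_resolventFun ht]
  exact levelFun_antitone hty

lemma re_inner_borelCalc_le_levelFun_mul_norm_sq (hP : IsSpectralFamily P)
    (hneg : ∀ t < 0, P t = 0) {x : ℝ} {g : E} (h : P x g = 0) :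
    (inner ℂ g (borelCalc P resolventFun g)).re ≤ levelFun x * ‖g‖ ^ 2 := by
  have := hP.isFiniteMeasure g
  rw [inner_borelCalc_self hP isBoundedBorel_resolventFun, Complex.ofReal_re, mul_comm,
    ← hP.scalarMeasure_real_univ, ← smul_eq_mul, ← integral_const]
  refine integral_mono_ae (isBoundedBorel_resolventFun.integrable _) (integrable_const _) ?_
  filter_upwards [hP.ae_nonneg hneg g, hP.ae_lt_of_apply_eq_zero h] with t ht hxt
  rw [← levelFun_eq_resolventFun ht]
  exact levelFun_antitone hxt.le

lemma borelCalc_resolventFamily {B : E →L[ℂ] E} (hpos : 0 ≤ B) (hB1 : B ≤ 1)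
    (hinj : ∀ f, B f = 0 → f = 0) : borelCalc (resolventFamily B) resolventFun = B := by
  have hB : IsSelfAdjoint B := .of_nonneg hpos
  have hP := isSpectralFamily_resolventFamily hpos hB1 hinj
  have hneg : ∀ t < 0, resolventFamily B t = 0 := fun t ht => resolventFamily_of_neg hB hB1 ht
  refine sub_eq_zero.1 (eq_zero_of_abs_re_inner_le hP (hneg (-1) (by norm_num))
    ((isSelfAdjoint_borelCalc hP isBoundedBorel_resolventFun).sub hB)
    (fun t => (commute_proj_borelCalc hP isBoundedBorel_resolventFun t).sub_right
      (commute_starProjection_specSubspace hB _)) fun x y hxy g hy hx => ?_)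
  have hlower := levelFun_mul_norm_sq_le_re_inner_borelCalc hP hneg hy
  have hupper := re_inner_borelCalc_le_levelFun_mul_norm_sq hP hneg hx
  have hlowerB := le_re_inner_of_mem_specSubspace hB (Submodule.starProjection_eq_self_iff.1 hy)
  have hupperB := re_inner_le_of_mem_orthogonal_specSubspace hB
    ((Submodule.starProjection_apply_eq_zero_iff _).1 hx)
  have hlip := mul_le_mul_of_nonneg_right (levelFun_sub_le hxy) (sq_nonneg ‖g‖)
  rw [sub_apply, inner_sub_right, Complex.sub_re, abs_le]
  constructor <;> linarith

omit [CompleteSpace E] in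
lemma IsSpectralIntegral.congr {φ ψ : ℝ → ℝ} {S : E →ₗ.[ℂ] E} (hS : IsSpectralIntegral P φ S)
    (h : ∀ f, φ =ᵐ[scalarMeasure P f] ψ) : IsSpectralIntegral P ψ S where
  mem_domain_iff f := by
    have hsq : (fun t => ENNReal.ofReal (φ t ^ 2)) =ᵐ[scalarMeasure P f]
        fun t => ENNReal.ofReal (ψ t ^ 2) := (h f).fun_comp fun r => ENNReal.ofReal (r ^ 2)
    rw [hS.mem_domain_iff, lintegral_congr_ae hsq]
  inner_eq f := by rw [hS.inner_eq, integral_congr_ae (h f)]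

theorem exists_spectralFamily {A : E →ₗ.[ℂ] E} (hA : IsSelfAdjoint A)
    (hpos : ∀ f : A.domain, 0 ≤ (inner ℂ (f : E) (A f)).re) :
    ∃ P : ℝ → E →L[ℂ] E, IsSpectralFamily P ∧ IsSpectralIntegral P id A := by
  obtain ⟨B, hB0, hB1, hgraph⟩ := exists_resolvent hA hpos
  have hinj : ∀ f, B f = 0 → f = 0 := fun f hf =>
    A.graph_fst_eq_zero_snd ((hgraph 0 f).2 (by rwa [zero_add])) rfl
  have hP := isSpectralFamily_resolventFamily hB0 hB1 hinj
  have hae := hP.ae_nonneg fun t ht => resolventFamily_of_neg (.of_nonneg hB0) hB1 ht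
  have hmax : Measurable fun t : ℝ => max t 0 := by fun_prop
  have hAS : A = spectralIntegral (resolventFamily B) fun t => max t 0 := by
    refine LinearPMap.eq_of_eq_graph (Submodule.ext fun p => ?_)
    rw [mem_graph_spectralIntegral_iff hP hmax fun _ => le_max_right _ _, hgraph]
    exact iff_of_eq (congrArg (fun T : E →L[ℂ] E => T (p.1 + p.2) = p.1)
      (borelCalc_resolventFamily hB0 hB1 hinj).symm)
  refine ⟨_, hP, (hAS ▸ isSpectralIntegral_spectralIntegral hP hmax).congr fun f => ?_⟩
  filter_upwards [hae f] with t ht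
  exact max_eq_left ht

lemma isSpectralFamily_spectralFamily {A : E →ₗ.[ℂ] E} (hA : IsSelfAdjoint A)
    (hpos : ∀ f : A.domain, 0 ≤ (inner ℂ (f : E) (A f)).re) :
    IsSpectralFamily (spectralFamily A) ∧ IsSpectralIntegral (spectralFamily A) id A := by
  have h := exists_spectralFamily hA hpos
  rw [spectralFamily, dif_pos h]
  exact h.choose_spec

end SpectralTheorem

/-! ## Positivity and spectral bands -/

section Positivity

variable {E : Type*} [NormedAddCommGroup E] [InnerProductSpace ℂ E] [CompleteSpace E]
variable {P : ℝ → E →L[ℂ] E} {A : E →ₗ.[ℂ] E}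

lemma eq_zero_of_ae_mem_Ioc (hP : IsSpectralFamily P) (hPA : IsSpectralIntegral P id A)
    (hpos : ∀ f : A.domain, 0 ≤ (inner ℂ (f : E) (A f)).re) {s t : ℝ} (ht : t < 0) {g : E}
    (hae : ∀ᵐ u ∂scalarMeasure P g, u ∈ Ioc s t) : g = 0 := by
  have hfin := hP.isFiniteMeasure g
  have hsq : ∀ᵐ u ∂scalarMeasure P g, u ^ 2 ≤ s ^ 2 := by
    filter_upwards [hae] with u hu
    nlinarith [hu.1, hu.2]
  have hdom : g ∈ A.domain := by
    refine (hPA.mem_domain_iff g).2 ((lintegral_mono_ae (g := fun _ => ENNReal.ofReal (s ^ 2))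
      (hsq.mono fun u hu => ENNReal.ofReal_le_ofReal hu)).trans_lt ?_)
    rw [lintegral_const]
    exact ENNReal.mul_lt_top ENNReal.ofReal_lt_top (measure_lt_top _ _)
  have hint : Integrable id (scalarMeasure P g) :=
    .of_bound measurable_id.aestronglyMeasurable |s| (hsq.mono fun u hu => sq_le_sq.1 hu)
  have hle : ∫ u, id u ∂scalarMeasure P g ≤ t * ‖g‖ ^ 2 :=
    (integral_mono_ae hint (integrable_const t) (hae.mono fun u hu => hu.2)).trans_eq (by
      rw [integral_const, hP.scalarMeasure_real_univ, smul_eq_mul, mul_comm])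
  have hnonneg := hpos ⟨g, hdom⟩
  rw [hPA.inner_eq, Complex.ofReal_re] at hnonneg
  have hg : ‖g‖ ^ 2 = 0 := by nlinarith [sq_nonneg ‖g‖]
  exact norm_eq_zero.1 (pow_eq_zero_iff two_ne_zero |>.1 hg)

lemma proj_eq_zero_of_neg (hP : IsSpectralFamily P) (hPA : IsSpectralIntegral P id A)
    (hpos : ∀ f : A.domain, 0 ≤ (inner ℂ (f : E) (A f)).re) {t : ℝ} (ht : t < 0) : P t = 0 := by
  ext f
  have hconst : ∀ s < t, P t f = P s f := fun s hs => sub_eq_zero.1 <| by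
    refine eq_zero_of_ae_mem_Ioc (s := s) hP hPA hpos ht ?_
    have hs0 : P s (P t f - P s f) = 0 := by
      rw [map_sub, hP.apply_apply, hP.apply_apply, min_eq_left hs.le, min_self, sub_self]
    have ht0 : P t (P t f - P s f) = P t f - P s f := by
      rw [map_sub, hP.apply_apply, hP.apply_apply, min_eq_right hs.le, min_self]
    filter_upwards [hP.ae_lt_of_apply_eq_zero hs0, hP.ae_le_of_apply_eq_self ht0] with u hu hu'
    exact ⟨hu, hu'⟩
  refine tendsto_nhds_unique (tendsto_const_nhds.congr' ?_) (hP.tendsto_atBot f)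
  filter_upwards [eventually_lt_atBot t] with s hs using hconst s hs

lemma eq_spectralIntegral_max (hA : Dense (A.domain : Set E)) (hP : IsSpectralFamily P)
    (hPA : IsSpectralIntegral P id A) (hneg : ∀ t < 0, P t = 0) :
    A = spectralIntegral P fun t => max t 0 :=
  (hPA.congr fun f => (hP.ae_nonneg hneg f).mono fun _ ht => (max_eq_left ht).symm).unique
    (isSpectralIntegral_spectralIntegral hP (by fun_prop)) hA

lemma borelCalc_zero (hP : IsSpectralFamily P) : borelCalc P (fun _ => 0) = 0 := by
  simpa using borelCalc_sub hP (.const 1) (.const 1)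

lemma proj_zero_spectralIntegral (hP : IsSpectralFamily P) {φ : ℝ → ℝ} (hφ : Measurable φ)
    (h0 : ∀ t ≤ 0, φ t = 0) (f : (spectralIntegral P φ).domain) :
    P 0 (spectralIntegral P φ f) = 0 := by
  have hmul : (fun t => (Iic (0 : ℝ)).indicator (fun _ => (1 : ℝ)) t * φ t) = fun _ => 0 := by
    ext t
    by_cases ht : t ≤ 0 <;> simp [ht, h0]
  have hcalc := borelCalc_spectralIntegral hP hφ ((IsBoundedBorel.const 1).indicator
    (measurableSet_Iic (a := (0 : ℝ)))) (hmul ▸ .const 0) f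
  rw [borelCalc_indicator_Iic hP, hmul] at hcalc
  rw [hcalc, borelCalc_zero hP, zero_apply]

lemma exists_spectralIntegral_proj_zero (hP : IsSpectralFamily P) {φ : ℝ → ℝ} (hφ : Measurable φ)
    (h0 : ∀ t ≤ 0, φ t = 0) (f : E) :
    ∃ h : P 0 f ∈ (spectralIntegral P φ).domain, spectralIntegral P φ ⟨P 0 f, h⟩ = 0 := by
  have hmul : (fun t => φ t * (Iic (0 : ℝ)).indicator (fun _ => (1 : ℝ)) t) = fun _ => 0 := by
    ext t
    by_cases ht : t ≤ 0 <;> simp [ht, h0]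
  have hcalc := exists_spectralIntegral_borelCalc hP hφ ((IsBoundedBorel.const 1).indicator
    (measurableSet_Iic (a := (0 : ℝ)))) (hmul ▸ .const 0) f
  rwa [borelCalc_indicator_Iic hP, hmul, borelCalc_zero hP, zero_apply] at hcalc

lemma proj_zero_opSqrt (hA : Dense (A.domain : Set E)) (hP : IsSpectralFamily P)
    (hPA : IsSpectralIntegral P id A) (hneg : ∀ t < 0, P t = 0) {ρ : E →L[ℂ] E}
    (hρ : ρ.IsPositive) (hker : ∀ f : A.domain, A f = 0 → ρ (f : E) = 0) (f : E) :
    P 0 (opSqrt ρ f) = 0 := by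
  have hAP := eq_spectralIntegral_max hA hP hPA hneg
  have hkill : ∀ g, opSqrt ρ (P 0 g) = 0 := fun g => by
    obtain ⟨hg, hAg⟩ : ∃ h : P 0 g ∈ A.domain, A ⟨P 0 g, h⟩ = 0 := by
      rw [hAP]
      exact exists_spectralIntegral_proj_zero hP (by fun_prop) (fun _ ht => max_eq_right ht) g
    have hsq := norm_opSqrt_sq hρ (P 0 g)
    rw [hker ⟨_, hg⟩ hAg, inner_zero_right, Complex.zero_re] at hsq
    exact norm_eq_zero.1 (pow_eq_zero_iff two_ne_zero |>.1 hsq)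
  refine ext_inner_left ℂ fun g => ?_
  rw [← hP.inner_left, inner_opSqrt, hkill, inner_zero_left, inner_zero_right]

end Positivity

section ENorm

variable {E : Type*} [SeminormedAddCommGroup E]

lemma ofReal_norm_sq (x : E) : ENNReal.ofReal (‖x‖ ^ 2) = ‖x‖ₑ ^ 2 := by
  rw [ENNReal.ofReal_pow (norm_nonneg _), ofReal_norm]

variable [InnerProductSpace ℂ E]

lemma enorm_inner_le (x y : E) : ‖inner ℂ x y‖ₑ ≤ ‖x‖ₑ * ‖y‖ₑ := by
  rw [← ofReal_norm, ← ofReal_norm, ← ofReal_norm, ← ENNReal.ofReal_mul (norm_nonneg _)]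
  exact ENNReal.ofReal_le_ofReal (norm_inner_le_norm _ _)

lemma enorm_inner_comm (x y : E) : ‖inner ℂ x y‖ₑ = ‖inner ℂ y x‖ₑ := by
  rw [← inner_conj_symm, RCLike.enorm_conj]

end ENorm

section Band

/-- The function `√t` cut down to `]a, b]`. -/
def bandSqrt (a b : ℝ) : ℝ → ℝ := (Ioc a b).indicator Real.sqrt

/-- The function `1 / √t` cut down to `]a, b]`, the inverse of `bandSqrt a b` on that band. -/
def bandInvSqrt (a b : ℝ) : ℝ → ℝ := (Ioc a b).indicator fun t => (√t)⁻¹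

variable {a b : ℝ}

lemma isBoundedBorel_bandSqrt (a b : ℝ) : IsBoundedBorel (bandSqrt a b) where
  measurable := Real.continuous_sqrt.measurable.indicator measurableSet_Ioc
  exists_abs_le := ⟨√b, fun t => by
    rw [bandSqrt, indicator]
    split_ifs with ht
    · exact (abs_of_nonneg (Real.sqrt_nonneg t)).trans_le (Real.sqrt_le_sqrt ht.2)
    · exact abs_zero.trans_le (Real.sqrt_nonneg b)⟩

lemma isBoundedBorel_bandInvSqrt (ha : 0 < a) (b : ℝ) : IsBoundedBorel (bandInvSqrt a b) where
  measurable := Real.continuous_sqrt.measurable.inv.indicator measurableSet_Ioc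
  exists_abs_le := ⟨(√a)⁻¹, fun t => by
    rw [bandInvSqrt, indicator]
    split_ifs with ht
    · rw [abs_of_nonneg (inv_nonneg.2 (Real.sqrt_nonneg t))]
      exact inv_anti₀ (Real.sqrt_pos.2 ha) (Real.sqrt_le_sqrt ht.1.le)
    · exact abs_zero.trans_le (inv_nonneg.2 (Real.sqrt_nonneg a))⟩

lemma bandSqrt_mul_bandInvSqrt (ha : 0 ≤ a) (b : ℝ) :
    (fun t => bandSqrt a b t * bandInvSqrt a b t) = (Ioc a b).indicator fun _ => 1 := by
  ext t
  simp only [bandSqrt, bandInvSqrt, indicator]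
  split_ifs with ht
  · exact mul_inv_cancel₀ (Real.sqrt_pos.2 (ha.trans_lt ht.1)).ne'
  · exact mul_zero 0

variable {E : Type*} [NormedAddCommGroup E] [InnerProductSpace ℂ E] [CompleteSpace E]
variable {P : ℝ → E →L[ℂ] E}

lemma borelCalc_indicator_Ioc (hP : IsSpectralFamily P) (h : a ≤ b) :
    borelCalc P ((Ioc a b).indicator fun _ => 1) = P b - P a := by
  have hIic : ∀ t : ℝ, IsBoundedBorel ((Iic t).indicator fun _ => 1) := fun t =>
    (IsBoundedBorel.const 1).indicator measurableSet_Iic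
  rw [← borelCalc_indicator_Iic hP b, ← borelCalc_indicator_Iic hP a,
    ← borelCalc_sub hP (hIic b) (hIic a), ← Iic_sdiff_Iic,
    indicator_sdiff (Iic_subset_Iic.2 h)]
  rfl

lemma enorm_sq_borelCalc_bandSqrt (hP : IsSpectralFamily P) (ha : 0 ≤ a) (b : ℝ) (f : E) :
    ‖borelCalc P (bandSqrt a b) f‖ₑ ^ 2 = ∫⁻ t in Ioc a b, ENNReal.ofReal t ∂scalarMeasure P f := by
  rw [enorm_sq_borelCalc hP (isBoundedBorel_bandSqrt a b), ← lintegral_indicator measurableSet_Ioc]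
  refine lintegral_congr fun t => ?_
  simp only [bandSqrt, indicator]
  split_ifs with ht
  · rw [Real.sq_sqrt (ha.trans ht.1.le)]
  · simp

lemma enorm_sq_borelCalc_bandInvSqrt (hP : IsSpectralFamily P) (ha : 0 < a) (b : ℝ) (f : E) :
    ‖borelCalc P (bandInvSqrt a b) f‖ₑ ^ 2
      = ∫⁻ t in Ioc a b, (ENNReal.ofReal t)⁻¹ ∂scalarMeasure P f := by
  rw [enorm_sq_borelCalc hP (isBoundedBorel_bandInvSqrt ha b),
    ← lintegral_indicator measurableSet_Ioc]
  refine lintegral_congr fun t => ?_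
  simp only [bandInvSqrt, indicator]
  split_ifs with ht
  · rw [inv_pow, Real.sq_sqrt (ha.trans ht.1).le, ENNReal.ofReal_inv_of_pos (ha.trans ht.1)]
  · simp

/-- The bounded operators `A^{1/2} χ_A(]1/(n+1), n+1])`, for `A = ∫ t dP_t`; they exhaust the
quadratic form of `A`. -/
def bandRoot (P : ℝ → E →L[ℂ] E) (n : ℕ) : E →L[ℂ] E := borelCalc P (bandSqrt (1 / (n + 1)) (n + 1))

/-- The inverses `A^{-1/2} χ_A(]1/(n+1), n+1])` of the operators `bandRoot`. -/
def bandInvRoot (P : ℝ → E →L[ℂ] E) (n : ℕ) : E →L[ℂ] E :=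
  borelCalc P (bandInvSqrt (1 / (n + 1)) (n + 1))

/-- The spectral projections `χ_A(]1/(n+1), n+1])`, which increase to that of `]0, ∞[`. -/
def bandProj (P : ℝ → E →L[ℂ] E) (n : ℕ) : E →L[ℂ] E := P (n + 1) - P (1 / (n + 1))

lemma one_div_le_add_one (n : ℕ) : 1 / ((n : ℝ) + 1) ≤ n + 1 := by
  rw [div_le_iff₀ n.cast_add_one_pos]
  nlinarith [n.cast_nonneg (α := ℝ)]

lemma isSelfAdjoint_bandRoot (hP : IsSpectralFamily P) (n : ℕ) : IsSelfAdjoint (bandRoot P n) :=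
  isSelfAdjoint_borelCalc hP (isBoundedBorel_bandSqrt _ _)

lemma bandRoot_mul_bandInvRoot (hP : IsSpectralFamily P) (n : ℕ) :
    bandRoot P n * bandInvRoot P n = bandProj P n := by
  have hpos : (0 : ℝ) < 1 / (n + 1) := Nat.one_div_pos_of_nat
  rw [bandRoot, bandInvRoot, ← borelCalc_mul hP (isBoundedBorel_bandSqrt _ _)
    (isBoundedBorel_bandInvSqrt hpos _), bandSqrt_mul_bandInvSqrt hpos.le,
    borelCalc_indicator_Ioc hP (one_div_le_add_one n), bandProj]

lemma norm_bandProj_apply_le (hP : IsSpectralFamily P) (n : ℕ) (f : E) :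
    ‖bandProj P n f‖ ≤ ‖f‖ := by
  refine le_of_sq_le_sq ?_ (norm_nonneg f)
  rw [bandProj, sub_apply, hP.norm_sq_sub_apply_apply (one_div_le_add_one n)]
  nlinarith [hP.norm_apply_le (n + 1) f, norm_nonneg (P (n + 1) f)]

lemma tendsto_bandProj (hP : IsSpectralFamily P) (f : E) :
    Tendsto (fun n => bandProj P n f) atTop (𝓝 (f - P 0 f)) := by
  have hcast : Tendsto (fun n : ℕ => (n : ℝ) + 1) atTop atTop :=
    tendsto_atTop_add_const_right _ _ tendsto_natCast_atTop_atTop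
  have hdiv : Tendsto (fun n : ℕ => 1 / ((n : ℝ) + 1)) atTop (𝓝[≥] 0) :=
    tendsto_nhdsWithin_iff.2 ⟨tendsto_one_div_add_atTop_nhds_zero_nat,
      .of_forall fun n => mem_Ici.2 Nat.one_div_pos_of_nat.le⟩
  exact ((hP.tendsto_atTop f).comp hcast).sub ((hP.rightCont 0 f).tendsto.comp hdiv)

lemma enorm_sq_bandRoot (hP : IsSpectralFamily P) (n : ℕ) (f : E) :
    ‖bandRoot P n f‖ₑ ^ 2
      = ∫⁻ t in Ioc (1 / ((n : ℝ) + 1)) (n + 1), ENNReal.ofReal t ∂scalarMeasure P f :=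
  enorm_sq_borelCalc_bandSqrt hP Nat.one_div_pos_of_nat.le _ f

lemma monotone_band : Monotone fun n : ℕ => Ioc (1 / ((n : ℝ) + 1)) (n + 1) := fun m n h =>
  Ioc_subset_Ioc (Nat.one_div_le_one_div h) (by gcongr)

lemma monotone_enorm_sq_bandRoot (hP : IsSpectralFamily P) (f : E) :
    Monotone fun n => ‖bandRoot P n f‖ₑ ^ 2 := fun m n h => by
  simp only [enorm_sq_bandRoot hP]
  exact lintegral_mono_set (monotone_band h)

lemma iUnion_band : ⋃ n : ℕ, Ioc (1 / ((n : ℝ) + 1)) (n + 1) = Ioi 0 := by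
  ext t
  simp only [mem_iUnion, mem_Ioc, mem_Ioi]
  refine ⟨fun ⟨n, hn⟩ => Nat.one_div_pos_of_nat.trans hn.1, fun ht => ?_⟩
  have hsmall := (tendsto_one_div_add_atTop_nhds_zero_nat (𝕜 := ℝ)).eventually_lt_const ht
  obtain ⟨n, hn, hn'⟩ := (hsmall.and (eventually_ge_atTop ⌈t⌉₊)).exists
  exact ⟨n, hn, (Nat.ceil_le.1 hn').trans (by linarith)⟩

lemma energy_eq_iSup {A : E →ₗ.[ℂ] E} (hP : IsSpectralFamily (spectralFamily A)) (f : E) :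
    energy A f = ⨆ n, ‖bandRoot (spectralFamily A) n f‖ₑ ^ 2 := by
  have hsupp : (Ioi (0 : ℝ)).indicator ENNReal.ofReal = ENNReal.ofReal :=
    indicator_eq_self.2 fun t ht => ENNReal.ofReal_pos.1 (pos_iff_ne_zero.2 ht)
  simp only [enorm_sq_bandRoot hP]
  rw [← setLIntegral_iUnion_of_directed _ monotone_band.directed_le, iUnion_band,
    ← lintegral_indicator measurableSet_Ioi, hsupp, energy]

end Band

/-! ## Hilbert--Schmidt norms -/

section HilbertSchmidt

variable {E : Type*} [NormedAddCommGroup E] [InnerProductSpace ℂ E]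

lemma enorm_sq_eq_tsum {ι : Type*} (b : HilbertBasis ι ℂ E) (x : E) :
    ‖x‖ₑ ^ 2 = ∑' i, ‖inner ℂ (b i) x‖ₑ ^ 2 := by
  have hsum : HasSum (fun i => ‖inner ℂ (b i) x‖ ^ 2) (‖x‖ ^ 2) := by
    simpa [b.repr_apply_apply] using lp.hasSum_norm (p := 2) (by norm_num) (b.repr x)
  simp only [← ofReal_norm_sq]
  rw [← hsum.tsum_eq, ENNReal.ofReal_tsum_of_nonneg (fun i => by positivity) hsum.summable]

variable [CompleteSpace E]

/-- The square of the Hilbert--Schmidt norm. -/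
def hsSq (T : E →L[ℂ] E) : ℝ≥0∞ := formTrace fun f => ‖T f‖ₑ ^ 2

lemma hsSq_star (T : E →L[ℂ] E) : hsSq (star T) = hsSq T :=
  (formTrace_adjoint T).symm

lemma isSelfAdjoint_opSqrt (T : E →L[ℂ] E) : IsSelfAdjoint (opSqrt T) :=
  .of_nonneg (CFC.sqrt_nonneg T)

lemma opSqrt_of_isStarProjection {p : E →L[ℂ] E} (hp : IsStarProjection p) : opSqrt p = p :=
  CFC.sqrt_unique hp.isIdempotentElem.eq hp.nonneg

lemma hsSq_mul_comm_of_isSelfAdjoint {S T : E →L[ℂ] E} (hS : IsSelfAdjoint S)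
    (hT : IsSelfAdjoint T) : hsSq (S * T) = hsSq (T * S) := by
  rw [← hsSq_star, star_mul, hS.star_eq, hT.star_eq]

lemma hsSq_mul_le {S : E →L[ℂ] E} (hS : ∀ f, ‖S f‖ ≤ ‖f‖) (T : E →L[ℂ] E) :
    hsSq (S * T) ≤ hsSq T :=
  ENNReal.tsum_le_tsum fun _ => pow_le_pow_left' (enorm_le_iff_norm_le.2 (hS _)) 2

lemma enorm_apply_sq_le (T : E →L[ℂ] E) (f : E) : ‖T f‖ₑ ^ 2 ≤ hsSq T * ‖f‖ₑ ^ 2 := by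
  rw [enorm_sq_eq_tsum (stdBasis E) (T f), ← hsSq_star, hsSq, formTrace, ← ENNReal.tsum_mul_right]
  refine ENNReal.tsum_le_tsum fun i => ?_
  rw [ContinuousLinearMap.star_eq_adjoint, ← ContinuousLinearMap.adjoint_inner_left, ← mul_pow]
  exact pow_le_pow_left' (enorm_inner_le _ _) 2

lemma hsSq_add_le (S T : E →L[ℂ] E) : hsSq (S + T) ≤ 2 * hsSq S + 2 * hsSq T := by
  simp only [hsSq, formTrace, ← ENNReal.tsum_mul_left, ← ENNReal.tsum_add]
  refine ENNReal.tsum_le_tsum fun i => ?_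
  obtain ⟨x, hx⟩ : ∃ x, x = S (stdBasis E i) := ⟨_, rfl⟩
  obtain ⟨y, hy⟩ : ∃ y, y = T (stdBasis E i) := ⟨_, rfl⟩
  have hsq : ‖x + y‖ ^ 2 ≤ 2 * (‖x‖ ^ 2 + ‖y‖ ^ 2) :=
    (pow_le_pow_left₀ (norm_nonneg _) (norm_add_le x y) 2).trans add_sq_le
  rw [add_apply, ← hx, ← hy, ← mul_add, ← ofReal_norm_sq, ← ofReal_norm_sq, ← ofReal_norm_sq,
    ← ENNReal.ofReal_add (by positivity) (by positivity), ← ENNReal.ofReal_ofNat 2,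
    ← ENNReal.ofReal_mul zero_le_two]
  exact ENNReal.ofReal_le_ofReal hsq

lemma trace_star_mul_self (T : E →L[ℂ] E) : trace (star T * T) = hsSq T := by
  rw [trace, hsSq]
  congr 1
  ext f
  rw [mul_apply_eq_comp, ContinuousLinearMap.star_eq_adjoint,
    ContinuousLinearMap.adjoint_inner_right, re_inner_self_eq, ofReal_norm_sq]

end HilbertSchmidt

/-! ## The spectral Cauchy--Schwarz inequality -/

/-- Layer cake: the left-hand side is the integral of `m ]0, min l r⁻¹]` over `r > 0`. -/
lemma setLIntegral_inv_mono {m ν : Measure ℝ} {l : ℝ}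
    (h : ∀ s, 0 < s → s ≤ l → m (Ioc 0 s) ≤ ν (Ioc 0 s)) :
    ∫⁻ t in Ioc 0 l, (ENNReal.ofReal t)⁻¹ ∂m ≤ ∫⁻ t in Ioc 0 l, (ENNReal.ofReal t)⁻¹ ∂ν := by
  rcases le_or_gt l 0 with hl | hl
  · simp [Ioc_eq_empty_of_le hl]
  have hlayer : ∀ m : Measure ℝ, ∫⁻ t in Ioc 0 l, (ENNReal.ofReal t)⁻¹ ∂m =
      ∫⁻ r in Ioi 0, m (Ioc 0 (min l r⁻¹)) := by
    intro m
    calc ∫⁻ t in Ioc 0 l, (ENNReal.ofReal t)⁻¹ ∂m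
        = ∫⁻ t in Ioc 0 l, ENNReal.ofReal t⁻¹ ∂m :=
          setLIntegral_congr_fun measurableSet_Ioc fun t ht =>
            (ENNReal.ofReal_inv_of_pos ht.1).symm
      _ = ∫⁻ r in Ioi 0, m.restrict (Ioc 0 l) {t | r ≤ t⁻¹} :=
          lintegral_eq_lintegral_meas_le _
            ((ae_restrict_mem measurableSet_Ioc).mono fun t ht => inv_nonneg.2 ht.1.le)
            measurable_inv.aemeasurable
      _ = _ := by
          refine setLIntegral_congr_fun measurableSet_Ioi fun r hr => ?_
          rw [Measure.restrict_apply (measurableSet_le measurable_const measurable_inv)]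
          congr 1
          ext t
          simp only [mem_inter_iff, mem_ofPred_eq, mem_Ioc, le_min_iff]
          constructor
          · rintro ⟨hrt, h0, htl⟩
            exact ⟨h0, htl, (le_inv_comm₀ hr h0).1 hrt⟩
          · rintro ⟨h0, htl, htr⟩
            exact ⟨(le_inv_comm₀ hr h0).2 htr, h0, htl⟩
  rw [hlayer m, hlayer ν]
  exact setLIntegral_mono' measurableSet_Ioi fun r hr =>
    h _ (lt_min hl (inv_pos.2 hr)) (min_le_left _ _)

section CauchySchwarz

variable {E : Type*} [NormedAddCommGroup E] [InnerProductSpace ℂ E]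

lemma enorm_sq_le_formNorm {T : E →L[ℂ] E} {q : E → ℝ≥0∞} (h : ∀ f, ‖T f‖ₑ ^ 2 ≤ q f) :
    ‖T‖ₑ ^ 2 ≤ formNorm q := by
  rcases eq_or_ne (formNorm q) ∞ with hq | hq
  · exact hq ▸ le_top
  have hT : ‖T‖ ≤ √(formNorm q).toReal := by
    refine T.opNorm_le_of_unit_norm (Real.sqrt_nonneg _) fun f hf => Real.le_sqrt_of_sq_le ?_
    rw [← ENNReal.ofReal_le_iff_le_toReal hq, ofReal_norm_sq]
    exact (h f).trans (le_iSup₂ (f := fun (g : E) (_ : ‖g‖ ≤ 1) => q g) f hf.le)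
  rw [← ofReal_norm_sq, ENNReal.ofReal_le_iff_le_toReal hq]
  exact (Real.le_sqrt (norm_nonneg _) ENNReal.toReal_nonneg).1 hT

variable [CompleteSpace E] {A : E →ₗ.[ℂ] E}

lemma formNorm_le_formTrace (hP : IsSpectralFamily (spectralFamily A)) (ρ : E →L[ℂ] E) :
    formNorm (sandwichForm A ρ) ≤ formTrace (sandwichForm A ρ) := by
  refine iSup₂_le fun f hf => ?_
  rw [sandwichForm, energy_eq_iSup hP]
  refine iSup_le fun n => ?_
  calc ‖bandRoot (spectralFamily A) n (opSqrt ρ f)‖ₑ ^ 2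
      ≤ hsSq (bandRoot (spectralFamily A) n * opSqrt ρ) * ‖f‖ₑ ^ 2 := enorm_apply_sq_le _ f
    _ ≤ hsSq (bandRoot (spectralFamily A) n * opSqrt ρ) := by
        refine mul_le_of_le_one_right zero_le (pow_le_one₀ zero_le ?_)
        rw [← ofReal_norm, ← ENNReal.ofReal_one]
        exact ENNReal.ofReal_le_ofReal hf
    _ ≤ formTrace (sandwichForm A ρ) := ENNReal.tsum_le_tsum fun i => by
        rw [sandwichForm, energy_eq_iSup hP]
        exact le_iSup (fun n => ‖bandRoot (spectralFamily A) n _‖ₑ ^ 2) n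

lemma enorm_opSqrt_sub_apply_sq_le (hP : IsSpectralFamily (spectralFamily A)) (ρ : E →L[ℂ] E)
    {a l : ℝ} (ha : 0 < a) (hal : a ≤ l) (f : E) :
    ‖opSqrt ρ (spectralFamily A l f - spectralFamily A a f)‖ₑ ^ 2 ≤
      formNorm (sandwichForm A ρ) *
        ∫⁻ t in Ioc a l, (ENNReal.ofReal t)⁻¹ ∂scalarMeasure (spectralFamily A) f := by
  set P := spectralFamily A
  have hfactor : P l f - P a f =
      borelCalc P (bandSqrt a l) (borelCalc P (bandInvSqrt a l) f) := by
    rw [borelCalc_apply_apply hP (isBoundedBorel_bandSqrt a l) (isBoundedBorel_bandInvSqrt ha l),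
      bandSqrt_mul_bandInvSqrt ha.le, borelCalc_indicator_Ioc hP hal, sub_apply]
  have hnorm : ‖borelCalc P (bandSqrt a l) * opSqrt ρ‖ₑ ^ 2 ≤ formNorm (sandwichForm A ρ) := by
    refine enorm_sq_le_formNorm fun g => ?_
    rw [mul_apply_eq_comp, enorm_sq_borelCalc_bandSqrt hP ha.le]
    exact setLIntegral_le_lintegral _ _
  have hstar : opSqrt ρ * borelCalc P (bandSqrt a l) =
      star (borelCalc P (bandSqrt a l) * opSqrt ρ) := by
    rw [star_mul, (isSelfAdjoint_opSqrt ρ).star_eq,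
      (isSelfAdjoint_borelCalc hP (isBoundedBorel_bandSqrt a l)).star_eq]
  rw [hfactor, ← enorm_sq_borelCalc_bandInvSqrt hP ha, ← mul_apply_eq_comp, hstar]
  refine (pow_le_pow_left₀ zero_le (ContinuousLinearMap.le_opENorm _ _) 2).trans ?_
  rw [mul_pow, ← ofReal_norm, norm_star, ofReal_norm]
  gcongr

/-- The Cauchy--Schwarz inequality for `ρ^{1/2} Π_l f = (ρ^{1/2} A^{1/2}) (A^{-1/2} Π_l f)`. -/
lemma enorm_opSqrt_sub_zero_apply_sq_le (hP : IsSpectralFamily (spectralFamily A))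
    (ρ : E →L[ℂ] E) {l : ℝ} (hl : 0 < l) (f : E) :
    ‖opSqrt ρ (spectralFamily A l f - spectralFamily A 0 f)‖ₑ ^ 2 ≤
      formNorm (sandwichForm A ρ) *
        ∫⁻ t in Ioc 0 l, (ENNReal.ofReal t)⁻¹ ∂scalarMeasure (spectralFamily A) f := by
  have hlim : Tendsto (fun a => spectralFamily A a f) (𝓝[>] 0) (𝓝 (spectralFamily A 0 f)) :=
    (hP.rightCont 0 f).mono Ioi_subset_Ici_self
  refine le_of_tendsto (ENNReal.Tendsto.pow
    (((opSqrt ρ).continuous.tendsto _).comp (hlim.const_sub (spectralFamily A l f))).enorm) ?_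
  filter_upwards [Ioc_mem_nhdsGT hl] with a ha
  refine (enorm_opSqrt_sub_apply_sq_le hP ρ ha.1 ha.2 f).trans ?_
  gcongr
  exact ha.1.le

/-! ## Traces of spectral projections -/

/-- The measure `I ↦ τ(T* χ_A(I) T)`, where `P` is the spectral family of `A`. -/
def traceMeasure (P : ℝ → E →L[ℂ] E) (T : E →L[ℂ] E) : Measure ℝ :=
  Measure.sum fun i => scalarMeasure P (T (stdBasis E i))

lemma setLIntegral_traceMeasure (P : ℝ → E →L[ℂ] E) (T : E →L[ℂ] E) (φ : ℝ → ℝ≥0∞) {s : Set ℝ}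
    (hs : MeasurableSet s) :
    ∫⁻ t in s, φ t ∂traceMeasure P T =
      formTrace fun f => ∫⁻ t in s, φ t ∂scalarMeasure P (T f) := by
  rw [traceMeasure, Measure.restrict_sum _ hs, lintegral_sum_measure, formTrace]

lemma IsSpectralFamily.scalarMeasure_Ioc {P : ℝ → E →L[ℂ] E} (hP : IsSpectralFamily P) (f : E)
    {s t : ℝ} (h : s ≤ t) : scalarMeasure P f (Ioc s t) = ‖P t f - P s f‖ₑ ^ 2 := by
  have hfin := hP.isFiniteMeasure f
  rw [← Iic_sdiff_Iic, measure_sdiff (Iic_subset_Iic.2 h) measurableSet_Iic.nullMeasurableSet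
    (measure_ne_top _ _), hP.scalarMeasure_Iic, hP.scalarMeasure_Iic,
    ← ENNReal.ofReal_sub _ (by positivity), ← hP.norm_sq_sub_apply_apply h, ofReal_norm_sq]

lemma traceMeasure_Ioc {P : ℝ → E →L[ℂ] E} (hP : IsSpectralFamily P) (T : E →L[ℂ] E) {s t : ℝ}
    (h : s ≤ t) : traceMeasure P T (Ioc s t) = hsSq ((P t - P s) * T) := by
  rw [traceMeasure, Measure.sum_apply _ measurableSet_Ioc, hsSq, formTrace]
  simp only [hP.scalarMeasure_Ioc _ h, mul_apply_eq_comp, sub_apply]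

lemma traceMeasure_Ioi {P : ℝ → E →L[ℂ] E} (hP : IsSpectralFamily P) (T : E →L[ℂ] E) (t : ℝ) :
    traceMeasure P T (Ioi t) = hsSq ((1 - P t) * T) := by
  rw [traceMeasure, Measure.sum_apply _ measurableSet_Ioi, hsSq, formTrace]
  simp only [hP.scalarMeasure_Ioi, mul_apply_eq_comp, sub_apply, one_apply_eq_self, ofReal_norm_sq]

lemma lintegral_traceMeasure_Ioi (hP : IsSpectralFamily (spectralFamily A))
    (hneg : ∀ t < 0, spectralFamily A t = 0) (ρ : E →L[ℂ] E) :
    ∫⁻ l in Ioi 0, traceMeasure (spectralFamily A) (opSqrt ρ) (Ioi l) =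
      formTrace (sandwichForm A ρ) := by
  have hnonneg : ∀ᵐ t ∂traceMeasure (spectralFamily A) (opSqrt ρ), 0 ≤ t :=
    (Measure.ae_sum_iff' measurableSet_Ici).2 fun i => hP.ae_nonneg hneg _
  exact (lintegral_eq_lintegral_meas_lt _ hnonneg aemeasurable_id).symm.trans
    (lintegral_sum_measure _ _)

lemma traceMeasure_Ioi_one_le (A : E →ₗ.[ℂ] E) (ρ : E →L[ℂ] E) :
    traceMeasure (spectralFamily A) (opSqrt ρ) (Ioi 1) ≤ formTrace (sandwichForm A ρ) := by
  refine le_trans ?_ (lintegral_sum_measure ENNReal.ofReal _).le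
  rw [← setLIntegral_one]
  refine (setLIntegral_mono' measurableSet_Ioi fun t ht => ?_).trans (setLIntegral_le_lintegral _ _)
  rw [← ENNReal.ofReal_one]
  exact ENNReal.ofReal_le_ofReal (le_of_lt ht)

end CauchySchwarz

/-! ## The density of low energies -/

section Density

variable {X : Type*} [MeasurableSpace X] {μ : Measure X}
variable {H : Type*} [NormedAddCommGroup H] [InnerProductSpace ℂ H] [CompleteSpace H]

lemma norm_chi_le {Ω : Set X} (hΩ : MeasurableSet Ω) (f : Lp H 2 μ) : ‖chi Ω hΩ f‖ ≤ ‖f‖ := by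
  refine Lp.norm_le_norm_of_ae_le ?_
  filter_upwards [chi_coeFn Ω hΩ f] with x hx
  rw [hx]
  exact norm_indicator_le_norm_self _ _

lemma isStarProjection_chi {Ω : Set X} (hΩ : MeasurableSet Ω) :
    IsStarProjection (chi Ω hΩ : Lp H 2 μ →L[ℂ] Lp H 2 μ) where
  isSelfAdjoint := ContinuousLinearMap.isSelfAdjoint_iff_isSymmetric.2 fun f g =>
    (inner_chi Ω hΩ f g).symm
  isIdempotentElem := by
    refine ContinuousLinearMap.ext fun f => Lp.ext ?_
    filter_upwards [chi_coeFn Ω hΩ (chi Ω hΩ f), chi_coeFn Ω hΩ f] with x h1 h2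
    rw [mul_apply_eq_comp, h1, h2]
    by_cases hx : x ∈ Ω <;> simp [hx, h2]

lemma densityMeasure_eq_hsSq (P : Lp H 2 μ →L[ℂ] Lp H 2 μ) {Ω : Set X} (hΩ : MeasurableSet Ω) :
    densityMeasure P Ω = hsSq (chi Ω hΩ * opSqrt P) := by
  have hchi := isStarProjection_chi (μ := μ) (H := H) hΩ
  have hstar : opSqrt P * chi Ω hΩ * opSqrt P =
      star (chi Ω hΩ * opSqrt P) * (chi Ω hΩ * opSqrt P) := by
    rw [star_mul, (isSelfAdjoint_opSqrt P).star_eq, hchi.isSelfAdjoint.star_eq, mul_assoc,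
      mul_assoc, ← mul_assoc (chi Ω hΩ), hchi.isIdempotentElem.eq]
  rw [densityMeasure_apply P hΩ, hstar, trace_star_mul_self]

lemma densityMeasure_le_density_mul (P : Lp H 2 μ →L[ℂ] Lp H 2 μ) {Ω : Set X}
    (hΩ : MeasurableSet Ω) (hμ : μ Ω ≠ ∞) : densityMeasure P Ω ≤ density P * μ Ω := by
  rcases eq_or_ne (μ Ω) 0 with h0 | h0
  · rw [densityMeasure_absolutelyContinuous P h0]
    exact zero_le
  · rw [← ENNReal.div_le_iff h0 hμ]
    exact le_iSup₂ (f := fun (Ω : Set X) (_ : MeasurableSet Ω) => densityMeasure P Ω / μ Ω) Ω hΩ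

variable {A : Lp H 2 μ →ₗ.[ℂ] Lp H 2 μ}

lemma isStarProjection_spectralProj (hP : IsSpectralFamily (spectralFamily A)) (l : ℝ) :
    IsStarProjection (spectralProj A l) :=
  (hP.isStarProjection 0).sub_of_mul_eq_left (hP.isStarProjection _)
    (hP.mono 0 _ (le_max_right l 0))

lemma densityMeasure_spectralProj (hP : IsSpectralFamily (spectralFamily A)) (l : ℝ) {Ω : Set X}
    (hΩ : MeasurableSet Ω) :
    densityMeasure (spectralProj A l) Ω =
      traceMeasure (spectralFamily A) (chi Ω hΩ) (Ioc 0 (max l 0)) := by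
  have hproj := isStarProjection_spectralProj hP l
  rw [densityMeasure_eq_hsSq _ hΩ, opSqrt_of_isStarProjection hproj,
    traceMeasure_Ioc hP _ (le_max_right l 0)]
  exact hsSq_mul_comm_of_isSelfAdjoint (isStarProjection_chi hΩ).isSelfAdjoint hproj.isSelfAdjoint

lemma monotone_spectralDensity (hP : IsSpectralFamily (spectralFamily A)) :
    Monotone (spectralDensity A) := by
  refine fun l m h => iSup₂_mono fun Ω hΩ => ?_
  rw [densityMeasure_spectralProj hP _ hΩ, densityMeasure_spectralProj hP _ hΩ]
  gcongr

lemma spectralDensity_of_nonpos (hP : IsSpectralFamily (spectralFamily A)) {l : ℝ} (h : l ≤ 0) :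
    spectralDensity A l = 0 := by
  refine le_antisymm (iSup₂_le fun Ω hΩ => ?_) zero_le
  simp [densityMeasure_spectralProj hP _ hΩ, max_eq_right h]

/-- The Stieltjes measure `dF` of the spectral density. -/
def densityStieltjes (A : Lp H 2 μ →ₗ.[ℂ] Lp H 2 μ) : Measure ℝ :=
  stieltjesMeasure fun t => (spectralDensity A t).toReal

lemma spectralDensity_le_densityStieltjes_Icc (hP : IsSpectralFamily (spectralFamily A))
    (hF : ∀ l : ℝ, spectralDensity A l ≠ ∞) (s : ℝ) :
    spectralDensity A s ≤ densityStieltjes A (Icc 0 s) := by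
  have hm : Monotone fun t => (spectralDensity A t).toReal := fun _ m h =>
    ENNReal.toReal_mono (hF m) (monotone_spectralDensity hP h)
  have h0 : Function.leftLim hm.stieltjesFunction 0 = 0 := by
    refine leftLim_eq_of_tendsto (tendsto_const_nhds.congr' ?_)
    filter_upwards [self_mem_nhdsWithin] with t ht
    rw [Monotone.stieltjesFunction_eq]
    symm
    refine rightLim_eq_of_tendsto (tendsto_const_nhds.congr' ?_)
    filter_upwards [Ioo_mem_nhdsGT (show t < 0 from ht)] with u hu
    rw [spectralDensity_of_nonpos hP hu.2.le, ENNReal.toReal_zero]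
  rw [densityStieltjes, stieltjesMeasure, dif_pos hm, StieltjesFunction.measure_Icc, h0, sub_zero,
    Monotone.stieltjesFunction_eq, ← ENNReal.ofReal_toReal (hF s)]
  exact ENNReal.ofReal_le_ofReal (hm.le_rightLim le_rfl)

lemma densityStieltjes_singleton_zero (hG : stieltjesG A 0 ≠ ∞) : densityStieltjes A {0} = 0 := by
  by_contra hne
  refine hG (top_unique ?_)
  rw [stieltjesG, Icc_self, lintegral_singleton, ENNReal.ofReal_zero, ENNReal.inv_zero]
  exact (ENNReal.top_mul hne).ge

lemma spectralDensity_le_densityStieltjes_Ioc (hP : IsSpectralFamily (spectralFamily A))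
    (hF : ∀ l : ℝ, spectralDensity A l ≠ ∞) (hG : stieltjesG A 0 ≠ ∞) {s : ℝ}
    (hs : 0 < s) : spectralDensity A s ≤ densityStieltjes A (Ioc 0 s) := by
  refine (spectralDensity_le_densityStieltjes_Icc hP hF s).trans ?_
  rw [← Ioc_union_left hs.le]
  refine (measure_union_le _ _).trans ?_
  rw [densityStieltjes_singleton_zero hG, add_zero]

lemma setLIntegral_inv_traceMeasure_chi_le (hP : IsSpectralFamily (spectralFamily A))
    (hF : ∀ l : ℝ, spectralDensity A l ≠ ∞) (hG : stieltjesG A 0 ≠ ∞) (l : ℝ)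
    {Ω : Set X} (hΩ : MeasurableSet Ω) (hμ : μ Ω ≠ ∞) :
    ∫⁻ t in Ioc 0 l, (ENNReal.ofReal t)⁻¹ ∂traceMeasure (spectralFamily A) (chi Ω hΩ) ≤
      μ Ω * stieltjesG A l := by
  calc ∫⁻ t in Ioc 0 l, (ENNReal.ofReal t)⁻¹ ∂traceMeasure (spectralFamily A) (chi Ω hΩ)
      ≤ ∫⁻ t in Ioc 0 l, (ENNReal.ofReal t)⁻¹ ∂(μ Ω • densityStieltjes A) := by
        refine setLIntegral_inv_mono fun s hs _ => ?_
        have hdens := densityMeasure_spectralProj hP s hΩ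
        rw [max_eq_left hs.le] at hdens
        rw [← hdens, Measure.smul_apply, smul_eq_mul, mul_comm]
        exact (densityMeasure_le_density_mul _ hΩ hμ).trans
          (mul_le_mul_left (spectralDensity_le_densityStieltjes_Ioc hP hF hG hs) _)
    _ = μ Ω * ∫⁻ t in Ioc 0 l, (ENNReal.ofReal t)⁻¹ ∂densityStieltjes A := by
        rw [Measure.restrict_smul, lintegral_smul_measure, smul_eq_mul]
    _ ≤ μ Ω * stieltjesG A l := by
        gcongr
        exact lintegral_mono_set Ioc_subset_Icc_self

lemma hsSq_chi_mul_spectralProj_mul_opSqrt_le (hP : IsSpectralFamily (spectralFamily A))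
    (hF : ∀ l : ℝ, spectralDensity A l ≠ ∞) (hG : stieltjesG A 0 ≠ ∞)
    (ρ : Lp H 2 μ →L[ℂ] Lp H 2 μ) {l : ℝ} (hl : 0 < l) {Ω : Set X} (hΩ : MeasurableSet Ω)
    (hμ : μ Ω ≠ ∞) :
    hsSq (chi Ω hΩ * spectralProj A l * opSqrt ρ) ≤
      formNorm (sandwichForm A ρ) * (μ Ω * stieltjesG A l) := by
  have hstar : star (chi Ω hΩ * spectralProj A l * opSqrt ρ) =
      opSqrt ρ * (spectralProj A l * chi Ω hΩ) := by
    rw [star_mul, star_mul, (isSelfAdjoint_opSqrt ρ).star_eq,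
      (isStarProjection_chi (μ := μ) (H := H) hΩ).isSelfAdjoint.star_eq,
      (isStarProjection_spectralProj hP l).isSelfAdjoint.star_eq]
  calc hsSq (chi Ω hΩ * spectralProj A l * opSqrt ρ)
      = hsSq (opSqrt ρ * (spectralProj A l * chi Ω hΩ)) := by rw [← hstar, hsSq_star]
    _ ≤ formTrace fun f => formNorm (sandwichForm A ρ) * ∫⁻ t in Ioc 0 l, (ENNReal.ofReal t)⁻¹
          ∂scalarMeasure (spectralFamily A) (chi Ω hΩ f) := by
        refine ENNReal.tsum_le_tsum fun i => ?_
        simp only [mul_apply_eq_comp, spectralProj, max_eq_left hl.le, sub_apply]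
        exact enorm_opSqrt_sub_zero_apply_sq_le hP ρ hl _
    _ = formNorm (sandwichForm A ρ) * ∫⁻ t in Ioc 0 l, (ENNReal.ofReal t)⁻¹
          ∂traceMeasure (spectralFamily A) (chi Ω hΩ) := by
        rw [setLIntegral_traceMeasure _ _ _ measurableSet_Ioc, formTrace, formTrace,
          ENNReal.tsum_mul_left]
    _ ≤ formNorm (sandwichForm A ρ) * (μ Ω * stieltjesG A l) := by
        gcongr
        exact setLIntegral_inv_traceMeasure_chi_le hP hF hG l hΩ hμ

end Density

/-! ## The density inequality -/

lemma lintegral_eq_lintegral_meas_ofReal_lt {X : Type*} [MeasurableSpace X] (ν : Measure X)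
    {g : X → ℝ≥0∞} (hg : Measurable g) :
    ∫⁻ x, g x ∂ν = ∫⁻ l in Ioi (0 : ℝ), ν {x | ENNReal.ofReal l < g x} := by
  rcases eq_or_ne (ν {x | g x = ∞}) 0 with htop | htop
  · have hfin : ∀ᵐ x ∂ν, g x ≠ ∞ := measure_eq_zero_iff_ae_notMem.1 htop
    calc ∫⁻ x, g x ∂ν = ∫⁻ x, ENNReal.ofReal (g x).toReal ∂ν :=
          lintegral_congr_ae (hfin.mono fun x hx => (ENNReal.ofReal_toReal hx).symm)
      _ = ∫⁻ l in Ioi (0 : ℝ), ν {x | l < (g x).toReal} :=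
          lintegral_eq_lintegral_meas_lt ν (.of_forall fun _ => ENNReal.toReal_nonneg)
            hg.ennreal_toReal.aemeasurable
      _ = ∫⁻ l in Ioi (0 : ℝ), ν {x | ENNReal.ofReal l < g x} := by
          refine setLIntegral_congr_fun measurableSet_Ioi fun l hl => measure_congr ?_
          filter_upwards [hfin] with x hx
          exact propext (ENNReal.ofReal_lt_iff_lt_toReal (le_of_lt hl) hx).symm
  · rw [lintegral_eq_top_of_measure_eq_top_ne_zero hg.aemeasurable htop]
    refine (top_unique ?_).symm
    calc ∞ = ∫⁻ _ in Ioi (0 : ℝ), ν {x | g x = ∞} := by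
          rw [setLIntegral_const, Real.volume_Ioi, ENNReal.mul_top htop]
      _ ≤ ∫⁻ l in Ioi (0 : ℝ), ν {x | ENNReal.ofReal l < g x} :=
          lintegral_mono fun l => measure_mono fun x hx => by
            rw [mem_ofPred_eq] at hx ⊢
            exact hx ▸ ENNReal.ofReal_lt_top

section MainInequality

variable {X : Type*} [MeasurableSpace X] {μ : Measure X}
variable {H : Type*} [NormedAddCommGroup H] [InnerProductSpace ℂ H] [CompleteSpace H]
variable {A : Lp H 2 μ →ₗ.[ℂ] Lp H 2 μ} {ρ : Lp H 2 μ →L[ℂ] Lp H 2 μ}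

lemma monotone_invG (A : Lp H 2 μ →ₗ.[ℂ] Lp H 2 μ) : Monotone (invG A) := fun _ _ h =>
  iSup₂_mono fun _ _ => iSup_mono' fun hle => ⟨hle.trans h, le_rfl⟩

lemma stieltjesG_le_of_lt_invG {l : ℝ} {y : ℝ≥0∞} (h : ENNReal.ofReal l < invG A y) :
    stieltjesG A l ≤ y := by
  simp only [invG, lt_iSup_iff] at h
  obtain ⟨m, -, hm, hlm⟩ := h
  exact (lintegral_mono_set (Icc_subset_Icc_right (ENNReal.ofReal_lt_ofReal_iff'.1 hlm).1.le)).trans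
    hm

lemma densityMeasure_le_add (hP : IsSpectralFamily (spectralFamily A))
    (hr : ∀ f, spectralFamily A 0 (opSqrt ρ f) = 0) {l : ℝ} (hl : 0 < l) {Ω : Set X}
    (hΩ : MeasurableSet Ω) :
    densityMeasure ρ Ω ≤ 2 * hsSq (chi Ω hΩ * spectralProj A l * opSqrt ρ) +
      2 * traceMeasure (spectralFamily A) (opSqrt ρ) (Ioi l) := by
  have hsplit : chi Ω hΩ * opSqrt ρ = chi Ω hΩ * spectralProj A l * opSqrt ρ +
      chi Ω hΩ * ((1 - spectralFamily A l) * opSqrt ρ) := by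
    ext1 f
    simp [mul_apply_eq_comp, spectralProj, max_eq_left hl.le, hr]
  rw [densityMeasure_eq_hsSq ρ hΩ, hsplit, traceMeasure_Ioi hP]
  refine (hsSq_add_le _ _).trans ?_
  have hchi : ∀ f : Lp H 2 μ, ‖chi Ω hΩ f‖ ≤ ‖f‖ := norm_chi_le hΩ
  gcongr 2 * _ + 2 * ?_
  exact hsSq_mul_le hchi _

lemma densityMeasure_ne_top (hP : IsSpectralFamily (spectralFamily A))
    (hF : ∀ l : ℝ, spectralDensity A l ≠ ∞) (hG : ∀ l : ℝ, stieltjesG A l ≠ ∞)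
    (hr : ∀ f, spectralFamily A 0 (opSqrt ρ f) = 0) (hE : formTrace (sandwichForm A ρ) ≠ ∞)
    {Ω : Set X} (hΩ : MeasurableSet Ω) (hμ : μ Ω ≠ ∞) : densityMeasure ρ Ω ≠ ∞ := by
  have hnorm : formNorm (sandwichForm A ρ) ≠ ∞ :=
    ne_top_of_le_ne_top hE (formNorm_le_formTrace hP ρ)
  have hlow : hsSq (chi Ω hΩ * spectralProj A 1 * opSqrt ρ) ≠ ∞ :=
    ne_top_of_le_ne_top (ENNReal.mul_ne_top hnorm (ENNReal.mul_ne_top hμ (hG 1)))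
      (hsSq_chi_mul_spectralProj_mul_opSqrt_le hP hF (hG 0) ρ one_pos hΩ hμ)
  have hhigh : traceMeasure (spectralFamily A) (opSqrt ρ) (Ioi 1) ≠ ∞ :=
    ne_top_of_le_ne_top hE (traceMeasure_Ioi_one_le A ρ)
  exact ne_top_of_le_ne_top (ENNReal.add_ne_top.2 ⟨ENNReal.mul_ne_top ENNReal.ofNat_ne_top hlow,
    ENNReal.mul_ne_top ENNReal.ofNat_ne_top hhigh⟩) (densityMeasure_le_add hP hr one_pos hΩ)

lemma densityMeasure_le_of_le_densityFun (hP : IsSpectralFamily (spectralFamily A))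
    (hF : ∀ l : ℝ, spectralDensity A l ≠ ∞) (hG : ∀ l : ℝ, stieltjesG A l ≠ ∞)
    (hr : ∀ f, spectralFamily A 0 (opSqrt ρ f) = 0) (hE : formTrace (sandwichForm A ρ) ≠ ∞)
    {l : ℝ} (hl : 0 < l) {Ω : Set X} (hΩ : MeasurableSet Ω) (hμ : μ Ω ≠ ∞)
    (hle : ∀ x ∈ Ω, 4 * formNorm (sandwichForm A ρ) * stieltjesG A l ≤ densityFun ρ x) :
    densityMeasure ρ Ω ≤ 4 * traceMeasure (spectralFamily A) (opSqrt ρ) (Ioi l) := by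
  obtain ⟨tail, htail⟩ : ∃ t, t = traceMeasure (spectralFamily A) (opSqrt ρ) (Ioi l) := ⟨_, rfl⟩
  have hdens : 4 * formNorm (sandwichForm A ρ) * stieltjesG A l * μ Ω ≤ densityMeasure ρ Ω := by
    rw [← setLIntegral_const]
    exact (setLIntegral_mono' hΩ hle).trans (Measure.setLIntegral_rnDeriv_le Ω)
  -- The low energies carry at most half of the mass of `ρ` on `Ω`, so they can be absorbed.
  have htwice : densityMeasure ρ Ω + densityMeasure ρ Ω ≤ densityMeasure ρ Ω + 4 * tail := by
    calc densityMeasure ρ Ω + densityMeasure ρ Ω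
        ≤ 2 * (2 * hsSq (chi Ω hΩ * spectralProj A l * opSqrt ρ) + 2 * tail) := by
          rw [← two_mul, htail]
          gcongr
          exact densityMeasure_le_add hP hr hl hΩ
      _ ≤ 2 * (2 * (formNorm (sandwichForm A ρ) * (μ Ω * stieltjesG A l)) + 2 * tail) := by
          gcongr
          exact hsSq_chi_mul_spectralProj_mul_opSqrt_le hP hF (hG 0) ρ hl hΩ hμ
      _ = 4 * formNorm (sandwichForm A ρ) * stieltjesG A l * μ Ω + 4 * tail := by ring
      _ ≤ densityMeasure ρ Ω + 4 * tail := by gcongr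
  rw [← htail]
  exact (ENNReal.add_le_add_iff_left (densityMeasure_ne_top hP hF hG hr hE hΩ hμ)).1 htwice

variable [SigmaFinite μ]

lemma densityMeasure_superlevel_le (hP : IsSpectralFamily (spectralFamily A))
    (hF : ∀ l : ℝ, spectralDensity A l ≠ ∞) (hG : ∀ l : ℝ, stieltjesG A l ≠ ∞)
    (hr : ∀ f, spectralFamily A 0 (opSqrt ρ f) = 0) (hE : formTrace (sandwichForm A ρ) ≠ ∞)
    {l : ℝ} (hl : 0 < l) :
    densityMeasure ρ {x | 4 * formNorm (sandwichForm A ρ) * stieltjesG A l ≤ densityFun ρ x} ≤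
      4 * traceMeasure (spectralFamily A) (opSqrt ρ) (Ioi l) := by
  have hΩ : MeasurableSet
      {x | 4 * formNorm (sandwichForm A ρ) * stieltjesG A l ≤ densityFun ρ x} :=
    measurableSet_le measurable_const (Measure.measurable_rnDeriv _ _)
  rw [← inter_univ {x | _}, ← iUnion_spanningSets μ, inter_iUnion, Monotone.measure_iUnion
    fun m n h => inter_subset_inter_right _ (monotone_spanningSets μ h)]
  refine iSup_le fun n => densityMeasure_le_of_le_densityFun hP hF hG hr hE hl
    (hΩ.inter (measurableSet_spanningSets μ n)) ?_ fun x hx => hx.1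
  exact ne_top_of_le_ne_top (measure_spanningSets_lt_top μ n).ne (measure_mono inter_subset_right)

theorem lintegral_invG_le (hP : IsSpectralFamily (spectralFamily A))
    (hneg : ∀ t < 0, spectralFamily A t = 0)
    (hF : ∀ l : ℝ, spectralDensity A l ≠ ∞) (hG : ∀ l : ℝ, stieltjesG A l ≠ ∞)
    (hr : ∀ f, spectralFamily A 0 (opSqrt ρ f) = 0) :
    ∫⁻ x, invG A (densityFun ρ x / (4 * formNorm (sandwichForm A ρ))) ∂densityMeasure ρ ≤
      4 * formTrace (sandwichForm A ρ) := by
  rcases eq_or_ne (formTrace (sandwichForm A ρ)) ∞ with hE | hE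
  · rw [hE, ENNReal.mul_top four_ne_zero]
    exact le_top
  have hmeas : Measurable fun x => invG A (densityFun ρ x / (4 * formNorm (sandwichForm A ρ))) :=
    (monotone_invG A).measurable.comp ((Measure.measurable_rnDeriv _ _).div_const _)
  rw [lintegral_eq_lintegral_meas_ofReal_lt _ hmeas, ← lintegral_traceMeasure_Ioi hP hneg,
    ← lintegral_const_mul' _ _ ENNReal.ofNat_ne_top]
  refine setLIntegral_mono' measurableSet_Ioi fun l hl => ?_
  refine (measure_mono fun x hx => ?_).trans (densityMeasure_superlevel_le hP hF hG hr hE hl)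
  rw [mem_ofPred_eq, mul_comm]
  exact ENNReal.mul_le_of_le_div (stieltjesG_le_of_lt_invG hx)

end MainInequality

/-! ## The trace of `A^{1/2} ρ A^{1/2}` -/

section BandCalculus

variable {E : Type*} [NormedAddCommGroup E] [InnerProductSpace ℂ E] [CompleteSpace E]
variable {P : ℝ → E →L[ℂ] E} {A : E →ₗ.[ℂ] E}

lemma borelCalc_indicator_band (hP : IsSpectralFamily P) (n : ℕ) :
    borelCalc P ((Ioc (1 / ((n : ℝ) + 1)) (n + 1)).indicator fun _ => 1) = bandProj P n :=
  borelCalc_indicator_Ioc hP (one_div_le_add_one n)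

lemma indicator_Ioc_mul_sqrt (a b : ℝ) :
    (fun t => (Ioc a b).indicator (fun _ => 1) t * √t) = bandSqrt a b := by
  ext t
  by_cases ht : t ∈ Ioc a b <;> simp only [bandSqrt, ht, indicator_of_mem, indicator_of_notMem,
    not_false_eq_true, one_mul, zero_mul]

lemma bandInvSqrt_mul_max {a : ℝ} (ha : 0 ≤ a) (b : ℝ) :
    (fun t => bandInvSqrt a b t * max t 0) = bandSqrt a b := by
  ext t
  simp only [bandSqrt, bandInvSqrt, indicator]
  split_ifs with ht
  · rw [max_eq_left (ha.trans ht.1.le), inv_mul_eq_div, Real.div_sqrt]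
  · exact zero_mul _

lemma bandProj_spectralIntegral_sqrt (hP : IsSpectralFamily P) (n : ℕ)
    (f : (spectralIntegral P Real.sqrt).domain) :
    bandProj P n (spectralIntegral P Real.sqrt f) = bandRoot P n f := by
  have hmul := indicator_Ioc_mul_sqrt (1 / ((n : ℝ) + 1)) (n + 1)
  rw [← borelCalc_indicator_band hP, borelCalc_spectralIntegral hP Real.continuous_sqrt.measurable
    ((IsBoundedBorel.const 1).indicator measurableSet_Ioc) (hmul ▸ isBoundedBorel_bandSqrt _ _),
    hmul, bandRoot]

lemma exists_spectralIntegral_sqrt_bandProj (hP : IsSpectralFamily P) (n : ℕ) (f : E) :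
    ∃ h : bandProj P n f ∈ (spectralIntegral P Real.sqrt).domain,
      spectralIntegral P Real.sqrt ⟨bandProj P n f, h⟩ = bandRoot P n f := by
  have hmul := indicator_Ioc_mul_sqrt (1 / ((n : ℝ) + 1)) (n + 1)
  simp only [mul_comm _ (√_)] at hmul
  have hcalc := exists_spectralIntegral_borelCalc hP Real.continuous_sqrt.measurable
    ((IsBoundedBorel.const 1).indicator measurableSet_Ioc) (hmul ▸ isBoundedBorel_bandSqrt _ _) f
  rwa [borelCalc_indicator_band hP, hmul] at hcalc

lemma bandProj_mul_bandRoot (hP : IsSpectralFamily P) (n : ℕ) :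
    bandProj P n * bandRoot P n = bandRoot P n := by
  have hmul : (fun t => (Ioc (1 / ((n : ℝ) + 1)) (n + 1)).indicator (fun _ => 1) t *
      bandSqrt (1 / (n + 1)) (n + 1) t) = bandSqrt (1 / (n + 1)) (n + 1) := by
    ext t
    simp only [bandSqrt, indicator]
    split_ifs <;> simp only [one_mul, mul_zero]
  rw [← borelCalc_indicator_band hP, bandRoot, ← borelCalc_mul hP
    ((IsBoundedBorel.const 1).indicator measurableSet_Ioc) (isBoundedBorel_bandSqrt _ _), hmul]

lemma bandInvRoot_apply (hA : Dense (A.domain : Set E)) (hP : IsSpectralFamily P)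
    (hPA : IsSpectralIntegral P id A) (hneg : ∀ t < 0, P t = 0) (n : ℕ) (f : A.domain) :
    bandInvRoot P n (A f) = bandRoot P n f := by
  have hpos : (0 : ℝ) < 1 / (n + 1) := Nat.one_div_pos_of_nat
  have hmul := bandInvSqrt_mul_max hpos.le (n + 1)
  obtain rfl := eq_spectralIntegral_max hA hP hPA hneg
  rw [bandInvRoot, borelCalc_spectralIntegral hP (by fun_prop) (isBoundedBorel_bandInvSqrt hpos _)
    (hmul ▸ isBoundedBorel_bandSqrt _ _), hmul, bandRoot]

end BandCalculus

lemma tsum_iSup_of_monotone {ι : Type*} {f : ι → ℕ → ℝ≥0∞} (hf : ∀ i, Monotone (f i)) :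
    ∑' i, ⨆ n, f i n = ⨆ n, ∑' i, f i n := by
  simp only [ENNReal.tsum_eq_iSup_sum]
  rw [iSup_comm]
  exact iSup_congr fun s => ENNReal.finsetSum_iSup_of_monotone hf

section Trace

variable {E : Type*} [NormedAddCommGroup E] [InnerProductSpace ℂ E] [CompleteSpace E]
variable {A : E →ₗ.[ℂ] E}

lemma formTrace_sandwichForm (hP : IsSpectralFamily (spectralFamily A)) (ρ : E →L[ℂ] E) :
    formTrace (sandwichForm A ρ) =
      ⨆ n, hsSq (opSqrt ρ * bandRoot (spectralFamily A) n) := by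
  simp only [hsSq_mul_comm_of_isSelfAdjoint (isSelfAdjoint_opSqrt ρ) (isSelfAdjoint_bandRoot hP _)]
  simp only [formTrace, sandwichForm, energy_eq_iSup hP, hsSq]
  exact tsum_iSup_of_monotone fun i => monotone_enorm_sq_bandRoot hP _

lemma sqrtOp_eq (hP : IsSpectralFamily (spectralFamily A)) :
    sqrtOp A = spectralIntegral (spectralFamily A) Real.sqrt := by
  have hsqrt := isSpectralIntegral_spectralIntegral hP Real.continuous_sqrt.measurable
  have hex : ∃ S : E →ₗ.[ℂ] E, IsSpectralIntegral (spectralFamily A) Real.sqrt S := ⟨_, hsqrt⟩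
  rw [sqrtOp, funCalc, dif_pos hex]
  exact (hsqrt.unique hex.choose_spec
    (dense_domain_spectralIntegral hP Real.continuous_sqrt.measurable)).symm

lemma sum_enorm_sq_le_hsSq (T : E →L[ℂ] E) {ι : Type*} [Fintype ι] {v : ι → E}
    (hv : Orthonormal ℂ v) : ∑ i, ‖T (v i)‖ₑ ^ 2 ≤ hsSq T := by
  rw [← hsSq_star, hsSq, formTrace]
  calc ∑ i, ‖T (v i)‖ₑ ^ 2 = ∑ i, ∑' j, ‖inner ℂ (stdBasis E j) (T (v i))‖ₑ ^ 2 :=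
        Finset.sum_congr rfl fun i _ => enorm_sq_eq_tsum (stdBasis E) _
    _ = ∑' j, ∑ i, ‖inner ℂ (stdBasis E j) (T (v i))‖ₑ ^ 2 :=
        (Summable.tsum_finsetSum fun _ _ => ENNReal.summable).symm
    _ ≤ ∑' j, ‖star T (stdBasis E j)‖ₑ ^ 2 := by
        refine ENNReal.tsum_le_tsum fun j => ?_
        have hbessel := ENNReal.ofReal_le_ofReal
          (hv.sum_inner_products_le (star T (stdBasis E j)) (s := Finset.univ))
        rw [ENNReal.ofReal_sum_of_nonneg fun _ _ => by positivity] at hbessel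
        simp only [ofReal_norm_sq] at hbessel
        refine hbessel.trans_eq' (Finset.sum_congr rfl fun i _ => ?_)
        rw [ContinuousLinearMap.star_eq_adjoint, ContinuousLinearMap.adjoint_inner_right,
          enorm_inner_comm]

lemma tendsto_bandRoot_apply (hP : IsSpectralFamily (spectralFamily A))
    (f : (spectralIntegral (spectralFamily A) Real.sqrt).domain) :
    Tendsto (fun n => bandRoot (spectralFamily A) n f) atTop
      (𝓝 (spectralIntegral (spectralFamily A) Real.sqrt f)) := by
  have hlim := tendsto_bandProj hP (spectralIntegral (spectralFamily A) Real.sqrt f)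
  simp only [bandProj_spectralIntegral_sqrt hP] at hlim
  rwa [proj_zero_spectralIntegral hP Real.continuous_sqrt.measurable
    fun t ht => Real.sqrt_eq_zero_of_nonpos ht, sub_zero] at hlim

lemma sandwichTrace_le (hP : IsSpectralFamily (spectralFamily A)) (ρ : E →L[ℂ] E) :
    sandwichTrace (sqrtOp A) ρ ≤ formTrace (sandwichForm A ρ) := by
  rw [sqrtOp_eq hP, formTrace_sandwichForm hP]
  refine iSup_le fun n => iSup₂_le fun v hv => ?_
  have hlim : Tendsto (fun m => ∑ i, ‖(opSqrt ρ * bandRoot (spectralFamily A) m) (v i)‖ₑ ^ 2) atTop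
      (𝓝 (∑ i, ‖opSqrt ρ (spectralIntegral (spectralFamily A) Real.sqrt (v i))‖ₑ ^ 2)) :=
    tendsto_finsetSum _ fun i _ => ENNReal.Tendsto.pow
      (((opSqrt ρ).continuous.tendsto _).comp (tendsto_bandRoot_apply hP (v i))).enorm
  exact le_of_tendsto' hlim fun m => (sum_enorm_sq_le_hsSq _ hv).trans
    (le_iSup (fun m => hsSq (opSqrt ρ * bandRoot (spectralFamily A) m)) m)

lemma hsSq_eq_tsum_of_mem {K : Submodule ℂ E} {ι : Type*} (b : HilbertBasis ι ℂ K)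
    (T : E →L[ℂ] E) (hT : ∀ f, star T f ∈ K) : hsSq T = ∑' k, ‖T (b k : E)‖ₑ ^ 2 := by
  rw [← hsSq_star, hsSq, formTrace]
  calc ∑' i, ‖star T (stdBasis E i)‖ₑ ^ 2
      = ∑' i, ∑' k, ‖inner ℂ (stdBasis E i) (T (b k : E))‖ₑ ^ 2 := by
        refine tsum_congr fun i => (enorm_sq_eq_tsum b ⟨_, hT (stdBasis E i)⟩).trans ?_
        refine tsum_congr fun k => ?_
        change ‖inner ℂ (b k : E) (ContinuousLinearMap.adjoint T (stdBasis E i))‖ₑ ^ 2 = _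
        rw [ContinuousLinearMap.adjoint_inner_right, enorm_inner_comm]
    _ = ∑' k, ∑' i, ‖inner ℂ (stdBasis E i) (T (b k : E))‖ₑ ^ 2 := ENNReal.tsum_comm
    _ = ∑' k, ‖T (b k : E)‖ₑ ^ 2 := tsum_congr fun k => (enorm_sq_eq_tsum (stdBasis E) _).symm

lemma tsum_le_sandwichTrace (S : E →ₗ.[ℂ] E) (ρ : E →L[ℂ] E) {ι : Type*} (v : ι → S.domain)
    (hv : Orthonormal ℂ fun i => (v i : E)) :
    ∑' i, ‖opSqrt ρ (S (v i))‖ₑ ^ 2 ≤ sandwichTrace S ρ := by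
  rw [ENNReal.tsum_eq_iSup_sum]
  refine iSup_le fun s => ?_
  rw [← Finset.sum_coe_sort s, ← Equiv.sum_comp s.equivFin.symm]
  exact le_iSup_of_le s.card (le_iSup₂_of_le (fun i => v (s.equivFin.symm i))
    (hv.comp _ (Subtype.val_injective.comp s.equivFin.symm.injective)) le_rfl)

lemma le_sandwichTrace (hP : IsSpectralFamily (spectralFamily A)) (ρ : E →L[ℂ] E) :
    formTrace (sandwichForm A ρ) ≤ sandwichTrace (sqrtOp A) ρ := by
  rw [sqrtOp_eq hP, formTrace_sandwichForm hP]
  refine iSup_le fun n => ?_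
  let K : Submodule ℂ E := (1 - bandProj (spectralFamily A) n).ker
  have hK : ∀ f, f ∈ K ↔ f = bandProj (spectralFamily A) n f := fun f => sub_eq_zero
  have : CompleteSpace K := (1 - bandProj (spectralFamily A) n).isClosed_ker.completeSpace_coe
  obtain ⟨w, b, -⟩ := exists_hilbertBasis ℂ K
  have hsqrt : ∀ k, ∃ v : (spectralIntegral (spectralFamily A) Real.sqrt).domain,
      (v : E) = b k ∧ spectralIntegral (spectralFamily A) Real.sqrt v =
        bandRoot (spectralFamily A) n (b k) := fun k => by
    obtain ⟨hmem, hval⟩ := exists_spectralIntegral_sqrt_bandProj hP n (b k : E)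
    exact ⟨⟨_, hmem⟩, ((hK _).1 (b k).2).symm, hval⟩
  choose v hvb hv using hsqrt
  have hmem : ∀ f, star (opSqrt ρ * bandRoot (spectralFamily A) n) f ∈ K := fun f => by
    rw [star_mul, (isSelfAdjoint_opSqrt ρ).star_eq, (isSelfAdjoint_bandRoot hP n).star_eq, hK,
      mul_apply_eq_comp, ← mul_apply_eq_comp (bandProj _ n), bandProj_mul_bandRoot hP]
  have hortho : Orthonormal ℂ fun k => (v k : E) := by
    simp only [hvb]
    exact b.orthonormal.comp_linearIsometry K.subtypeₗᵢ
  rw [hsSq_eq_tsum_of_mem b _ hmem]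
  simpa only [mul_apply_eq_comp, hv] using
    tsum_le_sandwichTrace (spectralIntegral (spectralFamily A) Real.sqrt) ρ v hortho

end Trace

/-! ## The trace of `A ρ` -/

section Summability

variable {ι F G : Type*} [NormedAddCommGroup F] [NormedAddCommGroup G]

lemma summable_norm_sq {x : ι → F} (h : ∑' i, ‖x i‖ₑ ^ 2 ≠ ∞) : Summable fun i => ‖x i‖ ^ 2 :=
  (ENNReal.summable_toReal h).congr fun i => by rw [ENNReal.toReal_pow, toReal_enorm]

lemma summable_norm_mul {x : ι → F} {y : ι → G} (hx : ∑' i, ‖x i‖ₑ ^ 2 ≠ ∞)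
    (hy : ∑' i, ‖y i‖ₑ ^ 2 ≠ ∞) : Summable fun i => ‖x i‖ * ‖y i‖ := by
  refine .of_nonneg_of_le (fun i => by positivity) (fun i => ?_)
    ((summable_norm_sq hx).add (summable_norm_sq hy))
  nlinarith [sq_nonneg (‖x i‖ - ‖y i‖), sq_nonneg (‖x i‖), sq_nonneg (‖y i‖)]

lemma ne_top_and_eq_toReal_of_tendsto {a : ℕ → ℝ≥0∞} {L : ℝ≥0∞} {z : ℂ} (ha : ∀ n, a n ≠ ∞)
    (hL : Tendsto a atTop (𝓝 L)) (hz : Tendsto (fun n => ((a n).toReal : ℂ)) atTop (𝓝 z)) :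
    L ≠ ∞ ∧ z = (L.toReal : ℂ) := by
  have hre : Tendsto (fun n => (a n).toReal) atTop (𝓝 z.re) :=
    (Complex.continuous_re.tendsto z).comp hz
  have hL' : L = ENNReal.ofReal z.re :=
    tendsto_nhds_unique hL
      ((ENNReal.tendsto_ofReal hre).congr fun n => ENNReal.ofReal_toReal (ha n))
  refine ⟨hL' ▸ ENNReal.ofReal_ne_top, ?_⟩
  rw [hL', ENNReal.toReal_ofReal (ge_of_tendsto' hre fun n => ENNReal.toReal_nonneg)]
  exact tendsto_nhds_unique hz ((Complex.continuous_ofReal.tendsto _).comp hre)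

end Summability

section TraceClass

variable {E : Type*} [NormedAddCommGroup E] [InnerProductSpace ℂ E] [CompleteSpace E]

lemma hsSq_mul_ne_top_left (S : E →L[ℂ] E) {T : E →L[ℂ] E} (hT : hsSq T ≠ ∞) :
    hsSq (S * T) ≠ ∞ := by
  refine ne_top_of_le_ne_top (b := ‖S‖ₑ ^ 2 * hsSq T)
    (ENNReal.mul_ne_top (ENNReal.pow_ne_top enorm_ne_top) hT) ?_
  rw [hsSq, hsSq, formTrace, formTrace, ← ENNReal.tsum_mul_left]
  refine ENNReal.tsum_le_tsum fun i => ?_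
  rw [mul_apply_eq_comp, ← mul_pow]
  exact pow_le_pow_left' (S.le_opENorm _) 2

lemma hsSq_mul_ne_top_right {S : E →L[ℂ] E} (T : E →L[ℂ] E) (hS : hsSq S ≠ ∞) :
    hsSq (S * T) ≠ ∞ := by
  rw [← hsSq_star, star_mul]
  exact hsSq_mul_ne_top_left _ (by rwa [hsSq_star])

/-- The complex trace of a trace class operator, as the sum of its diagonal entries; it is `0` by
convention if that sum does not converge. -/
def diagSum (T : E →L[ℂ] E) : ℂ := ∑' i, inner ℂ (stdBasis E i) (T (stdBasis E i))

lemma summable_diag_mul {S T : E →L[ℂ] E} (hS : hsSq S ≠ ∞) (hT : hsSq T ≠ ∞) :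
    Summable fun i => inner ℂ (stdBasis E i) ((S * T) (stdBasis E i)) := by
  refine .of_norm_bounded (summable_norm_mul ((hsSq_star S).trans_ne hS) hT) fun i => ?_
  rw [mul_apply_eq_comp, ← ContinuousLinearMap.adjoint_inner_left,
    ← ContinuousLinearMap.star_eq_adjoint]
  exact norm_inner_le_norm _ _

lemma diagSum_mul_eq_tsum (S T : E →L[ℂ] E) : diagSum (S * T) = ∑' i, ∑' j,
    inner ℂ (stdBasis E i) (S (stdBasis E j)) * inner ℂ (stdBasis E j) (T (stdBasis E i)) := by
  refine tsum_congr fun i => ?_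
  rw [mul_apply_eq_comp, ← ContinuousLinearMap.adjoint_inner_left,
    ← (stdBasis E).tsum_inner_mul_inner]
  exact tsum_congr fun j => by rw [ContinuousLinearMap.adjoint_inner_left]

lemma hsSq_eq_tsum_prod (T : E →L[ℂ] E) : hsSq T = ∑' p : basisIndex E × basisIndex E,
    ‖inner ℂ (stdBasis E p.2) (T (stdBasis E p.1))‖ₑ ^ 2 := by
  rw [ENNReal.tsum_prod (f := fun i j => ‖inner ℂ (stdBasis E j) (T (stdBasis E i))‖ₑ ^ 2)]
  simp only [← enorm_sq_eq_tsum (stdBasis E)]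
  rfl

lemma diagSum_mul_comm {S T : E →L[ℂ] E} (hS : hsSq S ≠ ∞) (hT : hsSq T ≠ ∞) :
    diagSum (S * T) = diagSum (T * S) := by
  rw [diagSum_mul_eq_tsum, diagSum_mul_eq_tsum]
  have hsum : Summable (Function.uncurry fun i j : basisIndex E =>
      inner ℂ (stdBasis E i) (S (stdBasis E j)) * inner ℂ (stdBasis E j) (T (stdBasis E i))) := by
    rw [hsSq_eq_tsum_prod, ← (Equiv.prodComm _ _).tsum_eq] at hS
    rw [hsSq_eq_tsum_prod] at hT
    exact .of_norm_bounded (summable_norm_mul hS hT) fun p => (norm_mul _ _).le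
  rw [← hsum.tsum_comm]
  exact tsum_congr fun i => tsum_congr fun j => mul_comm _ _

lemma diagSum_star_mul_self (T : E →L[ℂ] E) : diagSum (star T * T) = ((hsSq T).toReal : ℂ) := by
  rw [hsSq, formTrace, ENNReal.tsum_toReal_eq fun i => ENNReal.pow_ne_top enorm_ne_top,
    Complex.ofReal_tsum]
  refine tsum_congr fun i => ?_
  rw [mul_apply_eq_comp, ContinuousLinearMap.star_eq_adjoint,
    ContinuousLinearMap.adjoint_inner_right, inner_self_eq_norm_sq_to_K, ENNReal.toReal_pow,
    toReal_enorm, Complex.ofReal_pow]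
  rfl

lemma hsSq_ne_top_of_star_mul_self_eq {R S T : E →L[ℂ] E} (h : star R * R = S * T)
    (hS : hsSq S ≠ ∞) (hT : hsSq T ≠ ∞) : hsSq R ≠ ∞ := by
  rw [← trace_star_mul_self, h]
  exact (Complex.hasSum_re (summable_diag_mul hS hT).hasSum).summable.tsum_ofReal_ne_top

lemma tendsto_diagSum_mul {S T Q : E →L[ℂ] E} {Qn : ℕ → E →L[ℂ] E} (hS : hsSq S ≠ ∞)
    (hT : hsSq T ≠ ∞) (hle : ∀ n f, ‖Qn n f‖ ≤ ‖f‖)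
    (hlim : ∀ f, Tendsto (fun n => Qn n f) atTop (𝓝 (Q f))) :
    Tendsto (fun n => diagSum (S * (Qn n * T))) atTop (𝓝 (diagSum (S * (Q * T)))) := by
  refine tendsto_tsum_of_dominated_convergence
    (summable_norm_mul ((hsSq_star S).trans_ne hS) hT) (fun i => ?_)
    (.of_forall fun n i => ?_)
  · exact tendsto_const_nhds.inner ((S.continuous.tendsto _).comp (hlim _))
  · rw [mul_apply_eq_comp, ← ContinuousLinearMap.adjoint_inner_left,
      ← ContinuousLinearMap.star_eq_adjoint]
    exact (norm_inner_le_norm _ _).trans (by gcongr; exact hle n _)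

end TraceClass

section TraceFormula

variable {E : Type*} [NormedAddCommGroup E] [InnerProductSpace ℂ E] [CompleteSpace E]
variable {A : E →ₗ.[ℂ] E} {ρ U V : E →L[ℂ] E}

lemma star_mul_self_opSqrt_mul_bandRoot (hA : Dense (A.domain : Set E))
    (hP : IsSpectralFamily (spectralFamily A)) (hPA : IsSpectralIntegral (spectralFamily A) id A)
    (hneg : ∀ t < 0, spectralFamily A t = 0) (hρ : ρ.IsPositive)
    (hT : ∀ f, ∃ h : ρ f ∈ A.domain, A ⟨ρ f, h⟩ = (U * V) f) (n : ℕ) :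
    star (opSqrt ρ * bandRoot (spectralFamily A) n) * (opSqrt ρ * bandRoot (spectralFamily A) n) =
      (bandInvRoot (spectralFamily A) n * U) * (V * bandRoot (spectralFamily A) n) := by
  have hbandρ : bandRoot (spectralFamily A) n * ρ = bandInvRoot (spectralFamily A) n * (U * V) := by
    ext f
    obtain ⟨hmem, hval⟩ := hT f
    rw [mul_apply_eq_comp, mul_apply_eq_comp, ← hval, bandInvRoot_apply hA hP hPA hneg]
  calc _ = bandRoot (spectralFamily A) n * (opSqrt ρ * opSqrt ρ) *
        bandRoot (spectralFamily A) n := by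
        rw [star_mul, (isSelfAdjoint_opSqrt ρ).star_eq, (isSelfAdjoint_bandRoot hP n).star_eq]
        simp only [mul_assoc]
    _ = _ := by
        rw [opSqrt_mul_self ρ hρ, hbandρ]
        simp only [mul_assoc]

lemma proj_zero_apply {P : ℝ → E →L[ℂ] E} (hA : Dense (A.domain : Set E)) (hP : IsSpectralFamily P)
    (hPA : IsSpectralIntegral P id A) (hneg : ∀ t < 0, P t = 0) (f : A.domain) :
    P 0 (A f) = 0 := by
  obtain rfl := eq_spectralIntegral_max hA hP hPA hneg
  exact proj_zero_spectralIntegral hP (by fun_prop) (fun t ht => max_eq_right ht) f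

/-- With `S_n = ρ^{1/2} A_n^{1/2}` for the truncations `A_n` of `A`, one has
`S_n* S_n = (A_n^{-1/2} U)(V A_n^{1/2})`, whose trace is that of `V χ_n U` by cyclicity. -/
theorem formTrace_eq_diagSum (hA : Dense (A.domain : Set E))
    (hP : IsSpectralFamily (spectralFamily A)) (hPA : IsSpectralIntegral (spectralFamily A) id A)
    (hneg : ∀ t < 0, spectralFamily A t = 0) (hρ : ρ.IsPositive) (hU : hsSq U ≠ ∞)
    (hV : hsSq V ≠ ∞) (hT : ∀ f, ∃ h : ρ f ∈ A.domain, A ⟨ρ f, h⟩ = (U * V) f) :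
    formTrace (sandwichForm A ρ) ≠ ∞ ∧
      diagSum (U * V) = ((formTrace (sandwichForm A ρ)).toReal : ℂ) := by
  have hfactor := star_mul_self_opSqrt_mul_bandRoot hA hP hPA hneg hρ hT
  have hCU := fun n => hsSq_mul_ne_top_left (bandInvRoot (spectralFamily A) n) hU
  have hVB := fun n => hsSq_mul_ne_top_right (bandRoot (spectralFamily A) n) hV
  have hmono : Monotone fun n => hsSq (opSqrt ρ * bandRoot (spectralFamily A) n) := by
    simp only [hsSq_mul_comm_of_isSelfAdjoint (isSelfAdjoint_opSqrt ρ)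
      (isSelfAdjoint_bandRoot hP _)]
    exact fun m n h => ENNReal.tsum_le_tsum fun i => monotone_enorm_sq_bandRoot hP _ h
  have htrace : ∀ n, ((hsSq (opSqrt ρ * bandRoot (spectralFamily A) n)).toReal : ℂ) =
      diagSum (V * (bandProj (spectralFamily A) n * U)) := fun n => by
    rw [← diagSum_star_mul_self, hfactor, diagSum_mul_comm (hCU n) (hVB n),
      ← bandRoot_mul_bandInvRoot hP]
    simp only [mul_assoc]
  have hUV : diagSum (V * ((1 - spectralFamily A 0) * U)) = diagSum (U * V) := by
    have hrange : spectralFamily A 0 * (U * V) = 0 := by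
      ext f
      obtain ⟨hmem, hval⟩ := hT f
      rw [mul_apply_eq_comp, ← hval, proj_zero_apply hA hP hPA hneg, zero_apply]
    rw [diagSum_mul_comm hV (hsSq_mul_ne_top_left _ hU), mul_assoc, sub_mul, one_mul, hrange,
      sub_zero]
  refine ne_top_and_eq_toReal_of_tendsto
    (fun n => hsSq_ne_top_of_star_mul_self_eq (hfactor n) (hCU n) (hVB n)) ?_ ?_
  · rw [formTrace_sandwichForm hP]
    exact tendsto_atTop_iSup hmono
  · simp only [htrace, ← hUV]
    exact tendsto_diagSum_mul hV hU (norm_bandProj_apply_le hP) (tendsto_bandProj hP)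

end TraceFormula

end MixedState

end

theorem mainTheorem2 {X : Type*} [MeasurableSpace X] (μ : Measure X) [SigmaFinite μ]
    {H : Type*} [NormedAddCommGroup H] [InnerProductSpace ℂ H] [CompleteSpace H]
    (A : Lp H 2 μ →ₗ.[ℂ] Lp H 2 μ) (hA : IsSelfAdjoint A)
    (hpos : ∀ f : A.domain, 0 ≤ (inner ℂ (f : Lp H 2 μ) (A f)).re)
    (hF : ∀ l : ℝ, MixedState.spectralDensity A l ≠ ∞)
    (hG : ∀ l : ℝ, MixedState.stieltjesG A l ≠ ∞)
    (ρ : Lp H 2 μ →L[ℂ] Lp H 2 μ) (hρ : ρ.IsPositive)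
    (hker : ∀ f : A.domain, A f = 0 → ρ (f : Lp H 2 μ) = 0) :
    -- the inequality, where `𝓔(ρ) = τ(ρ^{1/2} A ρ^{1/2})`
    ∫⁻ x, MixedState.invG A
        (MixedState.densityFun ρ x / (4 * MixedState.formNorm (MixedState.sandwichForm A ρ)))
        ∂(MixedState.densityMeasure ρ)
      ≤ 4 * MixedState.formTrace (MixedState.sandwichForm A ρ) ∧
    -- `τ(ρ^{1/2} A ρ^{1/2}) = τ(A^{1/2} ρ A^{1/2})`
    MixedState.formTrace (MixedState.sandwichForm A ρ)
      = MixedState.sandwichTrace (MixedState.sqrtOp A) ρ ∧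
    -- `τ(ρ^{1/2} A ρ^{1/2}) = τ(A ρ)`, whenever `A ρ` is trace class
    (∀ T : Lp H 2 μ →L[ℂ] Lp H 2 μ,
      (∀ f, ∃ h : ρ f ∈ A.domain, A ⟨ρ f, h⟩ = T f) → MixedState.IsTraceClass T →
      MixedState.formTrace (MixedState.sandwichForm A ρ) ≠ ∞ ∧
      HasSum (fun i => inner ℂ (MixedState.stdBasis (Lp H 2 μ) i)
          (T (MixedState.stdBasis (Lp H 2 μ) i)))
        ((MixedState.formTrace (MixedState.sandwichForm A ρ)).toReal : ℂ)) := by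
  obtain ⟨hP, hPA⟩ := MixedState.isSpectralFamily_spectralFamily hA hpos
  have hdense := hA.dense_domain
  have hneg := fun t ht => MixedState.proj_eq_zero_of_neg hP hPA hpos (t := t) ht
  have hr := MixedState.proj_zero_opSqrt hdense hP hPA hneg hρ hker
  refine ⟨MixedState.lintegral_invG_le hP hneg hF hG hr,
    (MixedState.le_sandwichTrace hP ρ).antisymm (MixedState.sandwichTrace_le hP ρ), ?_⟩
  rintro T hT ⟨U, V, hU, hV, rfl⟩
  obtain ⟨hfin, heq⟩ := MixedState.formTrace_eq_diagSum hdense hP hPA hneg hρ hU hV hT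
  exact ⟨hfin, heq ▸ (MixedState.summable_diag_mul hU hV).hasSum⟩
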